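/- Let $\mathfrak g$ be a finite dimensional simple complex Lie algebra with Cartan subalgebra $\mathfrak h$, simple roots $\alpha_1,\dots,\alpha_r$, positive roots $\Delta_+$, Chevalley generators $e_j,f_j,h_j$, $\mathfrak n_\pm=\bigoplus_{\alpha\in\Delta_+}\mathfrak g_{\pm\alpha}$ and $\rho=\frac12\sum_{\alpha\in\Delta_+}\alpha$. Let $a$ be the antipode of $U(\mathfrak g)$, $\omega$ the Chevalley involution ($e_j\mapsto -f_j$, $f_j\mapsto -e_j$, $h_j\mapsto -h_j$), $\gamma:U(\mathfrak g)\to U(\mathfrak h)=\mathbb C[\mathfrak h^*]$ the projection along $\mathfrak n_-U(\mathfrak g)+U(\mathfrak g)\mathfrak n_+$, and $S_\mu(g_1,g_2)=\gamma(a\omega(g_1)g_2)(\mu)$ for $\mu\in\mathfrak h^*$. Let $V=V_1\otimes\cdots\otimes V_n$, $n\ge 1$, where $V_p$ is a highest weight $\mathfrak g$-module with highest weight $\Lambda_p$ and highest weight vector $v_p$, with its Shapovalov form $S(g_1v_p,g_2v_p)=S_{\Lambda_p}(g_1,g_2)$; let $S$ on $V$ be the product of these forms. Let $V[\nu]$ be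 the weight $\nu$ subspace of $V$ and let $V[0]_\mu$ be the space of all $u\in V[0]$ annihilated by the ideal $I_\mu\subset U(\mathfrak n_+)$, where $I_\mu$ is the annihilator of the lowest weight vector $\mathbf 1_\mu^*$ of the restricted dual of the Verma module $M_\mu$. For $u\in V[0]_\mu$, let $\mathrm X_\mu(u)$ be the set of all $w=\sum_jF_j\otimes u_j$ (finite sums) of weight zero in $U(\mathfrak n_-)\otimes V$ with $$\sum_j S_\mu(x,F_j)\,u_j=\omega(x)u\qquad\text{for all }x\in U(\mathfrak n_-).$$ When $S_\mu$ is nondegenerate on $U(\mathfrak n_-)$, its only element is $\Xi(\mu)(1\otimes u)=\sum_{j,k}(S_\mu^{-1})_{jk}F_j\otimes\omega(F_k)u$, where $\{F_j\}$ is a homogeneous basis of $U(\mathfrak n_-)$. For $\lambda\in\mathfrak h$ put $X_\beta(\lambda)=e^{-2\pi i\beta(\lambda)}$, and let $A_{X}=A_{X(\lambda)}$ be the linear map on $U(\mathfrak n_-)$ such that, for $\beta_k\in\Delta_+$ and $F_k\in\mathfrak g_{-\beta_k}$, $$A_X(F_1\cdots F_m)=\sum_{\sigma\in S_m}\ \prod_{k=1}^m\frac{X_{\beta_{\sigma(k)}}^{a_k^\sigma+1}}{1-X_{\beta_{\sigma(1)}}\cdots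 X_{\beta_{\sigma(k)}}}\;F_{\sigma(1)}\cdots F_{\sigma(m)},\qquad a_k^\sigma=\#\{j: k\le j<m,\ \sigma(j)>\sigma(j+1)\}.$$ For $\xi\in\mathfrak h^*$ and $w=\sum_jF_j\otimes u_j$ put $\psi^\xi_w(\lambda)=e^{2\pi i\xi(\lambda)}\sum_jA_{X(\lambda)}(F_j)u_j$ and $\mathcal Q(w)=\sum_ja(F_j)u_j$. If $w=\Xi(\xi-\rho)(1\otimes u)$, these are the trigonometric KZB eigenfunction $\psi_u^\xi$ and the vector $\mathcal Q(\xi)u$. For $V$-valued functions $\psi_1,\psi_2$ on $\mathfrak h$ let $$\langle\psi_1,\psi_2\rangle=\int_CS(\psi_1(\lambda),\psi_2(-\lambda))\,d\lambda_1\cdots d\lambda_r,$$ where on $C$ each $\lambda_j=\alpha_j(\lambda)$ ranges over the interval from $0-i\delta$ to $1-i\delta$, with $\delta>0$. **Proposition.** Let $\xi\in\mathfrak h^*$. 1. For every $u\in V[0]_{\xi-\rho}$ the set $\mathrm X_{\xi-\rho}(u)$ is not empty, and if the rational function $\mu\mapsto\Xi(\mu)(1\otimes u)$ (given by the formula above when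 $(\mu+\rho)(\alpha^\vee)\neq k$ for all $\alpha\in\Delta_+$ and all integers $k\ge1$) is regular at $\mu=\xi-\rho$, then its value there belongs to $\mathrm X_{\xi-\rho}(u)$. 2. For all $u,v\in V[0]_{\xi-\rho}$, all $w_u\in\mathrm X_{\xi-\rho}(u)$, all $w_v,w_v'\in\mathrm X_{\xi-\rho}(v)$ and all $\delta>0$, the integral converges and $$\langle\psi^\xi_{w_u},\psi^\xi_{w_v}\rangle=S(u,\mathcal Q(w_v')).$$ In particular, $\langle\psi_u^\xi,\psi_v^\xi\rangle=\langle u,v\rangle_\xi:=S(u,\mathcal Q(\xi)v)$ whenever $\Xi(\cdot)(1\otimes u)$ and $\Xi(\cdot)(1\otimes v)$ are regular at $\xi-\rho$; and for all $u,v\in V[0]_{\xi-\rho}$ the same identity holds for every choice of $w_u,w_v$ in place of $\Xi(\xi-\rho)(1\otimes u)$, $\Xi(\xi-\rho)(1\otimes v)$, the right side not depending on the choice. -/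

import Mathlib

open scoped TensorProduct

namespace TrigKZB

/- Associative algebras are regarded as Lie algebras through the commutator. -/
attribute [local instance 100] LieRing.ofAssociativeRing

/-- The element singled out by a property that at most one element is meant to satisfy
(and `0` if there is none). It is used below only for objects that exist and are unique. -/
noncomputable def theElement {M : Type*} [Zero M] (P : M → Prop) : M :=
  open Classical in if h : ∃ x, P x then h.choose else 0

theorem theElement_spec {M : Type*} [Zero M] {P : M → Prop} (h : ∃ x, P x) :
    P (theElement P) := by
  unfold theElement
  rw [dif_pos h]
  exact h.choose_spec

/-! ### Enveloping algebras -/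

section Enveloping

variable {L : Type*} [LieRing L] [LieAlgebra ℂ L]

/-- The antipode of `U(L)`: the anti-automorphism with `a(x) = -x` for `x ∈ L`. -/
noncomputable def antipode (L : Type*) [LieRing L] [LieAlgebra ℂ L] :
    UniversalEnvelopingAlgebra ℂ L →ₗ[ℂ] UniversalEnvelopingAlgebra ℂ L :=
  (MulOpposite.opLinearEquiv ℂ).symm.toLinearMap ∘ₗ
    (UniversalEnvelopingAlgebra.lift ℂ
      { toFun := fun x => MulOpposite.op (-UniversalEnvelopingAlgebra.ι ℂ x)
        map_add' := fun x y => by rw [map_add, neg_add, MulOpposite.op_add]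
        map_smul' := fun c x => by
          rw [map_smul, ← smul_neg, MulOpposite.op_smul, RingHom.id_apply]
        map_lie' := fun {x y} => by
          rw [LieHom.map_lie, LieRing.of_associative_ring_bracket,
            LieRing.of_associative_ring_bracket, ← MulOpposite.op_mul, ← MulOpposite.op_mul,
            ← MulOpposite.op_sub]
          congr 1
          noncomm_ring } :
      UniversalEnvelopingAlgebra ℂ L →ₐ[ℂ] (UniversalEnvelopingAlgebra ℂ L)ᵐᵒᵖ).toLinearMap

theorem antipode_one : antipode L 1 = 1 := by
  simp [antipode]

theorem antipode_ι (x : L) :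
    antipode L (UniversalEnvelopingAlgebra.ι ℂ x) = -UniversalEnvelopingAlgebra.ι ℂ x := by
  simp [antipode]

theorem antipode_mul (x y : UniversalEnvelopingAlgebra ℂ L) :
    antipode L (x * y) = antipode L y * antipode L x := by
  simp [antipode]

/-- The algebra map `U(n) → U(L)` of a Lie subalgebra `n` of `L`. -/
noncomputable def envIncl (n : LieSubalgebra ℂ L) :
    UniversalEnvelopingAlgebra ℂ n →ₐ[ℂ] UniversalEnvelopingAlgebra ℂ L :=
  UniversalEnvelopingAlgebra.lift ℂ ((UniversalEnvelopingAlgebra.ι ℂ).comp n.incl)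

variable {M : Type*} [AddCommGroup M] [Module ℂ M]

/-- The action of `U(L)` on a representation of `L`. -/
noncomputable def envAct (π : L →ₗ⁅ℂ⁆ Module.End ℂ M) :
    UniversalEnvelopingAlgebra ℂ L →ₐ[ℂ] Module.End ℂ M :=
  UniversalEnvelopingAlgebra.lift ℂ π

end Enveloping

/-! ### Tensor products of representations -/

section Tensor

variable {L : Type*} [LieRing L] [LieAlgebra ℂ L] {n : ℕ} (V : Fin n → Type*)
  [∀ p, AddCommGroup (V p)] [∀ p, Module ℂ (V p)]

/-- `x⁽ᵖ⁾`: the endomorphism `x` acting on the factor `p` of the tensor product. -/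
noncomputable def factorEnd (p : Fin n) :
    Module.End ℂ (V p) →ₗ[ℂ] Module.End ℂ (⨂[ℂ] q, V q) :=
  (PiTensorProduct.mapMultilinear ℂ V V).toLinearMap (fun _ => LinearMap.id) p

theorem factorEnd_mul (p : Fin n) (x y : Module.End ℂ (V p)) :
    factorEnd V p (x * y) = factorEnd V p x * factorEnd V p y := by
  ext t
  simp only [factorEnd, MultilinearMap.toLinearMap_apply, PiTensorProduct.mapMultilinear_apply,
    LinearMap.compMultilinearMap_apply, PiTensorProduct.map_tprod, Module.End.mul_apply]
  congr 1
  ext q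
  by_cases h : q = p
  · subst h; simp
  · simp [Function.update_of_ne h]

theorem factorEnd_comm {p q : Fin n} (h : p ≠ q) (x : Module.End ℂ (V p))
    (y : Module.End ℂ (V q)) :
    factorEnd V p x * factorEnd V q y = factorEnd V q y * factorEnd V p x := by
  ext t
  simp only [factorEnd, MultilinearMap.toLinearMap_apply, PiTensorProduct.mapMultilinear_apply,
    LinearMap.compMultilinearMap_apply, PiTensorProduct.map_tprod, Module.End.mul_apply]
  congr 1
  ext s
  by_cases h1 : s = p
  · subst h1
    simp [Function.update_of_ne h]
  · by_cases h2 : s = q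
    · subst h2
      simp [Function.update_of_ne h1]
    · simp [Function.update_of_ne h1, Function.update_of_ne h2]

variable [∀ p, LieRingModule L (V p)] [∀ p, LieModule ℂ L (V p)]

/-- The tensor product representation: `x` acts on `V₁ ⊗ ⋯ ⊗ Vₙ` by `∑ₚ x⁽ᵖ⁾`. -/
noncomputable def tensorRep (L : Type*) [LieRing L] [LieAlgebra ℂ L]
    [∀ p, LieRingModule L (V p)] [∀ p, LieModule ℂ L (V p)] :
    L →ₗ⁅ℂ⁆ Module.End ℂ (⨂[ℂ] q, V q) where
  toFun x := ∑ p, factorEnd V p (LieModule.toEnd ℂ L (V p) x)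
  map_add' x y := by simp only [map_add, Finset.sum_add_distrib]
  map_smul' c x := by simp only [map_smul, Finset.smul_sum, RingHom.id_apply]
  map_lie' {x y} := by
    simp only [LieHom.map_lie, LieRing.of_associative_ring_bracket, map_sub, factorEnd_mul,
      Finset.sum_mul_sum]
    rw [Finset.sum_comm (s := Finset.univ) (t := Finset.univ)
      (f := fun i j => factorEnd V i (LieModule.toEnd ℂ L (V i) y) *
        factorEnd V j (LieModule.toEnd ℂ L (V j) x)), ← Finset.sum_sub_distrib]
    refine Finset.sum_congr rfl fun p _ => ?_
    rw [← Finset.sum_sub_distrib, Finset.sum_eq_single p]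
    · intro q _ hq
      rw [factorEnd_comm V hq.symm, sub_self]
    · simp

/-- The product of bilinear forms on the factors. -/
noncomputable def tensorForm (B : ∀ p, V p →ₗ[ℂ] V p →ₗ[ℂ] ℂ) :
    (⨂[ℂ] q, V q) →ₗ[ℂ] (⨂[ℂ] q, V q) →ₗ[ℂ] ℂ :=
  LinearMap.compr₂ (PiTensorProduct.map₂ B)
    (PiTensorProduct.lift (MultilinearMap.mkPiAlgebra ℂ (Fin n) ℂ))

theorem tensorForm_tprod (B : ∀ p, V p →ₗ[ℂ] V p →ₗ[ℂ] ℂ) (x y : ∀ p, V p) :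
    tensorForm V B (PiTensorProduct.tprod ℂ x) (PiTensorProduct.tprod ℂ y) =
      ∏ p, B p (x p) (y p) := by
  simp [tensorForm, PiTensorProduct.map₂_tprod_tprod]

end Tensor

/-! ### Simple Lie algebras, the Shapovalov form -/

section Simple

variable {𝔤 : Type*} [LieRing 𝔤] [LieAlgebra ℂ 𝔤] [FiniteDimensional ℂ 𝔤]
  [LieAlgebra.IsSimple ℂ 𝔤] {H : LieSubalgebra ℂ 𝔤} {ι : Type*} [Fintype ι]

/-- The Chevalley generators `(-hᵢ, -fᵢ, -eᵢ)` in place of `(hᵢ, eᵢ, fᵢ)`. -/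
noncomputable def oppositeGenerators (b : LieAlgebra.Basis ι H) : LieAlgebra.Basis ι H where
  A := b.A
  h := -b.h
  e := -b.f
  f := -b.e
  cartan_eq_lieSpan := b.symm.cartan_eq_lieSpan
  span_ef := by
    have h := b.span_ef
    rw [eq_top_iff, ← h, LieSubalgebra.lieSpan_le]
    rintro x (⟨i, rfl⟩ | ⟨i, rfl⟩)
    · rw [← neg_neg (b.e i)]
      exact neg_mem (LieSubalgebra.subset_lieSpan (Or.inr ⟨i, rfl⟩))
    · rw [← neg_neg (b.f i)]
      exact neg_mem (LieSubalgebra.subset_lieSpan (Or.inl ⟨i, rfl⟩))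
  linInd := b.linInd.neg
  nondegen := b.nondegen
  sl2 i := by
    have h := (b.sl2 i).symm
    refine ⟨h.h_ne_zero, ?_, ?_, ?_⟩
    · simpa using h.lie_e_f
    · have h2 := h.lie_h_e_nsmul
      simp only [Pi.neg_apply, neg_lie, lie_neg, smul_neg, neg_neg] at h2 ⊢
      rw [← h2, neg_neg]
    · have h2 := h.lie_h_f_nsmul
      simp only [Pi.neg_apply, neg_lie, lie_neg, smul_neg, neg_neg] at h2 ⊢
      rw [← neg_eq_iff_eq_neg.mpr h2, neg_neg]
  lie_h_h i j := by simp [b.lie_h_h]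
  lie_h_e i j := by simp [b.lie_h_f]
  lie_h_f i j := by simp [b.lie_h_e]
  lie_e_f_ne i j h := by simpa using b.symm.lie_e_f_ne i j h

/-- The Chevalley involution of `𝔤`: the automorphism given on the Chevalley generators by
`eᵢ ↦ -fᵢ`, `fᵢ ↦ -eᵢ`, `hᵢ ↦ -hᵢ` (see the three lemmas below). -/
noncomputable def chevalley (b : LieAlgebra.Basis ι H) : 𝔤 ≃ₗ⁅ℂ⁆ 𝔤 :=
  LieAlgebra.Basis.equivOfReindex (Equiv.refl ι) b (oppositeGenerators b) rfl

theorem symm_trans_apply {P A B : Type*} [LieRing P] [LieAlgebra ℂ P] [LieRing A]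
    [LieAlgebra ℂ A] [LieRing B] [LieAlgebra ℂ B] (e : P ≃ₗ⁅ℂ⁆ A) (f : P ≃ₗ⁅ℂ⁆ B) (p : P)
    {x : A} {y : B} (hx : e p = x) (hy : f p = y) : (e.symm.trans f) x = y := by
  subst hx hy
  simp [LieEquiv.trans_apply]

theorem chevalley_e (b : LieAlgebra.Basis ι H) (i : ι) : chevalley b (b.e i) = -b.f i := by
  unfold chevalley LieAlgebra.Basis.equivOfReindex
  refine symm_trans_apply _ _ ⟨(b.e i, -b.f i), ?_⟩ rfl rfl
  exact LieSubalgebra.subset_lieSpan (Or.inl (Or.inr ⟨i, rfl⟩))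

theorem chevalley_f (b : LieAlgebra.Basis ι H) (i : ι) : chevalley b (b.f i) = -b.e i := by
  unfold chevalley LieAlgebra.Basis.equivOfReindex
  refine symm_trans_apply _ _ ⟨(b.f i, -b.e i), ?_⟩ rfl rfl
  exact LieSubalgebra.subset_lieSpan (Or.inr ⟨i, rfl⟩)

theorem chevalley_h (b : LieAlgebra.Basis ι H) (i : ι) : chevalley b (b.h i) = -b.h i := by
  rw [← (b.sl2 i).lie_e_f, LieEquiv.map_lie, chevalley_e, chevalley_f, neg_lie, lie_neg, neg_neg,
    lie_skew]

/-- The Chevalley involution `ω` of `U(𝔤)`. -/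
noncomputable def omega (b : LieAlgebra.Basis ι H) :
    UniversalEnvelopingAlgebra ℂ 𝔤 →ₐ[ℂ] UniversalEnvelopingAlgebra ℂ 𝔤 :=
  UniversalEnvelopingAlgebra.lift ℂ
    ((UniversalEnvelopingAlgebra.ι ℂ).comp (chevalley b : 𝔤 →ₗ⁅ℂ⁆ 𝔤))

variable [H.IsCartanSubalgebra]

/-- The positive roots: the roots in `⨁ ℕ αᵢ`, where `αᵢ = b.baseSupp i` are the simple roots. -/
noncomputable def posRoots (b : LieAlgebra.Basis ι H) : Finset (LieModule.Weight ℂ H 𝔤) :=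
  open Classical in
  H.root.filter fun α => ∃ m : ι → ℕ, α.toLinear = ∑ i, m i • b.baseSupp i

/-- `ρ`, the half sum of the positive roots. -/
noncomputable def rho (b : LieAlgebra.Basis ι H) : Module.Dual ℂ H :=
  (1 / 2 : ℂ) • ∑ α ∈ posRoots b, α.toLinear

/-- `𝔫₊`, the Lie subalgebra made of the positive root spaces. -/
noncomputable def nPlus (b : LieAlgebra.Basis ι H) : LieSubalgebra ℂ 𝔤 :=
  LieSubalgebra.lieSpan ℂ 𝔤 {x | ∃ α ∈ posRoots b, x ∈ LieAlgebra.rootSpace H (α : H → ℂ)}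

/-- `𝔫₋`, the Lie subalgebra made of the negative root spaces. -/
noncomputable def nMinus (b : LieAlgebra.Basis ι H) : LieSubalgebra ℂ 𝔤 :=
  LieSubalgebra.lieSpan ℂ 𝔤 {x | ∃ α ∈ posRoots b, x ∈ LieAlgebra.rootSpace H (-(α : H → ℂ))}

/-- `U(𝔫₋)`. -/
abbrev UMinus (b : LieAlgebra.Basis ι H) : Type _ := UniversalEnvelopingAlgebra ℂ (nMinus b)

/-- The projection `γ : U(𝔤) → U(𝔥)` along `𝔫₋ U(𝔤) + U(𝔤) 𝔫₊`. -/
noncomputable def gammaProj (b : LieAlgebra.Basis ι H) :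
    UniversalEnvelopingAlgebra ℂ 𝔤 →ₗ[ℂ] UniversalEnvelopingAlgebra ℂ H :=
  theElement fun γ : UniversalEnvelopingAlgebra ℂ 𝔤 →ₗ[ℂ] UniversalEnvelopingAlgebra ℂ H =>
    (∀ x, γ (envIncl H x) = x) ∧
    (∀ x ∈ nMinus b, ∀ g, γ (UniversalEnvelopingAlgebra.ι ℂ x * g) = 0) ∧
    (∀ x ∈ nPlus b, ∀ g, γ (g * UniversalEnvelopingAlgebra.ι ℂ x) = 0)

/-- Evaluation of `U(𝔥) = ℂ[𝔥*]` at the point `μ` of `𝔥*`. -/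
noncomputable def evalAt (μ : Module.Dual ℂ H) : UniversalEnvelopingAlgebra ℂ H →ₐ[ℂ] ℂ :=
  UniversalEnvelopingAlgebra.lift ℂ (LieAlgebra.lieCharacterEquivLinearDual.symm μ)

/-- The form `S_μ(g₁, g₂) = γ(a ω(g₁) g₂)(μ)` on `U(𝔤)`. -/
noncomputable def shapU (b : LieAlgebra.Basis ι H) (μ : Module.Dual ℂ H)
    (g₁ g₂ : UniversalEnvelopingAlgebra ℂ 𝔤) : ℂ :=
  evalAt μ (gammaProj b (antipode 𝔤 (omega b g₁) * g₂))

/-- The linear form `y ↦ S_μ(x, y)` on `U(𝔫₋)`, for `x ∈ U(𝔫₋)`. -/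
noncomputable def shapMinus (b : LieAlgebra.Basis ι H) (μ : Module.Dual ℂ H) (x : UMinus b) :
    UMinus b →ₗ[ℂ] ℂ :=
  (evalAt μ).toLinearMap ∘ₗ gammaProj b ∘ₗ
    LinearMap.mulLeft ℂ (antipode 𝔤 (omega b (envIncl (nMinus b) x))) ∘ₗ
    (envIncl (nMinus b)).toLinearMap

theorem shapMinus_apply (b : LieAlgebra.Basis ι H) (μ : Module.Dual ℂ H) (x y : UMinus b) :
    shapMinus b μ x y = shapU b μ (envIncl (nMinus b) x) (envIncl (nMinus b) y) := rfl

/-- The left ideal `I_μ` of `U(𝔫₊)` annihilating the lowest weight vector `𝟏_μ^*` of the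
restricted dual of the Verma module `M_μ`. Since `𝟏_μ^*(y 𝟏_μ) = γ(y)(μ)`, the condition
`x 𝟏_μ^* = 0` says that `𝟏_μ^*(a(x) y 𝟏_μ) = γ(a(x) y)(μ)` vanishes for all `y ∈ U(𝔤)`. -/
def annIdeal (b : LieAlgebra.Basis ι H) (μ : Module.Dual ℂ H) :
    Set (UniversalEnvelopingAlgebra ℂ (nPlus b)) :=
  {x | ∀ y, evalAt μ (gammaProj b (antipode 𝔤 (envIncl (nPlus b) x) * y)) = 0}

section Rep

variable {M : Type*} [AddCommGroup M] [Module ℂ M]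

/-- The weight space `M[ν]` of a representation of `𝔤`. -/
def weightSpace (H : LieSubalgebra ℂ 𝔤) (π : 𝔤 →ₗ⁅ℂ⁆ Module.End ℂ M) (ν : Module.Dual ℂ H) :
    Set M :=
  {u | ∀ h : H, π h u = ν h • u}

/-- The subspace `M[ν]_μ` of `M[ν]` annihilated by `I_μ`. -/
def weightSpaceAnn (b : LieAlgebra.Basis ι H) (π : 𝔤 →ₗ⁅ℂ⁆ Module.End ℂ M)
    (ν μ : Module.Dual ℂ H) : Set M :=
  {u | u ∈ weightSpace H π ν ∧ ∀ x ∈ annIdeal b μ, envAct π (envIncl (nPlus b) x) u = 0}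

/-- The weight zero part of `U(𝔫₋) ⊗ M`: it is spanned by the `F₁ ⋯ Fₘ ⊗ x` with
`Fₖ ∈ 𝔤_{-βₖ}`, `βₖ` a positive root, and `x ∈ M[β₁ + ⋯ + βₘ]`. -/
noncomputable def weightZero (b : LieAlgebra.Basis ι H) (π : 𝔤 →ₗ⁅ℂ⁆ Module.End ℂ M) :
    Submodule ℂ (UMinus b ⊗[ℂ] M) :=
  Submodule.span ℂ {w | ∃ (m : ℕ) (β : Fin m → LieModule.Weight ℂ H 𝔤) (F : Fin m → nMinus b)
    (x : M), (∀ k, β k ∈ posRoots b ∧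
        (F k : 𝔤) ∈ LieAlgebra.rootSpace H (-(β k : H → ℂ))) ∧
      x ∈ weightSpace H π (∑ k, (β k).toLinear) ∧
      w = (List.ofFn fun k => UniversalEnvelopingAlgebra.ι ℂ (F k)).prod ⊗ₜ[ℂ] x}

/-- `w = ∑ⱼ Fⱼ ⊗ uⱼ`, of weight zero, is obtained by applying an inverse of the Shapovalov
matrix of `M_μ` to the vectors `ω(F_k) u`, that is `∑ⱼ S_μ(x, Fⱼ) uⱼ = ω(x) u` for all
`x ∈ U(𝔫₋)`. If `S_μ` is nondegenerate, the only such `w` is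
`Ξ(μ)(1 ⊗ u) = ∑ⱼₖ (S_μ⁻¹)ⱼₖ Fⱼ ⊗ ω(F_k) u`; in general `w` is determined up to
`Ker S_μ ⊗ M`. -/
def IsXi (b : LieAlgebra.Basis ι H) (π : 𝔤 →ₗ⁅ℂ⁆ Module.End ℂ M) (μ : Module.Dual ℂ H) (u : M)
    (w : UMinus b ⊗[ℂ] M) : Prop :=
  w ∈ weightZero b π ∧
    ∀ x : UMinus b, TensorProduct.lid ℂ M (LinearMap.rTensor M (shapMinus b μ x) w) =
      envAct π (omega b (envIncl (nMinus b) x)) u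

/-- `μ` is off all hyperplanes `(α, μ + ρ) = (k/2) (α, α)` with `α` a positive root and
`k = 1, 2, …`, that is, `(μ + ρ)(α^∨) ≠ k`. -/
def IsGeneric (b : LieAlgebra.Basis ι H) (μ : Module.Dual ℂ H) : Prop :=
  ∀ α ∈ posRoots b, ∀ k : ℕ, 1 ≤ k → (μ + rho b) (LieAlgebra.IsKilling.coroot α) ≠ (k : ℂ)

/-- The rational function `Ξ(·)(1 ⊗ u)` on `𝔥*` is regular at `μ` with value `w`: for generic `lam`
the vector `Ξ(lam)(1 ⊗ u)` is `q(lam)⁻¹ ∑ᵢ pᵢ(lam) tᵢ` with polynomials `pᵢ`, `q` on `𝔥*`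
(elements of `U(𝔥)`), `tᵢ` fixed, `q(μ) ≠ 0`, and `w` is the value of this expression at `μ`. -/
def IsRegularXiValue (b : LieAlgebra.Basis ι H) (π : 𝔤 →ₗ⁅ℂ⁆ Module.End ℂ M)
    (μ : Module.Dual ℂ H) (u : M) (w : UMinus b ⊗[ℂ] M) : Prop :=
  ∃ (N : ℕ) (q : UniversalEnvelopingAlgebra ℂ H) (p : Fin N → UniversalEnvelopingAlgebra ℂ H)
    (t : Fin N → UMinus b ⊗[ℂ] M),
    evalAt μ q ≠ 0 ∧
    (∀ lam, IsGeneric b lam → evalAt lam q ≠ 0 →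
      IsXi b π lam u ((evalAt lam q)⁻¹ • ∑ i, evalAt lam (p i) • t i)) ∧
    w = (evalAt μ q)⁻¹ • ∑ i, evalAt μ (p i) • t i

/-- `∑ₖ Fₖ ⊗ vₖ ↦ ∑ₖ a(Fₖ) vₖ`. Applied to `Ξ(ξ - ρ)(1 ⊗ v)` it gives `𝒬(ξ) v`. -/
noncomputable def Qvec (b : LieAlgebra.Basis ι H) (π : 𝔤 →ₗ⁅ℂ⁆ Module.End ℂ M) :
    UMinus b ⊗[ℂ] M →ₗ[ℂ] M :=
  TensorProduct.lift ((envAct π).toLinearMap ∘ₗ (envIncl (nMinus b)).toLinearMap ∘ₗ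
    antipode (nMinus b))

end Rep

/-! ### The functions `ψ` and the torus integral -/

/-- `X_β(lam) = exp(-2πi β(lam))`. -/
noncomputable def Xexp (β : LieModule.Weight ℂ H 𝔤) (lam : H) : ℂ :=
  Complex.exp (-2 * Real.pi * Complex.I * β lam)

/-- `a_k^σ`: the number of `j` with `k ≤ j < m` and `σ(j) > σ(j+1)`. -/
def descentCount {m : ℕ} (σ : Equiv.Perm (Fin m)) (k : Fin m) : ℕ :=
  (Finset.univ.filter fun j : Fin m =>
    k ≤ j ∧ ∃ h : (j : ℕ) + 1 < m, σ ⟨(j : ℕ) + 1, h⟩ < σ j).card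

/-- The map `A_X : U(𝔫₋) → U(𝔫₋)` at the point `X = X(lam)`: it is the linear map with
`A_X(F₁ ⋯ Fₘ) = ∑_σ ∏ₖ (X_{β_{σ(k)}}^{a_k^σ + 1} / (1 - X_{β_{σ(1)}} ⋯ X_{β_{σ(k)}}))
F_{σ(1)} ⋯ F_{σ(m)}` for all `Fₖ ∈ 𝔤_{-βₖ}`, `βₖ` positive roots; so `A_X(1) = 1`. -/
noncomputable def AX (b : LieAlgebra.Basis ι H) (lam : H) : UMinus b →ₗ[ℂ] UMinus b :=
  theElement fun A : UMinus b →ₗ[ℂ] UMinus b =>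
    ∀ (m : ℕ) (β : Fin m → LieModule.Weight ℂ H 𝔤) (F : Fin m → nMinus b),
      (∀ k, β k ∈ posRoots b ∧ (F k : 𝔤) ∈ LieAlgebra.rootSpace H (-(β k : H → ℂ))) →
      A (List.ofFn fun k => UniversalEnvelopingAlgebra.ι ℂ (F k)).prod =
        ∑ σ : Equiv.Perm (Fin m),
          (∏ k, Xexp (β (σ k)) lam ^ (descentCount σ k + 1) /
            (1 - ∏ l ∈ Finset.Iic k, Xexp (β (σ l)) lam)) •
          (List.ofFn fun k => UniversalEnvelopingAlgebra.ι ℂ (F (σ k))).prod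

section Rep2

variable {M : Type*} [AddCommGroup M] [Module ℂ M]

/-- The function `lam ↦ exp(2πi ξ(lam)) ∑ⱼ A_{X(lam)}(Fⱼ) uⱼ` on `𝔥` attached to
`w = ∑ⱼ Fⱼ ⊗ uⱼ`; for `w = Ξ(ξ - ρ)(1 ⊗ u)` this is `ψ_u^ξ`. -/
noncomputable def psi (b : LieAlgebra.Basis ι H) (π : 𝔤 →ₗ⁅ℂ⁆ Module.End ℂ M)
    (ξ : Module.Dual ℂ H) (w : UMinus b ⊗[ℂ] M) (lam : H) : M :=
  Complex.exp (2 * Real.pi * Complex.I * ξ lam) •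
    TensorProduct.lift ((envAct π).toLinearMap ∘ₗ (envIncl (nMinus b)).toLinearMap ∘ₗ
      AX b lam) w

end Rep2

/-- `V` is a highest weight module with highest weight `Λ` and highest weight vector `v`. -/
structure IsHighestWeight (b : LieAlgebra.Basis ι H) {V : Type*} [AddCommGroup V] [Module ℂ V]
    [LieRingModule 𝔤 V] [LieModule ℂ 𝔤 V] (Λ : Module.Dual ℂ H) (v : V) : Prop where
  ne_zero : v ≠ 0
  weight : ∀ h : H, ⁅(h : 𝔤), v⁆ = Λ h • v
  singular : ∀ x ∈ nPlus b, ⁅x, v⁆ = 0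
  generates : LieSubmodule.lieSpan ℂ 𝔤 {v} = ⊤

/-- The Shapovalov form of a highest weight module with highest weight `Λ` and highest weight
vector `v`: the bilinear form with `S(g₁ v, g₂ v) = S_Λ(g₁, g₂)` for `g₁, g₂ ∈ U(𝔤)`. -/
noncomputable def shapModule (b : LieAlgebra.Basis ι H) {V : Type*} [AddCommGroup V] [Module ℂ V]
    [LieRingModule 𝔤 V] [LieModule ℂ 𝔤 V] (Λ : Module.Dual ℂ H) (v : V) : V →ₗ[ℂ] V →ₗ[ℂ] ℂ :=
  theElement fun B : V →ₗ[ℂ] V →ₗ[ℂ] ℂ => ∀ g₁ g₂ : UniversalEnvelopingAlgebra ℂ 𝔤,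
    B (envAct (LieModule.toEnd ℂ 𝔤 V) g₁ v) (envAct (LieModule.toEnd ℂ 𝔤 V) g₂ v) =
      shapU b Λ g₁ g₂

/-- The Shapovalov form on `V₁ ⊗ ⋯ ⊗ Vₙ`: the product of the Shapovalov forms of the factors. -/
noncomputable def shapTensor (b : LieAlgebra.Basis ι H) {n : ℕ} (V : Fin n → Type*)
    [∀ p, AddCommGroup (V p)] [∀ p, Module ℂ (V p)] [∀ p, LieRingModule 𝔤 (V p)]
    [∀ p, LieModule ℂ 𝔤 (V p)] (Λ : Fin n → Module.Dual ℂ H) (v : ∀ p, V p) :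
    (⨂[ℂ] p, V p) →ₗ[ℂ] (⨂[ℂ] p, V p) →ₗ[ℂ] ℂ :=
  tensorForm V fun p => shapModule b (Λ p) (v p)

/-- The point of `𝔥` at which the simple roots take the values `c i`. -/
noncomputable def pointOf (b : LieAlgebra.Basis ι H) (c : ι → ℂ) : H :=
  open Classical in ∑ j, (((b.A.map (Int.cast : ℤ → ℂ))⁻¹).mulVec c) j • b.h' j

theorem baseSupp_pointOf (b : LieAlgebra.Basis ι H) (c : ι → ℂ) (i : ι) :
    b.baseSupp i (pointOf b c) = c i := by
  classical
  have hdet : IsUnit (b.A.map (Int.cast : ℤ → ℂ)).det := by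
    have h := b.nondegen.det_ne_zero
    have h2 : (b.A.map (Int.cast : ℤ → ℂ)).det = ((b.A.det : ℤ) : ℂ) :=
      (RingHom.map_det (Int.castRingHom ℂ) b.A).symm
    rw [h2, isUnit_iff_ne_zero]
    exact_mod_cast h
  have h3 : (b.A.map (Int.cast : ℤ → ℂ)).mulVec
      (((b.A.map (Int.cast : ℤ → ℂ))⁻¹).mulVec c) i = c i := by
    rw [Matrix.mulVec_mulVec, Matrix.mul_nonsing_inv _ hdet, Matrix.one_mulVec]
  rw [← h3]
  simp only [pointOf, map_sum, map_smul, LieAlgebra.Basis.baseSupp_apply_h', smul_eq_mul,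
    Matrix.mulVec, dotProduct, Matrix.map_apply]
  refine Finset.sum_congr rfl fun j _ => ?_
  rw [mul_comm]

/-- The point of the cycle `C` with coordinates `lam_j = α_j(lam) = t_j - iδ`, `0 ≤ t_j ≤ 1`. -/
noncomputable def contourPoint (b : LieAlgebra.Basis ι H) (δ : ℝ) (t : ι → ℝ) : H :=
  pointOf b fun j => (t j : ℂ) - Complex.I * δ

/-- The integrand `S(ψ₁(lam), ψ₂(-lam))` along the cycle `C`. -/
noncomputable def integrand (b : LieAlgebra.Basis ι H) {M : Type*} [AddCommGroup M] [Module ℂ M]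
    (S : M →ₗ[ℂ] M →ₗ[ℂ] ℂ) (δ : ℝ) (ψ₁ ψ₂ : H → M) (t : ι → ℝ) : ℂ :=
  S (ψ₁ (contourPoint b δ t)) (ψ₂ (-contourPoint b δ t))

/-- `⟨ψ₁, ψ₂⟩ = ∫_C S(ψ₁(lam), ψ₂(-lam)) dlam₁ ⋯ dlam_r`, where each coordinate
`lam_j = α_j(lam)` runs through the interval from `0 - iδ` to `1 - iδ`. -/
noncomputable def scalarProduct (b : LieAlgebra.Basis ι H) {M : Type*} [AddCommGroup M]
    [Module ℂ M] (S : M →ₗ[ℂ] M →ₗ[ℂ] ℂ) (δ : ℝ) (ψ₁ ψ₂ : H → M) : ℂ :=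
  ∫ t in Set.Icc (0 : ι → ℝ) 1, integrand b S δ ψ₁ ψ₂ t

end Simple

end TrigKZB

/-!
The integral over the contour is a "constant term". On it each `X_{α_i}` has modulus
`e^{-2πδ} < 1`, so the coefficients of `A_X` and of `A_{1/X}` are uniform limits of polynomials in
the `X_{α_i}`, and the integral over the torus sends such a limit to its constant term. This is a
multiplicative functional (`meanAlgebra`, `HasMean`), so the means of `A_X` and `A_{1/X}` can be
taken separately. With `P` the product of the `X`'s up to an index, a permutation contributes to
`A_X` the factors `P / (1 - P)` at descents and `1 / (1 - P)` elsewhere, the last index counting as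
a descent. The means of these factors are `0` and `1`, and after `X ↦ 1 / X` they are `-1` and `0`.
Hence the mean of `A_X` is the counit of `U(𝔫₋)` (`AX_contour_word_mem`), and in the mean of
`A_{1/X}` only the reversal survives, so that it is the antipode (`AX_neg_contour_word_mem`). The
exponentials in `ξ` cancel, and `⟨ψ_w, ψ_{w'}⟩ = S((S_μ(1, ·) ⊗ id) w, 𝒬(w'))`
(`hasMean_integrand`), because the counit is `S_μ(1, ·)`. For `w ∈ X_μ(u)` the equation at `x = 1`
says that the first argument is `u`.

Two solutions `w`, `w'` of the equations for `v` differ by an element of `Ker S_μ ⊗ V`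
(`mem_span_ker_tmul`). For `z ∈ Ker S_μ`, contravariance gives `S(u, a(z) m) = S(ω(z) u, m)`
(`shapTensor_env`), and `ω(z)` lies in `I_μ`, so `ω(z) u = 0` (`omega_smul_eq_zero`). Hence
`S(u, 𝒬(w))` does not depend on the choice. The same fact makes the equations solvable: words of
different weights are orthogonal, so the equations split into finite linear systems, one for each
weight, and each relation between the rows of a system comes from an element of `Ker S_μ`, which
kills the right hand side (`exists_xi_of_weight`). Only finitely many weights matter, since the
weights of `V` are bounded above (`exists_isXi`). A regular value of `Ξ` satisfies the equations
because they are polynomial identities that hold at generic points (`IsRegularXiValue.isXi`).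

The objects `γ`, `S` and `A_X` have to be shown to exist. For `γ`, take the universal Verma module
of the Lie algebra with the Chevalley generators but without the Serre relations: the words in the
`fᵢ` with coefficients in `U(𝔥)`. Divide it by the submodule generated by the Serre relations.
These relations lie in the sum of the parts generated by the `fᵢ` and by the `eᵢ`, so this
submodule is contained in the span of the nonempty words (`serre_mem_lower`), and the coefficient
of the empty word defines `γ` on the quotient (`exists_gammaProj`). Then `S_Λ` descends to a
highest weight module, because `g v = γ(g)(Λ) v` up to terms of lower weight
(`IsHighestWeight.shapModule_spec`). For `A_X`, the sum over permutations is rewritten as a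
recursion over the splittings of a word into two subwords (`symWord`, `symWord_ofFn`). The
recursion is compatible with commutators (`symWord_commutator`), so it defines a map on `U(𝔫₋)`
(`exists_symWord_map`).
-/

namespace TrigKZB

attribute [local instance 100] LieRing.ofAssociativeRing
set_option linter.unusedSectionVars false

local notation "𝓤" => UniversalEnvelopingAlgebra ℂ
local notation "𝓲" => UniversalEnvelopingAlgebra.ι ℂ

/-! ### Words in enveloping algebras -/

section Words

variable {L : Type*} [LieRing L] [LieAlgebra ℂ L]

theorem env_ι_lie (x y : L) : 𝓲 ⁅x, y⁆ = 𝓲 x * 𝓲 y - 𝓲 y * 𝓲 x := by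
  rw [LieHom.map_lie, LieRing.of_associative_ring_bracket]

/-- If `s` generates the Lie algebra `L`, then it generates the algebra `U(L)`. -/
theorem env_subalgebra_eq_top {s : Set L} (hs : LieSubalgebra.lieSpan ℂ L s = ⊤)
    (K : Subalgebra ℂ (𝓤 L)) (h : ∀ x ∈ s, 𝓲 x ∈ K) : K = ⊤ := by
  have hK : ∀ x : L, 𝓲 x ∈ K := by
    intro x
    have hx : x ∈ LieSubalgebra.lieSpan ℂ L s := by rw [hs]; trivial
    induction hx using LieSubalgebra.lieSpan_induction with
    | mem u hu => exact h u hu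
    | zero => rw [map_zero]; exact K.zero_mem
    | add u v _ _ hu hv => rw [map_add]; exact K.add_mem hu hv
    | smul t u _ hu => rw [map_smul]; exact K.smul_mem hu t
    | lie u v _ _ hu hv =>
      rw [env_ι_lie]
      exact K.sub_mem (K.mul_mem hu hv) (K.mul_mem hv hu)
  let f : L →ₗ⁅ℂ⁆ K :=
    { toFun := fun x => ⟨𝓲 x, hK x⟩
      map_add' := fun x y => Subtype.ext (map_add _ _ _)
      map_smul' := fun c x => Subtype.ext (map_smul _ _ _)
      map_lie' := fun {x y} => Subtype.ext (env_ι_lie x y) }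
  have hf : K.val.comp (UniversalEnvelopingAlgebra.lift ℂ f) = AlgHom.id ℂ (𝓤 L) := by
    apply UniversalEnvelopingAlgebra.hom_ext
    ext x
    have : UniversalEnvelopingAlgebra.lift ℂ f (𝓲 x) = f x :=
      UniversalEnvelopingAlgebra.lift_ι_apply ℂ f x
    change ((UniversalEnvelopingAlgebra.lift ℂ f (𝓲 x) : K) : 𝓤 L) = 𝓲 x
    rw [this]
    rfl
  rw [eq_top_iff]
  intro z _
  have : z = K.val (UniversalEnvelopingAlgebra.lift ℂ f z) := (DFunLike.congr_fun hf z).symm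
  rw [this]
  exact Subtype.property _

/-- A subspace of `U(L)` that contains `1` and is stable under left multiplication by a set of
generators of `L` is all of `U(L)`. -/
theorem env_left_induction {s : Set L} (hs : LieSubalgebra.lieSpan ℂ L s = ⊤)
    (P : Submodule ℂ (𝓤 L)) (h1 : 1 ∈ P) (h : ∀ x ∈ s, ∀ y ∈ P, 𝓲 x * y ∈ P) (z : 𝓤 L) :
    z ∈ P := by
  let K : Subalgebra ℂ (𝓤 L) :=
    { carrier := {z | ∀ y ∈ P, z * y ∈ P}
      mul_mem' := fun {a b} ha hb y hy => by rw [mul_assoc]; exact ha _ (hb _ hy)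
      add_mem' := fun {a b} ha hb y hy => by rw [add_mul]; exact P.add_mem (ha _ hy) (hb _ hy)
      algebraMap_mem' := fun r y hy => by
        rw [← Algebra.smul_def]; exact P.smul_mem r hy }
  have hK : K = ⊤ := env_subalgebra_eq_top hs K h
  have hz : z ∈ K := by rw [hK]; trivial
  simpa using hz 1 h1

theorem lieSpan_univ_eq_top : LieSubalgebra.lieSpan ℂ L (Set.univ : Set L) = ⊤ :=
  eq_top_iff.2 fun _ _ => LieSubalgebra.subset_lieSpan trivial

theorem lieSpan_range_basis {κ : Type*} (e : Module.Basis κ ℂ L) :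
    LieSubalgebra.lieSpan ℂ L (Set.range e) = ⊤ := by
  rw [eq_top_iff]
  intro x _
  have hx : x ∈ Submodule.span ℂ (Set.range e) := by rw [e.span_eq]; trivial
  exact (Submodule.span_le (p := (LieSubalgebra.lieSpan ℂ L (Set.range e)).toSubmodule)).2
    (fun y hy => LieSubalgebra.subset_lieSpan hy) hx

/-- The product in `U(L)` of a word of elements of `L`. -/
noncomputable def wordProd (l : List L) : 𝓤 L := (l.map (𝓲 : L → 𝓤 L)).prod

@[simp] theorem wordProd_nil : wordProd ([] : List L) = 1 := rfl

@[simp] theorem wordProd_cons (x : L) (l : List L) : wordProd (x :: l) = 𝓲 x * wordProd l := by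
  simp [wordProd]

@[simp] theorem wordProd_append (l l' : List L) :
    wordProd (l ++ l') = wordProd l * wordProd l' := by
  simp [wordProd]

/-- The words in the elements of a basis of `L` span `U(L)`. -/
theorem span_wordProd_basis {κ : Type*} (e : Module.Basis κ ℂ L) :
    Submodule.span ℂ (Set.range fun l : List κ => wordProd (l.map e)) = ⊤ := by
  rw [eq_top_iff]
  intro z _
  refine env_left_induction (lieSpan_range_basis e)
    (Submodule.span ℂ (Set.range fun l : List κ => wordProd (l.map e)))
    (Submodule.subset_span ⟨[], rfl⟩) ?_ z
  rintro _ ⟨k, rfl⟩ y hy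
  have : Submodule.span ℂ (Set.range fun l : List κ => wordProd (l.map e)) ≤
      (Submodule.span ℂ (Set.range fun l : List κ => wordProd (l.map e))).comap
        (LinearMap.mulLeft ℂ (𝓲 (e k))) := by
    rw [Submodule.span_le]
    rintro _ ⟨l, rfl⟩
    exact Submodule.subset_span ⟨k :: l, by simp⟩
  exact this hy

/-- The commutation relations of `L`, for functions on the words in a basis of `L`. -/
def wordRelations {κ E : Type*} [AddCommGroup E] [Module ℂ E] (e : Module.Basis κ ℂ L) :
    Submodule ℂ (List κ → E) where
  carrier := {φ | ∀ s i j t, φ (s ++ i :: j :: t) - φ (s ++ j :: i :: t) =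
    (e.repr ⁅e i, e j⁆).sum fun k c => c • φ (s ++ k :: t)}
  zero_mem' := fun s i j t => by simp
  add_mem' := fun {φ ψ} hφ hψ s i j t => by
    simp only [Pi.add_apply, smul_add, Finsupp.sum_add]
    rw [← hφ s i j t, ← hψ s i j t]; abel
  smul_mem' := fun c φ hφ s i j t => by
    have := congrArg (fun z => c • z) (hφ s i j t)
    simp only [Finsupp.smul_sum, smul_sub] at this
    simp only [Pi.smul_apply, this]
    exact Finsupp.sum_congr fun k _ => smul_comm _ _ _

/-- Right translation by a letter. -/
def wordTranslate {κ E : Type*} [AddCommGroup E] [Module ℂ E] (e : Module.Basis κ ℂ L) (k : κ) :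
    Module.End ℂ (wordRelations (E := E) e) where
  toFun φ := ⟨fun s => φ.1 (s ++ [k]), fun s i j t => by
    simpa using φ.2 s i j (t ++ [k])⟩
  map_add' φ ψ := rfl
  map_smul' c φ := rfl

/-- A representation of `L` from a linear map that turns brackets into commutators. -/
def repOfCommutator {M : Type*} [AddCommGroup M] [Module ℂ M] (T : L →ₗ[ℂ] Module.End ℂ M)
    (h : ∀ x y, T ⁅x, y⁆ = T x * T y - T y * T x) : L →ₗ⁅ℂ⁆ Module.End ℂ M where
  toFun := T
  map_add' := T.map_add
  map_smul' := T.map_smul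
  map_lie' {x y} := by rw [LieRing.of_associative_ring_bracket]; exact h x y

/-- It suffices to check on a basis that a linear map turns brackets into commutators. -/
theorem commutator_of_basis {κ M : Type*} [AddCommGroup M] [Module ℂ M] (e : Module.Basis κ ℂ L)
    (T : L →ₗ[ℂ] Module.End ℂ M)
    (h : ∀ i j, T ⁅e i, e j⁆ = T (e i) * T (e j) - T (e j) * T (e i)) (x y : L) :
    T ⁅x, y⁆ = T x * T y - T y * T x := by
  let D : L →ₗ[ℂ] L →ₗ[ℂ] Module.End ℂ M :=
    LinearMap.mk₂ ℂ (fun x y => T ⁅x, y⁆ - (T x * T y - T y * T x))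
      (fun x x' y => by simp only [add_lie, map_add, add_mul, mul_add]; abel)
      (fun c x y => by
        simp only [smul_lie, map_smul, smul_mul_assoc, mul_smul_comm, smul_sub])
      (fun x y y' => by simp only [lie_add, map_add, add_mul, mul_add]; abel)
      (fun c x y => by
        simp only [lie_smul, map_smul, smul_mul_assoc, mul_smul_comm, smul_sub])
  have hD : D = 0 := e.ext fun i => e.ext fun j => sub_eq_zero.2 (h i j)
  exact sub_eq_zero.1 (LinearMap.congr_fun (LinearMap.congr_fun hD x) y)

/-- A linear map out of `U(L)` is the same as a function on the words in a basis of `L` which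
satisfies the commutation relations: on such functions, `L` acts by right translations. -/
theorem exists_linearMap_of_wordRelations {κ E : Type*} [AddCommGroup E] [Module ℂ E]
    (e : Module.Basis κ ℂ L) (φ : List κ → E) (hφ : φ ∈ wordRelations (E := E) e) :
    ∃ A : 𝓤 L →ₗ[ℂ] E, ∀ l : List κ, A (wordProd (l.map e)) = φ l := by
  let T : L →ₗ[ℂ] Module.End ℂ (wordRelations (E := E) e) := e.constr ℂ (wordTranslate e)
  have hT : ∀ k, T (e k) = wordTranslate e k := fun k => e.constr_basis ℂ _ k
  have hlie : ∀ x y, T ⁅x, y⁆ = T x * T y - T y * T x := by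
    have : ∀ i j, T ⁅e i, e j⁆ = T (e i) * T (e j) - T (e j) * T (e i) := by
      intro i j
      ext ψ s
      rw [hT, hT]
      have h1 := ψ.2 s i j []
      have h2 : T ⁅e i, e j⁆ =
          (e.repr ⁅e i, e j⁆).sum fun k c => c • wordTranslate e k := by
        rw [Module.Basis.constr_apply]
      rw [h2, Finsupp.sum, LinearMap.sum_apply, AddSubmonoidClass.coe_finsetSum,
        Finset.sum_apply]
      simp only [LinearMap.sub_apply, Module.End.mul_apply]
      have h3 : ((wordTranslate e i (wordTranslate e j ψ) -
          wordTranslate e j (wordTranslate e i ψ) : wordRelations (E := E) e) : List κ → E) s =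
          ψ.1 (s ++ [i, j]) - ψ.1 (s ++ [j, i]) := by
        change ψ.1 ((s ++ [i]) ++ [j]) - ψ.1 ((s ++ [j]) ++ [i]) = _
        simp
      rw [h3, h1]
      rfl
    exact commutator_of_basis e T this
  let ρ : L →ₗ⁅ℂ⁆ Module.End ℂ (wordRelations (E := E) e) := repOfCommutator T hlie
  have hρ : ∀ (l : List κ) (ψ : wordRelations (E := E) e) (s : List κ),
      (envAct ρ (wordProd (l.map e)) ψ).1 s = ψ.1 (s ++ l) := by
    intro l
    induction l with
    | nil => intro ψ s; simp
    | cons k l ih =>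
      intro ψ s
      have h1 : envAct ρ (𝓲 (e k)) = wordTranslate e k := by
        rw [← hT]; exact UniversalEnvelopingAlgebra.lift_ι_apply ℂ ρ (e k)
      rw [List.map_cons, wordProd_cons, map_mul, Module.End.mul_apply, h1]
      change (envAct ρ (wordProd (l.map e)) ψ).1 (s ++ [k]) = _
      rw [ih]; simp
  refine ⟨{ toFun := fun z => (envAct ρ z ⟨φ, hφ⟩).1 []
            map_add' := fun z w => by rw [map_add]; rfl
            map_smul' := fun c z => by rw [map_smul]; rfl }, fun l => ?_⟩
  simpa using hρ l ⟨φ, hφ⟩ []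

end Words

section Enveloping

variable {L : Type*} [LieRing L] [LieAlgebra ℂ L]

theorem envIncl_ι (n : LieSubalgebra ℂ L) (x : n) : envIncl n (𝓲 x) = 𝓲 (x : L) :=
  UniversalEnvelopingAlgebra.lift_ι_apply ℂ _ x

variable {M : Type*} [AddCommGroup M] [Module ℂ M]

theorem envAct_ι (π : L →ₗ⁅ℂ⁆ Module.End ℂ M) (x : L) : envAct π (𝓲 x) = π x :=
  UniversalEnvelopingAlgebra.lift_ι_apply ℂ _ x

theorem antipode_antipode (z : 𝓤 L) : antipode L (antipode L z) = z := by
  refine env_left_induction lieSpan_univ_eq_top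
    (LinearMap.eqLocus (antipode L ∘ₗ antipode L) LinearMap.id) ?_ ?_ z
  · simp [LinearMap.mem_eqLocus, antipode_one]
  · intro x _ y hy
    simp only [LinearMap.mem_eqLocus, LinearMap.comp_apply, LinearMap.id_apply] at hy ⊢
    rw [antipode_mul, antipode_mul, hy, antipode_ι, map_neg, antipode_ι, neg_neg]

end Enveloping

/-! ### The triangular decomposition of `𝔤` -/

section Triangular

variable {𝔤 : Type*} [LieRing 𝔤] [LieAlgebra ℂ 𝔤] [FiniteDimensional ℂ 𝔤]
  [LieAlgebra.IsSimple ℂ 𝔤] {H : LieSubalgebra ℂ 𝔤} {ι : Type*} [Fintype ι]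
  [H.IsCartanSubalgebra]

open LieAlgebra LieAlgebra.IsKilling

theorem lie_of_mem_rootSpace {χ : H → ℂ} {x : 𝔤} (hx : x ∈ rootSpace H χ) (h : H) :
    ⁅(h : 𝔤), x⁆ = χ h • x :=
  lie_eq_smul_of_mem_rootSpace hx h

theorem mem_posRoots (b : LieAlgebra.Basis ι H) (α : LieModule.Weight ℂ H 𝔤) :
    α ∈ posRoots b ↔ α ∈ H.root ∧ ∃ m : ι → ℕ, α.toLinear = ∑ i, m i • b.baseSupp i := by
  simp [posRoots]

/-- The vectors of the root spaces of the negative roots. -/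
def negRootVectors (b : LieAlgebra.Basis ι H) : Set 𝔤 :=
  {x | ∃ α ∈ posRoots b, x ∈ rootSpace H (-(α : H → ℂ))}

theorem sum_nsmul_baseSupp_eq_zero (b : LieAlgebra.Basis ι H) {m : ι → ℕ}
    (h : ∑ i, m i • b.baseSupp i = 0) : m = 0 := by
  have := Fintype.linearIndependent_iff.mp b.linearIndependent_baseSupp (fun i => (m i : ℂ))
    (by simpa [Nat.cast_smul_eq_nsmul] using h)
  funext i
  simpa using this i

theorem lieSpan_f_le_span (b : LieAlgebra.Basis ι H) {x : 𝔤}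
    (hx : x ∈ LieSubalgebra.lieSpan ℂ 𝔤 (Set.range b.f)) :
    x ∈ Submodule.span ℂ (negRootVectors b) := by
  have hx' : x ∈ b.borelLower := hx
  rw [b.borelLower_eq, ← LieSubmodule.mem_toSubmodule, LieSubmodule.iSup_toSubmodule] at hx'
  have key : ⨆ (n : ι → ℕ), (⨆ (_ : n ≠ 0),
      rootSpace H (∑ i, n i • (-b.baseSupp) i) : LieSubmodule ℂ H 𝔤).toSubmodule ≤
      Submodule.span ℂ (negRootVectors b) := by
    refine iSup_le fun n => ?_
    rw [LieSubmodule.iSup_toSubmodule]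
    refine iSup_le fun hn y hy => ?_
    by_cases h0 : y = 0
    · rw [h0]; exact Submodule.zero_mem _
    have hne : rootSpace H (∑ i, n i • ⇑((-b.baseSupp) i) : H → ℂ) ≠ ⊥ := by
      intro h
      rw [LieSubmodule.mem_toSubmodule, h] at hy
      exact h0 (by simpa using hy)
    let β : LieModule.Weight ℂ H 𝔤 := ⟨_, hne⟩
    have hβ : (-β).toLinear = ∑ i, n i • b.baseSupp i := by
      ext z
      simp [β]
    refine Submodule.subset_span ⟨-β, (mem_posRoots b _).2 ⟨?_, n, hβ⟩, ?_⟩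
    · simp only [LieSubalgebra.root, Finset.mem_filter, Finset.mem_univ, true_and]
      intro h
      refine hn (sum_nsmul_baseSupp_eq_zero b ?_)
      rw [← hβ]
      ext z
      exact congrFun h z
    · have : (-((-β : LieModule.Weight ℂ H 𝔤) : H → ℂ)) = (β : H → ℂ) := by
        rw [LieModule.Weight.coe_neg, neg_neg]
      rw [this]
      exact hy
  exact key hx'

theorem negRootVectors_subset (b : LieAlgebra.Basis ι H) :
    negRootVectors b ⊆ LieSubalgebra.lieSpan ℂ 𝔤 (Set.range b.f) := by
  rintro x ⟨α, hα, hx⟩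
  obtain ⟨hα, m, hm⟩ := (mem_posRoots b α).1 hα
  have hm0 : m ≠ 0 := by
    rintro rfl
    have h1 : α.toLinear = 0 := by simpa using hm
    simp only [LieSubalgebra.root, Finset.mem_filter, Finset.mem_univ, true_and] at hα
    apply hα
    ext z
    exact LinearMap.congr_fun h1 z
  suffices x ∈ b.borelLower from this
  rw [b.borelLower_eq]
  refine LieSubmodule.mem_iSup_of_mem m (LieSubmodule.mem_iSup_of_mem hm0 ?_)
  have : (-(α : H → ℂ)) = (∑ i, m i • ⇑((-b.baseSupp) i) : H → ℂ) := by
    funext z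
    have := LinearMap.congr_fun hm z
    simp only [LieModule.Weight.toLinear_apply, LinearMap.sum_apply, LinearMap.smul_apply] at this
    simp [this]
  rw [← this]
  exact hx

/-- `𝔫₋`, defined as the span of root spaces, is generated by the `fᵢ`. -/
theorem nMinus_eq (b : LieAlgebra.Basis ι H) :
    nMinus b = LieSubalgebra.lieSpan ℂ 𝔤 (Set.range b.f) := by
  apply le_antisymm
  · exact LieSubalgebra.lieSpan_le.2 (negRootVectors_subset b)
  · intro x hx
    exact (Submodule.span_le (p := (nMinus b).toSubmodule)).2
      (fun y hy => LieSubalgebra.subset_lieSpan hy) (lieSpan_f_le_span b hx)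

theorem nMinus_toSubmodule (b : LieAlgebra.Basis ι H) :
    (nMinus b).toSubmodule = Submodule.span ℂ (negRootVectors b) := by
  apply le_antisymm
  · intro x hx
    rw [LieSubalgebra.mem_toSubmodule, nMinus_eq] at hx
    exact lieSpan_f_le_span b hx
  · exact Submodule.span_le.2 fun y hy => LieSubalgebra.subset_lieSpan hy

theorem neg_mem_posRoots_symm (b : LieAlgebra.Basis ι H) {α : LieModule.Weight ℂ H 𝔤}
    (hα : α ∈ posRoots b) : -α ∈ posRoots b.symm := by
  obtain ⟨hα, m, hm⟩ := (mem_posRoots b α).1 hα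
  refine (mem_posRoots b.symm (-α)).2 ⟨?_, m, ?_⟩
  · simp only [LieSubalgebra.root, Finset.mem_filter, Finset.mem_univ, true_and] at hα ⊢
    intro h
    apply hα
    simpa using h.neg
  · rw [LieAlgebra.Basis.symm_baseSupp]
    ext z
    have := LinearMap.congr_fun hm z
    simp only [LieModule.Weight.toLinear_apply, LinearMap.sum_apply, LinearMap.smul_apply] at this
    simp [this]

theorem nPlus_eq_nMinus_symm (b : LieAlgebra.Basis ι H) : nPlus b = nMinus b.symm := by
  unfold nPlus nMinus
  congr 1
  ext x
  constructor
  · rintro ⟨α, hα, hx⟩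
    refine ⟨-α, neg_mem_posRoots_symm b hα, ?_⟩
    rwa [LieModule.Weight.coe_neg, neg_neg]
  · rintro ⟨α, hα, hx⟩
    refine ⟨-α, ?_, ?_⟩
    · have := neg_mem_posRoots_symm b.symm hα
      rwa [LieAlgebra.Basis.symm_symm] at this
    · rwa [LieModule.Weight.coe_neg]

theorem nPlus_eq (b : LieAlgebra.Basis ι H) :
    nPlus b = LieSubalgebra.lieSpan ℂ 𝔤 (Set.range b.e) := by
  rw [nPlus_eq_nMinus_symm, nMinus_eq]
  rfl

theorem f_mem_nMinus (b : LieAlgebra.Basis ι H) (i : ι) : b.f i ∈ nMinus b := by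
  rw [nMinus_eq]; exact LieSubalgebra.subset_lieSpan ⟨i, rfl⟩

theorem e_mem_nPlus (b : LieAlgebra.Basis ι H) (i : ι) : b.e i ∈ nPlus b := by
  rw [nPlus_eq]; exact LieSubalgebra.subset_lieSpan ⟨i, rfl⟩

theorem lie_h_mem_nMinus (b : LieAlgebra.Basis ι H) (h : H) {x : 𝔤} (hx : x ∈ nMinus b) :
    ⁅(h : 𝔤), x⁆ ∈ nMinus b := by
  rw [nMinus_eq] at hx ⊢
  exact b.borelLower.lie_mem (x := h) hx

theorem lie_h_mem_nPlus (b : LieAlgebra.Basis ι H) (h : H) {x : 𝔤} (hx : x ∈ nPlus b) :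
    ⁅(h : 𝔤), x⁆ ∈ nPlus b := by
  rw [nPlus_eq_nMinus_symm] at hx ⊢
  exact lie_h_mem_nMinus b.symm h hx

/-- `𝔤 = 𝔫₋ + 𝔥 + 𝔫₊`. -/
theorem exists_triangular (b : LieAlgebra.Basis ι H) (x : 𝔤) :
    ∃ y ∈ nMinus b, ∃ h : H, ∃ z ∈ nPlus b, x = y + h + z := by
  have hx : x ∈ iSup ![H.toLieSubmodule, b.borelLower, b.borelUpper] := by
    rw [b.iSup_cartan_borelLower_borelUpper_eq_top]; trivial
  have e : iSup ![H.toLieSubmodule, b.borelLower, b.borelUpper] =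
      H.toLieSubmodule ⊔ b.borelLower ⊔ b.borelUpper := by simp
  rw [e, LieSubmodule.mem_sup] at hx
  obtain ⟨w, hw, z, hz, rfl⟩ := hx
  rw [LieSubmodule.mem_sup] at hw
  obtain ⟨h, hh, y, hy, rfl⟩ := hw
  refine ⟨y, by rw [nMinus_eq]; exact hy, ⟨h, hh⟩, z, by rw [nPlus_eq]; exact hz, ?_⟩
  rw [add_comm h y]

/-- The sum `𝔤 = 𝔫₋ + 𝔥 + 𝔫₊` is direct. -/
theorem triangular_eq_zero (b : LieAlgebra.Basis ι H) {y z : 𝔤} {h : H} (hy : y ∈ nMinus b)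
    (hz : z ∈ nPlus b) (hs : y + h + z = 0) : y = 0 ∧ h = 0 ∧ z = 0 := by
  have hy' : y ∈ b.borelLower := by rw [nMinus_eq] at hy; exact hy
  have hz' : z ∈ b.borelUpper := by rw [nPlus_eq] at hz; exact hz
  have hh' : (h : 𝔤) ∈ H.toLieSubmodule := h.2
  have ind := b.iSupIndep_rootSpace
  rw [← b.borelLower_eq, ← b.borelUpper_eq, ← b.cartan_eq, iSupIndep_fin_three] at ind
  simp only [Matrix.cons_val_zero, Matrix.cons_val_one, Matrix.cons_val] at ind
  obtain ⟨h0, h1, h2⟩ := ind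
  have hdis : ∀ {N N' : LieSubmodule ℂ H 𝔤} {w : 𝔤}, Disjoint N N' → w ∈ N → w ∈ N' → w = 0 := by
    intro N N' w hd h1 h2
    have : w ∈ N ⊓ N' := ⟨h1, h2⟩
    rw [hd.eq_bot] at this
    simpa using this
  have H0 : (h : 𝔤) = 0 := by
    refine hdis h0 hh' ?_
    have : (h : 𝔤) = -(y + z) := by rw [eq_neg_iff_add_eq_zero, ← hs]; abel
    rw [this]
    exact neg_mem ((LieSubmodule.mem_sup _ _ _).2 ⟨y, hy', z, hz', rfl⟩)
  have H1 : y = 0 := by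
    refine hdis h1 hy' ?_
    have : y = -(z + h) := by rw [eq_neg_iff_add_eq_zero, ← hs]; abel
    rw [this]
    exact neg_mem ((LieSubmodule.mem_sup _ _ _).2 ⟨z, hz', h, hh', rfl⟩)
  refine ⟨H1, Subtype.ext H0, ?_⟩
  simpa [H0, H1] using hs

/-! ### The Chevalley involution -/

theorem chevalley_mem_nPlus (b : LieAlgebra.Basis ι H) {x : 𝔤} (hx : x ∈ nMinus b) :
    chevalley b x ∈ nPlus b := by
  rw [nMinus_eq] at hx
  induction hx using LieSubalgebra.lieSpan_induction with
  | mem u hu =>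
    obtain ⟨i, rfl⟩ := hu
    rw [chevalley_f]
    exact neg_mem (e_mem_nPlus b i)
  | zero => rw [map_zero]; exact zero_mem _
  | add u v _ _ hu hv => rw [map_add]; exact add_mem hu hv
  | smul t u _ hu => rw [map_smul]; exact (nPlus b).smul_mem t hu
  | lie u v _ _ hu hv => rw [LieEquiv.map_lie]; exact (nPlus b).lie_mem hu hv

theorem chevalley_mem_nMinus (b : LieAlgebra.Basis ι H) {x : 𝔤} (hx : x ∈ nPlus b) :
    chevalley b x ∈ nMinus b := by
  rw [nPlus_eq] at hx
  induction hx using LieSubalgebra.lieSpan_induction with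
  | mem u hu =>
    obtain ⟨i, rfl⟩ := hu
    rw [chevalley_e]
    exact neg_mem (f_mem_nMinus b i)
  | zero => rw [map_zero]; exact zero_mem _
  | add u v _ _ hu hv => rw [map_add]; exact add_mem hu hv
  | smul t u _ hu => rw [map_smul]; exact (nMinus b).smul_mem t hu
  | lie u v _ _ hu hv => rw [LieEquiv.map_lie]; exact (nMinus b).lie_mem hu hv

theorem chevalley_cartan (b : LieAlgebra.Basis ι H) (h : H) : chevalley b h = -(h : 𝔤) := by
  obtain ⟨h, hmem⟩ := h
  change chevalley b h = -h
  have hh : h ∈ Submodule.span ℂ (Set.range b.h) := by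
    rw [← b.coe_cartan_eq_span]; exact hmem
  clear hmem
  induction hh using Submodule.span_induction with
  | mem u hu => obtain ⟨i, rfl⟩ := hu; exact chevalley_h b i
  | zero => simp
  | add u v _ _ hu hv => rw [map_add, hu, hv, neg_add]
  | smul t u _ hu => rw [map_smul, hu, smul_neg]

theorem chevalley_chevalley (b : LieAlgebra.Basis ι H) (x : 𝔤) :
    chevalley b (chevalley b x) = x := by
  have hx : x ∈ LieSubalgebra.lieSpan ℂ 𝔤 (Set.range b.e ∪ Set.range b.f) := by
    rw [b.span_ef]; trivial
  induction hx using LieSubalgebra.lieSpan_induction with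
  | mem u hu =>
    rcases hu with ⟨i, rfl⟩ | ⟨i, rfl⟩
    · rw [chevalley_e, map_neg, chevalley_f, neg_neg]
    · rw [chevalley_f, map_neg, chevalley_e, neg_neg]
  | zero => simp
  | add u v _ _ hu hv => rw [map_add, map_add, hu, hv]
  | smul t u _ hu => rw [map_smul, map_smul, hu]
  | lie u v _ _ hu hv => rw [LieEquiv.map_lie, LieEquiv.map_lie, hu, hv]

theorem omega_ι (b : LieAlgebra.Basis ι H) (x : 𝔤) : omega b (𝓲 x) = 𝓲 (chevalley b x) :=
  UniversalEnvelopingAlgebra.lift_ι_apply ℂ _ x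

theorem omega_omega (b : LieAlgebra.Basis ι H) (z : 𝓤 𝔤) : omega b (omega b z) = z := by
  refine env_left_induction lieSpan_univ_eq_top
    (LinearMap.eqLocus ((omega b).toLinearMap ∘ₗ (omega b).toLinearMap) LinearMap.id) ?_ ?_ z
  · simp [LinearMap.mem_eqLocus]
  · intro x _ y hy
    simp only [LinearMap.mem_eqLocus, LinearMap.comp_apply, LinearMap.id_apply,
      AlgHom.toLinearMap_apply] at hy ⊢
    rw [map_mul, map_mul, hy, omega_ι, omega_ι, chevalley_chevalley]

theorem antipode_omega (b : LieAlgebra.Basis ι H) (z : 𝓤 𝔤) :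
    antipode 𝔤 (omega b z) = omega b (antipode 𝔤 z) := by
  refine env_left_induction lieSpan_univ_eq_top
    (LinearMap.eqLocus (antipode 𝔤 ∘ₗ (omega b).toLinearMap)
      ((omega b).toLinearMap ∘ₗ antipode 𝔤)) ?_ ?_ z
  · simp [LinearMap.mem_eqLocus, antipode_one]
  · intro x _ y hy
    simp only [LinearMap.mem_eqLocus, LinearMap.comp_apply, AlgHom.toLinearMap_apply] at hy ⊢
    rw [map_mul, antipode_mul, antipode_mul, map_mul, hy, omega_ι, antipode_ι, antipode_ι,
      map_neg, omega_ι]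

/-! ### Root vectors of `𝔫₋` -/

/-- A basis of `𝔫₋` made of root vectors, with the roots (up to sign) of its elements. -/
theorem exists_rootBasis (b : LieAlgebra.Basis ι H) :
    ∃ (κ : Set (nMinus b)) (e : Module.Basis κ ℂ (nMinus b)) (d : κ → LieModule.Weight ℂ H 𝔤),
      ∀ k, d k ∈ posRoots b ∧ (e k : 𝔤) ∈ rootSpace H (-(d k : H → ℂ)) := by
  let s : Set (nMinus b) := {x | (x : 𝔤) ∈ negRootVectors b}
  have hs : ⊤ ≤ Submodule.span ℂ s := by
    rintro ⟨x, hx⟩ -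
    have hx' : x ∈ Submodule.span ℂ (negRootVectors b) := by
      rw [← nMinus_toSubmodule]; exact hx
    have hm : Submodule.map (nMinus b).toSubmodule.subtype (Submodule.span ℂ s) =
        Submodule.span ℂ (negRootVectors b) := by
      rw [Submodule.map_span]
      congr 1
      ext y
      constructor
      · rintro ⟨y, hy, rfl⟩; exact hy
      · intro hy
        exact ⟨⟨y, LieSubalgebra.subset_lieSpan hy⟩, hy, rfl⟩
    rw [← hm] at hx'
    obtain ⟨y, hy, hyx⟩ := hx'
    have : y = ⟨x, hx⟩ := Subtype.ext hyx
    rwa [← this]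
  have h : ∀ k, (Module.Basis.ofSpan hs k) ∈ s := fun k =>
    Module.Basis.ofSpan_subset hs ⟨k, rfl⟩
  exact ⟨_, Module.Basis.ofSpan hs, fun k => (h k).choose, fun k => (h k).choose_spec⟩

/-- The coordinates of a weight vector of `𝔫₋` in a basis of root vectors vanish except at the
basis elements of the same weight. -/
theorem weight_eq_of_repr_ne_zero (b : LieAlgebra.Basis ι H) {κ : Type*}
    (e : Module.Basis κ ℂ (nMinus b)) (d : κ → LieModule.Weight ℂ H 𝔤)
    (he : ∀ k, d k ∈ posRoots b ∧ (e k : 𝔤) ∈ rootSpace H (-(d k : H → ℂ)))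
    {χ : H → ℂ} {x : nMinus b} (hx : ∀ h : H, ⁅(h : 𝔤), (x : 𝔤)⁆ = -χ h • (x : 𝔤)) {k : κ}
    (hk : e.repr x k ≠ 0) : (d k : H → ℂ) = χ := by
  funext h
  let T : nMinus b →ₗ[ℂ] nMinus b :=
    { toFun := fun x => ⟨⁅(h : 𝔤), (x : 𝔤)⁆, lie_h_mem_nMinus b h x.2⟩
      map_add' := fun x y => Subtype.ext (lie_add _ _ _)
      map_smul' := fun c x => Subtype.ext (lie_smul _ _ _) }
  have hT : ∀ j, T (e j) = -(d j h) • e j := fun j =>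
    Subtype.ext (lie_of_mem_rootSpace (he j).2 h)
  have h1 : T x = -χ h • x := Subtype.ext (hx h)
  have h2 : ∀ y, e.repr (T y) k = -(d k h) * e.repr y k := by
    intro y
    have : (e.coord k) ∘ₗ T = (-(d k h)) • e.coord k := by
      refine e.ext fun j => ?_
      simp only [LinearMap.comp_apply, hT, map_smul, Module.Basis.coord_apply,
        Module.Basis.repr_self, LinearMap.smul_apply]
      by_cases hj : j = k
      · rw [hj]
      · simp [Finsupp.single_eq_of_ne' hj]
    exact LinearMap.congr_fun this y
  have h3 := h2 x
  rw [h1, map_smul, Finsupp.smul_apply, smul_eq_mul] at h3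
  exact (neg_injective (mul_right_cancel₀ hk h3)).symm

/-- The element of `𝔥` at which all simple roots are `1`: a root takes there its height. -/
noncomputable def heightElt (b : LieAlgebra.Basis ι H) : H := pointOf b fun _ => 1

theorem posRoot_heightElt (b : LieAlgebra.Basis ι H) {α : LieModule.Weight ℂ H 𝔤}
    (hα : α ∈ posRoots b) : ∃ n : ℕ, 1 ≤ n ∧ α (heightElt b) = n := by
  obtain ⟨hα, m, hm⟩ := (mem_posRoots b α).1 hα
  refine ⟨∑ i, m i, ?_, ?_⟩
  · by_contra h
    have hm0 : m = 0 := by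
      funext i
      have : ∑ i, m i = 0 := by omega
      simpa using (Finset.sum_eq_zero_iff.1 this) i (Finset.mem_univ i)
    subst hm0
    have h1 : α.toLinear = 0 := by simpa using hm
    simp only [LieSubalgebra.root, Finset.mem_filter, Finset.mem_univ, true_and] at hα
    apply hα
    ext z
    exact LinearMap.congr_fun h1 z
  · have := LinearMap.congr_fun hm (heightElt b)
    simp only [LieModule.Weight.toLinear_apply, LinearMap.sum_apply, LinearMap.smul_apply,
      heightElt, baseSupp_pointOf] at this
    rw [heightElt, this]
    simp

end Triangular

/-! ### The universal Verma module and the projection `γ` -/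

section Graph

variable {𝔤 : Type*} [LieRing 𝔤] [LieAlgebra ℂ 𝔤] {H : LieSubalgebra ℂ 𝔤}
  {ι : Type*} [Fintype ι] (b : LieAlgebra.Basis ι H)

/-- Elements of an associative algebra that satisfy the relations of the Chevalley generators
except for the Serre relations. -/
structure ChevalleyTriple (A : Type*) [Ring A] [Algebra ℂ A] where
  h : ι → A
  e : ι → A
  f : ι → A
  h_h : ∀ i j, h i * h j - h j * h i = 0
  h_e : ∀ i j, h j * e i - e i * h j = b.A i j • e i
  h_f : ∀ i j, h j * f i - f i * h j = -b.A i j • f i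
  e_f : ∀ i, e i * f i - f i * e i = h i
  e_f_ne : ∀ i j, i ≠ j → e i * f j - f j * e i = 0

variable {b} {A : Type*} [Ring A] [Algebra ℂ A] (t : ChevalleyTriple b A)

namespace ChevalleyTriple

/-- The pairs `(eᵢ, eᵢ)` and `(fᵢ, fᵢ)` in `A × 𝔤`. -/
def gens : Set (A × 𝔤) :=
  Set.range (fun i => (t.e i, b.e i)) ∪ Set.range (fun i => (t.f i, b.f i))

/-- The Lie algebra generated by the pairs `(eᵢ, eᵢ)` and `(fᵢ, fᵢ)` in `A × 𝔤`: the graph of a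
many valued map from `𝔤` to `A`. The elements `a` with `(a, 0)` in the graph measure the failure of
the Serre relations in `A`. -/
def graph : LieSubalgebra ℂ (A × 𝔤) := LieSubalgebra.lieSpan ℂ (A × 𝔤) t.gens

theorem lie_mk (a c : A) (x y : 𝔤) :
    (⁅(a, x), (c, y)⁆ : A × 𝔤) = (a * c - c * a, ⁅x, y⁆) := by
  rw [← LieRing.of_associative_ring_bracket]; rfl

theorem e_mem (i : ι) : (t.e i, b.e i) ∈ t.graph :=
  LieSubalgebra.subset_lieSpan (Or.inl ⟨i, rfl⟩)

theorem f_mem (i : ι) : (t.f i, b.f i) ∈ t.graph :=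
  LieSubalgebra.subset_lieSpan (Or.inr ⟨i, rfl⟩)

theorem h_mem (i : ι) : (t.h i, b.h i) ∈ t.graph := by
  have := t.graph.lie_mem (t.e_mem i) (t.f_mem i)
  rwa [lie_mk, t.e_f, (b.sl2 i).lie_e_f] at this

/-- The pairs `(hᵢ, hᵢ)`, `(eᵢ, eᵢ)`, `(fᵢ, fᵢ)` as Chevalley generators of the graph. No Serre
relation is required of a `LieAlgebra.Basis`, and the linear independence of the `hᵢ` can be read
off in `𝔤`, so the triangular decomposition of `LieAlgebra.Basis` applies to the graph. -/
noncomputable def graphBasis : LieAlgebra.Basis ι (LieSubalgebra.lieSpan ℂ t.graph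
    (Set.range fun i => (⟨(t.h i, b.h i), t.h_mem i⟩ : t.graph))) where
  A := b.A
  h i := ⟨(t.h i, b.h i), t.h_mem i⟩
  e i := ⟨(t.e i, b.e i), t.e_mem i⟩
  f i := ⟨(t.f i, b.f i), t.f_mem i⟩
  cartan_eq_lieSpan := rfl
  span_ef := by
    have : (Set.range fun i => (⟨(t.e i, b.e i), t.e_mem i⟩ : t.graph)) ∪
        (Set.range fun i => (⟨(t.f i, b.f i), t.f_mem i⟩ : t.graph)) =
        Subtype.val ⁻¹' t.gens := by
      ext; simp [gens, Subtype.ext_iff]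
    rw [this]
    exact LieSubalgebra.lieSpan_lieSpan_coe_preimage
  linInd := .of_comp t.graph.toSubmodule.subtype <| .of_comp (LinearMap.snd ℂ A 𝔤) b.linInd
  nondegen := b.nondegen
  sl2 i :=
    { h_ne_zero := fun h => (b.sl2 i).h_ne_zero (congrArg (fun z : t.graph => z.1.2) h)
      lie_e_f := by
        refine Subtype.ext ?_
        rw [LieSubalgebra.coe_bracket, lie_mk, t.e_f, (b.sl2 i).lie_e_f]
      lie_h_e_nsmul := by
        refine Subtype.ext ?_
        rw [LieSubalgebra.coe_bracket, lie_mk, t.h_e, (b.sl2 i).lie_h_e_nsmul]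
        have : b.A i i = 2 := by
          have : IsAddTorsionFree 𝔤 := .of_isTorsionFree ℂ 𝔤
          exact b.A_diag_eq_two i
        rw [this]
        simp
      lie_h_f_nsmul := by
        refine Subtype.ext ?_
        rw [LieSubalgebra.coe_bracket, lie_mk, t.h_f, (b.sl2 i).lie_h_f_nsmul]
        have : b.A i i = 2 := by
          have : IsAddTorsionFree 𝔤 := .of_isTorsionFree ℂ 𝔤
          exact b.A_diag_eq_two i
        rw [this]
        simp }
  lie_h_h i j := Subtype.ext (by
    rw [LieSubalgebra.coe_bracket, lie_mk, t.h_h, b.lie_h_h]; rfl)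
  lie_h_e i j := Subtype.ext (by
    rw [LieSubalgebra.coe_bracket, lie_mk, t.h_e, b.lie_h_e]; rfl)
  lie_h_f i j := Subtype.ext (by
    rw [LieSubalgebra.coe_bracket, lie_mk, t.h_f, b.lie_h_f]; rfl)
  lie_e_f_ne i j hij := Subtype.ext (by
    rw [LieSubalgebra.coe_bracket, lie_mk, t.e_f_ne i j hij, b.lie_e_f_ne i j hij]; rfl)

/-- The part of the graph generated by the `(fᵢ, fᵢ)`. -/
def graphMinus : LieSubalgebra ℂ (A × 𝔤) :=
  LieSubalgebra.lieSpan ℂ (A × 𝔤) (Set.range fun i => (t.f i, b.f i))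

/-- The part of the graph generated by the `(eᵢ, eᵢ)`. -/
def graphPlus : LieSubalgebra ℂ (A × 𝔤) :=
  LieSubalgebra.lieSpan ℂ (A × 𝔤) (Set.range fun i => (t.e i, b.e i))

theorem graphMinus_le : t.graphMinus ≤ t.graph :=
  LieSubalgebra.lieSpan_mono Set.subset_union_right

theorem graphPlus_le : t.graphPlus ≤ t.graph :=
  LieSubalgebra.lieSpan_mono Set.subset_union_left

/-- The triangular decomposition of the graph. -/
theorem exists_graph_triangular {p : A × 𝔤} (hp : p ∈ t.graph) :
    ∃ q ∈ t.graphMinus, ∃ c : ι → ℂ, ∃ r ∈ t.graphPlus,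
      p = q + ∑ i, c i • (t.h i, b.h i) + r := by
  let b' := t.graphBasis
  have hx : (⟨p, hp⟩ : t.graph) ∈ iSup ![LieSubalgebra.toLieSubmodule _, b'.borelLower,
      b'.borelUpper] := by
    rw [b'.iSup_cartan_borelLower_borelUpper_eq_top]; trivial
  have e : iSup ![LieSubalgebra.toLieSubmodule _, b'.borelLower, b'.borelUpper] =
      LieSubalgebra.toLieSubmodule _ ⊔ b'.borelLower ⊔ b'.borelUpper := by simp
  rw [e, LieSubmodule.mem_sup] at hx
  obtain ⟨w, hw, z, hz, hwz⟩ := hx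
  rw [LieSubmodule.mem_sup] at hw
  obtain ⟨h, hh, y, hy, rfl⟩ := hw
  have hy' : y ∈ LieSubalgebra.lieSpan ℂ t.graph (Set.range b'.f) := hy
  have hz' : z ∈ LieSubalgebra.lieSpan ℂ t.graph (Set.range b'.e) := hz
  have hh' : h ∈ Submodule.span ℂ (Set.range b'.h) := by
    rw [← b'.coe_cartan_eq_span]; exact hh
  refine ⟨y.1, ?_, ?_⟩
  · have : y.1 ∈ (LieSubalgebra.lieSpan ℂ t.graph (Set.range b'.f)).map t.graph.incl :=
      ⟨y, hy', rfl⟩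
    rw [LieSubalgebra.map_lieSpan, ← Set.range_comp] at this
    exact this
  · obtain ⟨c, hc⟩ := (Submodule.mem_span_range_iff_exists_fun ℂ).1 hh'
    refine ⟨c, z.1, ?_, ?_⟩
    · have : z.1 ∈ (LieSubalgebra.lieSpan ℂ t.graph (Set.range b'.e)).map t.graph.incl :=
        ⟨z, hz', rfl⟩
      rw [LieSubalgebra.map_lieSpan, ← Set.range_comp] at this
      exact this
    · have h1 : h.1 = ∑ i, c i • (t.h i, b.h i) := by
        rw [← hc, AddSubmonoidClass.coe_finsetSum]
        rfl
      have h2 : p = h.1 + y.1 + z.1 := congrArg Subtype.val hwz.symm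
      rw [h2, h1, add_comm (∑ i, _) y.1]

theorem exists_mem_graphMinus {x : 𝔤} (hx : x ∈ LieSubalgebra.lieSpan ℂ 𝔤 (Set.range b.f)) :
    ∃ a, (a, x) ∈ t.graphMinus := by
  induction hx using LieSubalgebra.lieSpan_induction with
  | mem u hu => obtain ⟨i, rfl⟩ := hu; exact ⟨t.f i, LieSubalgebra.subset_lieSpan ⟨i, rfl⟩⟩
  | zero => exact ⟨0, zero_mem _⟩
  | add u v _ _ hu hv =>
    obtain ⟨a, ha⟩ := hu; obtain ⟨c, hc⟩ := hv; exact ⟨a + c, add_mem ha hc⟩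
  | smul s u _ hu => obtain ⟨a, ha⟩ := hu; exact ⟨s • a, t.graphMinus.smul_mem s ha⟩
  | lie u v _ _ hu hv =>
    obtain ⟨a, ha⟩ := hu; obtain ⟨c, hc⟩ := hv
    exact ⟨_, by have := t.graphMinus.lie_mem ha hc; rwa [lie_mk] at this⟩

theorem exists_mem_graphPlus {x : 𝔤} (hx : x ∈ LieSubalgebra.lieSpan ℂ 𝔤 (Set.range b.e)) :
    ∃ a, (a, x) ∈ t.graphPlus := by
  induction hx using LieSubalgebra.lieSpan_induction with
  | mem u hu => obtain ⟨i, rfl⟩ := hu; exact ⟨t.e i, LieSubalgebra.subset_lieSpan ⟨i, rfl⟩⟩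
  | zero => exact ⟨0, zero_mem _⟩
  | add u v _ _ hu hv =>
    obtain ⟨a, ha⟩ := hu; obtain ⟨c, hc⟩ := hv; exact ⟨a + c, add_mem ha hc⟩
  | smul s u _ hu => obtain ⟨a, ha⟩ := hu; exact ⟨s • a, t.graphPlus.smul_mem s ha⟩
  | lie u v _ _ hu hv =>
    obtain ⟨a, ha⟩ := hu; obtain ⟨c, hc⟩ := hv
    exact ⟨_, by have := t.graphPlus.lie_mem ha hc; rwa [lie_mk] at this⟩

theorem exists_mem_graph (x : 𝔤) : ∃ a, (a, x) ∈ t.graph := by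
  have hx : x ∈ LieSubalgebra.lieSpan ℂ 𝔤 (Set.range b.e ∪ Set.range b.f) := by
    rw [b.span_ef]; trivial
  induction hx using LieSubalgebra.lieSpan_induction with
  | mem u hu =>
    rcases hu with ⟨i, rfl⟩ | ⟨i, rfl⟩
    exacts [⟨t.e i, t.e_mem i⟩, ⟨t.f i, t.f_mem i⟩]
  | zero => exact ⟨0, zero_mem _⟩
  | add u v _ _ hu hv =>
    obtain ⟨a, ha⟩ := hu; obtain ⟨c, hc⟩ := hv; exact ⟨a + c, add_mem ha hc⟩
  | smul s u _ hu => obtain ⟨a, ha⟩ := hu; exact ⟨s • a, t.graph.smul_mem s ha⟩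
  | lie u v _ _ hu hv =>
    obtain ⟨a, ha⟩ := hu; obtain ⟨c, hc⟩ := hv
    exact ⟨_, by have := t.graph.lie_mem ha hc; rwa [lie_mk] at this⟩

end ChevalleyTriple

end Graph

section Verma

variable {𝔤 : Type*} [LieRing 𝔤] [LieAlgebra ℂ 𝔤] {H : LieSubalgebra ℂ 𝔤}
  {ι : Type*} [Fintype ι]

theorem env_cartan_comm (b : LieAlgebra.Basis ι H) (x y : 𝓤 H) : x * y = y * x := by
  have hab := b.isLieAbelian_cartan
  have h1 : ∀ (h : H) (y : 𝓤 H), 𝓲 h * y = y * 𝓲 h := by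
    intro h y
    refine env_left_induction lieSpan_univ_eq_top
      (LinearMap.eqLocus (LinearMap.mulLeft ℂ (𝓲 h)) (LinearMap.mulRight ℂ (𝓲 h))) ?_ ?_ y
    · simp [LinearMap.mem_eqLocus]
    · intro k _ y hy
      simp only [LinearMap.mem_eqLocus, LinearMap.mulLeft_apply, LinearMap.mulRight_apply] at hy ⊢
      have h2 : 𝓲 h * 𝓲 k = 𝓲 k * 𝓲 h := by
        rw [← sub_eq_zero, ← env_ι_lie, trivial_lie_zero, map_zero]
      rw [← mul_assoc, h2, mul_assoc, hy, mul_assoc]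
  refine env_left_induction lieSpan_univ_eq_top
    (LinearMap.eqLocus (LinearMap.mulRight ℂ y) (LinearMap.mulLeft ℂ y)) ?_ ?_ x
  · simp [LinearMap.mem_eqLocus]
  · intro k _ x hx
    simp only [LinearMap.mem_eqLocus, LinearMap.mulLeft_apply, LinearMap.mulRight_apply] at hx ⊢
    rw [mul_assoc, hx, ← mul_assoc, h1, mul_assoc]

/-- The space of the universal Verma module of the Lie algebra with the Chevalley generators but
without the Serre relations: words in the `fᵢ` with coefficients in `U(𝔥)`. -/
abbrev FreeVerma (ι : Type*) (H : LieSubalgebra ℂ 𝔤) : Type _ := List ι →₀ 𝓤 H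

variable (b : LieAlgebra.Basis ι H)

/-- The sum of the simple roots of the letters of the word `w`, at `hᵢ`: the word lowers the weight
by this sum. -/
def wordWeight (w : List ι) (i : ι) : ℤ := (w.map fun j => b.A j i).sum

/-- The operator `hᵢ` on the multiples of the word `w`. -/
noncomputable def vermaHWord (i : ι) (w : List ι) : 𝓤 H →ₗ[ℂ] FreeVerma ι H :=
  Finsupp.lsingle w ∘ₗ
    LinearMap.mulLeft ℂ (𝓲 (b.h' i) - (wordWeight b w i : ℤ) • (1 : 𝓤 H))

/-- The operator `fᵢ`: it puts the letter `i` in front of a word. -/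
noncomputable def vermaF (H : LieSubalgebra ℂ 𝔤) (i : ι) : Module.End ℂ (FreeVerma ι H) :=
  Finsupp.lmapDomain (𝓤 H) ℂ (List.cons i)

/-- The operator `hᵢ`. -/
noncomputable def vermaH (i : ι) : Module.End ℂ (FreeVerma ι H) :=
  Finsupp.lsum ℂ (vermaHWord b i)

open Classical in
/-- The operator `eᵢ` on the multiples of a word, computed from `eᵢ fⱼ = fⱼ eᵢ + δᵢⱼ hᵢ` by moving
`eᵢ` to the right until it meets the empty word, which it kills. -/
noncomputable def vermaEWord (i : ι) : List ι → (𝓤 H →ₗ[ℂ] FreeVerma ι H)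
  | [] => 0
  | j :: w => vermaF H j ∘ₗ vermaEWord i w + if i = j then vermaHWord b i w else 0

/-- The operator `eᵢ`. -/
noncomputable def vermaE (i : ι) : Module.End ℂ (FreeVerma ι H) :=
  Finsupp.lsum ℂ (vermaEWord b i)

theorem vermaF_single (i : ι) (w : List ι) (r : 𝓤 H) :
    vermaF H i (Finsupp.single w r) = Finsupp.single (i :: w) r := by
  simp [vermaF]

theorem vermaH_single (i : ι) (w : List ι) (r : 𝓤 H) :
    vermaH b i (Finsupp.single w r) =
      Finsupp.single w ((𝓲 (b.h' i) - (wordWeight b w i : ℤ) • (1 : 𝓤 H)) * r) := by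
  simp [vermaH, vermaHWord]

theorem vermaE_single_nil (i : ι) (r : 𝓤 H) : vermaE b i (Finsupp.single [] r) = 0 := by
  rw [vermaE, Finsupp.lsum_single]
  rfl

theorem end_ext_single {M : Type*} [AddCommGroup M] [Module ℂ M] {P Q : FreeVerma ι H →ₗ[ℂ] M}
    (h : ∀ w r, P (Finsupp.single w r) = Q (Finsupp.single w r)) : P = Q :=
  Finsupp.lhom_ext h

theorem verma_h_h (i j : ι) : vermaH b i * vermaH b j - vermaH b j * vermaH b i = 0 := by
  have h : vermaH b i * vermaH b j = vermaH b j * vermaH b i := by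
    refine end_ext_single fun w r => ?_
    simp only [Module.End.mul_apply, vermaH_single, ← mul_assoc]
    rw [env_cartan_comm b (𝓲 (b.h' i) - _)]
  exact sub_eq_zero.2 h

theorem verma_h_f (i j : ι) :
    vermaH b j * vermaF H i - vermaF H i * vermaH b j = -b.A i j • vermaF H i := by
  refine end_ext_single fun w r => ?_
  simp only [Module.End.mul_apply, vermaH_single, vermaF_single, LinearMap.sub_apply,
    LinearMap.smul_apply, ← Finsupp.single_sub, Finsupp.smul_single]
  congr 1
  have : wordWeight b (i :: w) j = b.A i j + wordWeight b w j := by simp [wordWeight]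
  rw [this, ← sub_mul, add_smul, neg_smul, sub_sub_sub_cancel_left, ← sub_sub, sub_right_comm,
    sub_self, zero_sub, neg_mul, smul_mul_assoc, one_mul]

theorem verma_e_f (i : ι) : vermaE b i * vermaF H i - vermaF H i * vermaE b i = vermaH b i := by
  refine end_ext_single fun w r => ?_
  simp [Module.End.mul_apply, vermaF_single, vermaE, vermaH, vermaEWord]

theorem verma_e_f_ne (i j : ι) (hij : i ≠ j) :
    vermaE b i * vermaF H j - vermaF H j * vermaE b i = 0 := by
  refine end_ext_single fun w r => ?_
  simp [Module.End.mul_apply, vermaF_single, vermaE, vermaEWord, hij]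

/-- If `[h, f] = -c f`, `[e, f] = k`, `[h, k] = 0` and `a k = c k`, then `[h, e] - a e` commutes
with `f`. -/
theorem commute_of_relations {A : Type*} [Ring A] {h e f k : A} {a c : ℤ}
    (hf : h * f - f * h = -c • f) (ef : e * f - f * e = k) (hk : h * k - k * h = 0)
    (hac : a • k = c • k) :
    (h * e - e * h - a • e) * f = f * (h * e - e * h - a • e) := by
  have h1 : h * f = f * h - c • f := by
    rw [sub_eq_iff_eq_add] at hf
    rw [hf, neg_smul]; abel
  have h2 : e * f = f * e + k := by rw [← ef]; abel
  have h3 : h * k = k * h := sub_eq_zero.1 hk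
  have e1 : h * e * f = f * (h * e) - c • (f * e) + k * h := by
    rw [mul_assoc, h2, mul_add, ← mul_assoc, h1, h3, sub_mul, smul_mul_assoc, mul_assoc]
  have e2 : e * h * f = f * (e * h) + k * h - c • (f * e + k) := by
    rw [mul_assoc, h1, mul_sub, ← mul_assoc, h2, add_mul, mul_assoc, mul_smul_comm, h2]
  rw [sub_mul, sub_mul, e1, e2, mul_sub, mul_sub, smul_mul_assoc, h2, mul_smul_comm, smul_add,
    smul_add, hac]
  abel

theorem verma_h_e (i j : ι) :
    vermaH b j * vermaE b i - vermaE b i * vermaH b j = b.A i j • vermaE b i := by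
  -- the difference of the two sides kills the empty word and commutes with all `fₖ`
  have hcomm : ∀ k,
      (vermaH b j * vermaE b i - vermaE b i * vermaH b j - b.A i j • vermaE b i) * vermaF H k =
      vermaF H k *
        (vermaH b j * vermaE b i - vermaE b i * vermaH b j - b.A i j • vermaE b i) := by
    intro k
    by_cases hik : i = k
    · subst hik
      exact commute_of_relations (A := Module.End ℂ (FreeVerma ι H)) (verma_h_f b i j)
        (verma_e_f b i) (verma_h_h b j i) rfl
    · refine commute_of_relations (A := Module.End ℂ (FreeVerma ι H)) (k := 0) (verma_h_f b k j)
        (verma_e_f_ne b i k hik) ?_ ?_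
      · rw [mul_zero, zero_mul]; exact sub_self _
      · rw [smul_zero, smul_zero]
  refine sub_eq_zero.1 (end_ext_single fun w => ?_)
  induction w with
  | nil =>
    intro r
    have h1 : vermaE b i (vermaH b j (Finsupp.single [] r)) = 0 := by
      rw [vermaH_single, vermaE_single_nil]
    change vermaH b j (vermaE b i (Finsupp.single [] r)) -
      vermaE b i (vermaH b j (Finsupp.single [] r)) -
      b.A i j • vermaE b i (Finsupp.single [] r) = 0
    rw [h1, vermaE_single_nil, map_zero, smul_zero, sub_zero, sub_zero]
  | cons k w ih =>
    intro r
    have := LinearMap.congr_fun (hcomm k) (Finsupp.single w r)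
    rw [Module.End.mul_apply, Module.End.mul_apply, vermaF_single, ih] at this
    rw [this]
    exact map_zero _

/-- The Chevalley generators on the universal Verma module without the Serre relations. -/
noncomputable def vermaTriple : ChevalleyTriple b (Module.End ℂ (FreeVerma ι H)) where
  h := vermaH b
  e := vermaE b
  f := vermaF H
  h_h := verma_h_h b
  h_e := verma_h_e b
  h_f := verma_h_f b
  e_f := verma_e_f b
  e_f_ne := verma_e_f_ne b

/-- The combinations of the nonempty words. -/
noncomputable def vermaLower (ι : Type*) (H : LieSubalgebra ℂ 𝔤) :
    Submodule ℂ (FreeVerma ι H) :=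
  LinearMap.ker (Finsupp.lapply [] : FreeVerma ι H →ₗ[ℂ] 𝓤 H)

theorem vermaF_mem_lower (i : ι) (m : FreeVerma ι H) : vermaF H i m ∈ vermaLower ι H := by
  have : Finsupp.lapply [] ∘ₗ vermaF H i = (0 : FreeVerma ι H →ₗ[ℂ] 𝓤 H) := by
    refine end_ext_single fun w r => ?_
    simp [vermaF_single]
  exact LinearMap.congr_fun this m

theorem graphMinus_range {p : Module.End ℂ (FreeVerma ι H) × 𝔤}
    (hp : p ∈ (vermaTriple b).graphMinus) (m : FreeVerma ι H) : p.1 m ∈ vermaLower ι H := by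
  induction hp using LieSubalgebra.lieSpan_induction generalizing m with
  | mem u hu => obtain ⟨i, rfl⟩ := hu; exact vermaF_mem_lower i m
  | zero => exact zero_mem _
  | add u v _ _ hu hv => exact add_mem (hu m) (hv m)
  | smul s u _ hu => exact Submodule.smul_mem _ s (hu m)
  | lie u v _ _ hu hv =>
    obtain ⟨u1, u2⟩ := u
    obtain ⟨v1, v2⟩ := v
    rw [ChevalleyTriple.lie_mk]
    exact sub_mem (hu _) (hv _)

theorem graphPlus_single_nil {p : Module.End ℂ (FreeVerma ι H) × 𝔤}
    (hp : p ∈ (vermaTriple b).graphPlus) (r : 𝓤 H) : p.1 (Finsupp.single [] r) = 0 := by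
  induction hp using LieSubalgebra.lieSpan_induction with
  | mem u hu => obtain ⟨i, rfl⟩ := hu; exact vermaE_single_nil b i r
  | zero => rfl
  | add u v _ _ hu hv =>
    rw [Prod.fst_add, LinearMap.add_apply, hu, hv, add_zero]
  | smul s u _ hu => rw [Prod.smul_fst, LinearMap.smul_apply, hu, smul_zero]
  | lie u v _ _ hu hv =>
    obtain ⟨u1, u2⟩ := u
    obtain ⟨v1, v2⟩ := v
    rw [ChevalleyTriple.lie_mk]
    change u1 (v1 _) - v1 (u1 _) = 0
    have h1 : u1 (Finsupp.single [] r) = 0 := hu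
    have h2 : v1 (Finsupp.single [] r) = 0 := hv
    rw [h1, h2, map_zero, map_zero, sub_zero]

end Verma

section SerreQuotient

variable {𝔤 : Type*} [LieRing 𝔤] [LieAlgebra ℂ 𝔤] {H : LieSubalgebra ℂ 𝔤}
  {ι : Type*} [Fintype ι] {b : LieAlgebra.Basis ι H} {M : Type*} [AddCommGroup M] [Module ℂ M]
  (t : ChevalleyTriple b (Module.End ℂ M))

/-- The submodule generated by the Serre relations, in a module over the Lie algebra with the
Chevalley generators but without the Serre relations. Instead of listing these relations, one takes
all combinations `a` of the generators on `M` whose counterpart in `𝔤` is zero. -/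
def serreSubmodule : Submodule ℂ M :=
  Submodule.span ℂ {v | ∃ a m, (a, (0 : 𝔤)) ∈ t.graph ∧ v = a m}

theorem serreSubmodule_stable {p : Module.End ℂ M × 𝔤} (hp : p ∈ t.graph) :
    serreSubmodule t ≤ (serreSubmodule t).comap p.1 := by
  refine Submodule.span_le.2 ?_
  rintro _ ⟨a, m, ha, rfl⟩
  obtain ⟨c, x⟩ := p
  have hc : (c * a - a * c, (0 : 𝔤)) ∈ t.graph := by
    have := t.graph.lie_mem hp ha
    rw [ChevalleyTriple.lie_mk, lie_zero] at this
    exact this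
  have h1 : c (a m) = a (c m) + (c * a - a * c) m := by simp [Module.End.mul_apply]
  change c (a m) ∈ serreSubmodule t
  rw [h1]
  exact add_mem (Submodule.subset_span ⟨a, c m, ha, rfl⟩)
    (Submodule.subset_span ⟨_, m, hc, rfl⟩)

/-- `𝔤` acts on the quotient by the Serre relations. -/
theorem exists_serreQuotientRep : ∃ π : 𝔤 →ₗ⁅ℂ⁆ Module.End ℂ (M ⧸ serreSubmodule t),
    ∀ p ∈ t.graph, ∀ m,
      π p.2 ((serreSubmodule t).mkQ m) = (serreSubmodule t).mkQ (p.1 m) := by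
  -- two lifts of `x` to the graph differ by a pair `(a, 0)`, so they act alike on the quotient
  choose s hs using t.exists_mem_graph
  let T : 𝔤 → Module.End ℂ (M ⧸ serreSubmodule t) := fun x =>
    (serreSubmodule t).mapQ (serreSubmodule t) (s x) (serreSubmodule_stable t (hs x))
  have hT : ∀ p ∈ t.graph, ∀ m,
      T p.2 ((serreSubmodule t).mkQ m) = (serreSubmodule t).mkQ (p.1 m) := by
    intro p hp m
    have h1 : (s p.2 - p.1, (0 : 𝔤)) ∈ t.graph := by
      have := sub_mem (hs p.2) hp
      rwa [show ((s p.2, p.2) : _ × 𝔤) - p = (s p.2 - p.1, 0) from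
        Prod.ext rfl (sub_self _)] at this
    have h2 : T p.2 ((serreSubmodule t).mkQ m) = (serreSubmodule t).mkQ (s p.2 m) := rfl
    rw [h2, ← sub_eq_zero, ← map_sub]
    exact (Submodule.Quotient.mk_eq_zero _).2 (Submodule.subset_span ⟨_, m, h1, rfl⟩)
  have hTs : ∀ x m, T x ((serreSubmodule t).mkQ m) = (serreSubmodule t).mkQ (s x m) :=
    fun x m => rfl
  have hext : ∀ P Q : Module.End ℂ (M ⧸ serreSubmodule t),
      (∀ m, P ((serreSubmodule t).mkQ m) = Q ((serreSubmodule t).mkQ m)) → P = Q :=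
    fun P Q h => LinearMap.ext fun q => by
      obtain ⟨m, rfl⟩ := Submodule.mkQ_surjective _ q
      exact h m
  let Tl : 𝔤 →ₗ[ℂ] Module.End ℂ (M ⧸ serreSubmodule t) :=
    { toFun := T
      map_add' := fun x y => hext _ _ fun m => by
        rw [hT (s x + s y, x + y) (add_mem (hs x) (hs y)), LinearMap.add_apply,
          LinearMap.add_apply, hTs, hTs, map_add]
      map_smul' := fun c x => hext _ _ fun m => by
        rw [hT (c • s x, c • x) (t.graph.smul_mem c (hs x)), LinearMap.smul_apply,
          RingHom.id_apply, LinearMap.smul_apply, hTs, map_smul] }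
  refine ⟨repOfCommutator Tl fun x y => hext _ _ fun m => ?_, hT⟩
  have h1 : (s x * s y - s y * s x, ⁅x, y⁆) ∈ t.graph := by
    have := t.graph.lie_mem (hs x) (hs y)
    rwa [ChevalleyTriple.lie_mk] at this
  change T ⁅x, y⁆ ((serreSubmodule t).mkQ m) =
    T x (T y ((serreSubmodule t).mkQ m)) - T y (T x ((serreSubmodule t).mkQ m))
  rw [hT _ h1, hTs, hTs, hTs, hTs, ← map_sub]
  rfl

end SerreQuotient

section VermaModule

variable {𝔤 : Type*} [LieRing 𝔤] [LieAlgebra ℂ 𝔤] [FiniteDimensional ℂ 𝔤]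
  [LieAlgebra.IsSimple ℂ 𝔤] {H : LieSubalgebra ℂ 𝔤} {ι : Type*} [Fintype ι]
  [H.IsCartanSubalgebra] (b : LieAlgebra.Basis ι H)

theorem graphMinus_snd {p : Module.End ℂ (FreeVerma ι H) × 𝔤}
    (hp : p ∈ (vermaTriple b).graphMinus) : p.2 ∈ nMinus b := by
  induction hp using LieSubalgebra.lieSpan_induction with
  | mem u hu => obtain ⟨i, rfl⟩ := hu; exact f_mem_nMinus b i
  | zero => exact zero_mem _
  | add u v _ _ hu hv => exact add_mem hu hv
  | smul s u _ hu => exact (nMinus b).smul_mem s hu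
  | lie u v _ _ hu hv => exact (nMinus b).lie_mem hu hv

theorem graphPlus_snd {p : Module.End ℂ (FreeVerma ι H) × 𝔤}
    (hp : p ∈ (vermaTriple b).graphPlus) : p.2 ∈ nPlus b := by
  induction hp using LieSubalgebra.lieSpan_induction with
  | mem u hu => obtain ⟨i, rfl⟩ := hu; exact e_mem_nPlus b i
  | zero => exact zero_mem _
  | add u v _ _ hu hv => exact add_mem hu hv
  | smul s u _ hu => exact (nPlus b).smul_mem s hu
  | lie u v _ _ hu hv => exact (nPlus b).lie_mem hu hv

/-- The Serre relations map the free Verma module to the combinations of nonempty words: by the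
triangular decomposition of the graph, and because `𝔤 = 𝔫₋ ⊕ 𝔥 ⊕ 𝔫₊`, they have no component
along the `hᵢ`. -/
theorem serre_mem_lower {a : Module.End ℂ (FreeVerma ι H)}
    (ha : (a, (0 : 𝔤)) ∈ (vermaTriple b).graph) (m : FreeVerma ι H) : a m ∈ vermaLower ι H := by
  have hnil : ∀ a : Module.End ℂ (FreeVerma ι H), (a, (0 : 𝔤)) ∈ (vermaTriple b).graph → ∀ r,
      a (Finsupp.single [] r) ∈ vermaLower ι H := by
    intro a ha r
    obtain ⟨q, hq, c, s, hs, h⟩ := (vermaTriple b).exists_graph_triangular ha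
    have h2 : (0 : 𝔤) = q.2 + ((∑ i, c i • b.h' i : H) : 𝔤) + s.2 := by
      have : (0 : 𝔤) = (q + ∑ i, c i • ((vermaTriple b).h i, b.h i) + s).2 := congrArg Prod.snd h
      rw [Prod.snd_add, Prod.snd_add, Prod.snd_sum] at this
      rw [this, AddSubmonoidClass.coe_finsetSum]
      rfl
    obtain ⟨-, h0, -⟩ := triangular_eq_zero b (graphMinus_snd b hq) (graphPlus_snd b hs) h2.symm
    -- the `hᵢ` are linearly independent in `𝔤`
    have hc : c = 0 := by
      have : ∑ i, c i • b.h i = 0 := by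
        have := congrArg (Subtype.val : H → 𝔤) h0
        rw [AddSubmonoidClass.coe_finsetSum] at this
        exact this
      exact funext fun i => Fintype.linearIndependent_iff.1 b.linInd c this i
    have h1 : a = q.1 + s.1 := by
      have : a = (q + ∑ i, c i • ((vermaTriple b).h i, b.h i) + s).1 := congrArg Prod.fst h
      rw [Prod.fst_add, Prod.fst_add, Prod.fst_sum] at this
      simpa [hc] using this
    rw [h1, LinearMap.add_apply, graphPlus_single_nil b hs, add_zero]
    exact graphMinus_range b hq _
  have hall : ∀ (w : List ι) (a : Module.End ℂ (FreeVerma ι H)),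
      (a, (0 : 𝔤)) ∈ (vermaTriple b).graph → ∀ r, a (Finsupp.single w r) ∈ vermaLower ι H := by
    intro w
    induction w with
    | nil => exact hnil
    | cons j w ih =>
      intro a ha r
      have hc : (a * vermaF H j - vermaF H j * a, (0 : 𝔤)) ∈ (vermaTriple b).graph := by
        have := (vermaTriple b).graph.lie_mem ha ((vermaTriple b).f_mem j)
        rw [ChevalleyTriple.lie_mk, zero_lie] at this
        exact this
      -- `a fⱼ = [a, fⱼ] + fⱼ a`, and `[a, fⱼ]` is again a Serre relation
      have h1 : a (Finsupp.single (j :: w) r) = (a * vermaF H j - vermaF H j * a)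
          (Finsupp.single w r) + vermaF H j (a (Finsupp.single w r)) := by
        simp [Module.End.mul_apply, vermaF_single]
      rw [h1]
      exact add_mem (ih _ hc r) (vermaF_mem_lower j _)
  induction m using Finsupp.induction_linear with
  | zero => rw [map_zero]; exact zero_mem _
  | add m m' h h' => rw [map_add]; exact add_mem h h'
  | single w r => exact hall w a ha r

theorem serreSubmodule_le : serreSubmodule (vermaTriple b) ≤ vermaLower ι H := by
  refine Submodule.span_le.2 ?_
  rintro _ ⟨a, m, ha, rfl⟩
  exact serre_mem_lower b ha m

/-- The projection `γ` exists: it is the coefficient of the highest weight vector in the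
universal Verma module. -/
theorem exists_gammaProj : ∃ γ : 𝓤 𝔤 →ₗ[ℂ] 𝓤 H,
    (∀ x, γ (envIncl H x) = x) ∧
    (∀ x ∈ nMinus b, ∀ g, γ (𝓲 x * g) = 0) ∧
    (∀ x ∈ nPlus b, ∀ g, γ (g * 𝓲 x) = 0) := by
  obtain ⟨π, hπ⟩ := exists_serreQuotientRep (vermaTriple b)
  let q := (serreSubmodule (vermaTriple b)).mkQ
  let top : (FreeVerma ι H ⧸ serreSubmodule (vermaTriple b)) →ₗ[ℂ] 𝓤 H :=
    (serreSubmodule (vermaTriple b)).liftQ (Finsupp.lapply []) (serreSubmodule_le b)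
  have htop : ∀ m, top ((serreSubmodule (vermaTriple b)).mkQ m) = m [] := fun m => rfl
  let γ : 𝓤 𝔤 →ₗ[ℂ] 𝓤 H :=
    { toFun := fun g => top (envAct π g (q (Finsupp.single [] 1)))
      map_add' := fun x y => by rw [map_add, LinearMap.add_apply, map_add]
      map_smul' := fun c x => by
        rw [map_smul, LinearMap.smul_apply, map_smul, RingHom.id_apply] }
  have hH : ∀ (h : H) (r : 𝓤 H), π h (q (Finsupp.single [] r)) =
      q (Finsupp.single [] (𝓲 h * r)) := by
    rintro ⟨h, hh⟩ r
    have hspan : h ∈ Submodule.span ℂ (Set.range b.h) := by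
      rw [← b.coe_cartan_eq_span]; exact hh
    obtain ⟨c, rfl⟩ := (Submodule.mem_span_range_iff_exists_fun ℂ).1 hspan
    have hg : (∑ i, c i • vermaH b i, ∑ i, c i • b.h i) ∈ (vermaTriple b).graph := by
      have : ∑ i, c i • (vermaH b i, b.h i) ∈ (vermaTriple b).graph :=
        sum_mem fun i _ => (vermaTriple b).graph.smul_mem _ ((vermaTriple b).h_mem i)
      convert this using 1
      exact Prod.ext (by simp [Prod.fst_sum]) (by simp [Prod.snd_sum])
    rw [hπ _ hg]
    congr 1
    have h1 : (⟨∑ i, c i • b.h i, hh⟩ : H) = ∑ i, c i • b.h' i := by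
      refine Subtype.ext ?_
      rw [AddSubmonoidClass.coe_finsetSum]
      rfl
    rw [h1, map_sum, LinearMap.sum_apply, Finset.sum_mul, Finsupp.single_finsetSum]
    refine Finset.sum_congr rfl fun i _ => ?_
    rw [LinearMap.smul_apply, vermaH_single, map_smul, smul_mul_assoc, Finsupp.smul_single]
    simp [wordWeight]
  refine ⟨γ, fun x => ?_, fun x hx g => ?_, fun x hx g => ?_⟩
  · have hx : ∀ x : 𝓤 H, envAct π (envIncl H x) (q (Finsupp.single [] 1)) =
        q (Finsupp.single [] x) := by
      intro x
      let P : 𝓤 H →ₗ[ℂ] (FreeVerma ι H ⧸ serreSubmodule (vermaTriple b)) :=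
        { toFun := fun x => envAct π (envIncl H x) (q (Finsupp.single [] 1))
          map_add' := fun x y => by rw [map_add, map_add, LinearMap.add_apply]
          map_smul' := fun c x => by
            rw [map_smul, map_smul, LinearMap.smul_apply, RingHom.id_apply] }
      refine env_left_induction lieSpan_univ_eq_top
        (LinearMap.eqLocus P (q ∘ₗ Finsupp.lsingle [])) ?_ ?_ x
      · change envAct π (envIncl H 1) _ = _
        rw [map_one, map_one]
        rfl
      · intro h _ y hy
        replace hy : envAct π (envIncl H y) (q (Finsupp.single [] 1)) =
          q (Finsupp.single [] y) := hy
        change envAct π (envIncl H (𝓲 h * y)) (q (Finsupp.single [] 1)) =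
          q (Finsupp.single [] (𝓲 h * y))
        rw [map_mul, map_mul, Module.End.mul_apply, hy, envIncl_ι, envAct_ι, hH]
    change top (envAct π (envIncl H x) _) = x
    rw [hx, htop, Finsupp.single_eq_same]
  · rw [nMinus_eq] at hx
    obtain ⟨a, ha⟩ := (vermaTriple b).exists_mem_graphMinus hx
    change top (envAct π (𝓲 x * g) _) = 0
    rw [map_mul, Module.End.mul_apply, envAct_ι]
    obtain ⟨m, hm⟩ := Submodule.mkQ_surjective _
      (envAct π g (q (Finsupp.single [] 1)))
    rw [← hm, hπ _ ((vermaTriple b).graphMinus_le ha)]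
    exact graphMinus_range b ha m
  · rw [nPlus_eq] at hx
    obtain ⟨a, ha⟩ := (vermaTriple b).exists_mem_graphPlus hx
    change top (envAct π (g * 𝓲 x) _) = 0
    rw [map_mul, Module.End.mul_apply, envAct_ι, hπ _ ((vermaTriple b).graphPlus_le ha),
      graphPlus_single_nil b ha, map_zero, map_zero, map_zero]

end VermaModule

/-! ### The triangular decomposition of `U(𝔤)` and the Shapovalov form -/

section Projection

variable {𝔤 : Type*} [LieRing 𝔤] [LieAlgebra ℂ 𝔤] [FiniteDimensional ℂ 𝔤]
  [LieAlgebra.IsSimple ℂ 𝔤] {H : LieSubalgebra ℂ 𝔤} {ι : Type*} [Fintype ι]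
  [H.IsCartanSubalgebra] (b : LieAlgebra.Basis ι H)

/-- The spanning part of the triangular decomposition: `U(𝔤)` is the smallest subspace that contains
`U(𝔫₋)` and is stable under right multiplication by `𝔥` and `𝔫₊`. -/
theorem triangular_induction (P : Submodule ℂ (𝓤 𝔤))
    (h0 : ∀ a : UMinus b, envIncl (nMinus b) a ∈ P)
    (hH : ∀ h : H, ∀ y ∈ P, y * 𝓲 (h : 𝔤) ∈ P) (hp : ∀ x ∈ nPlus b, ∀ y ∈ P, y * 𝓲 x ∈ P)
    (z : 𝓤 𝔤) : z ∈ P := by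
  -- `W = U(𝔫₋) B`, where `B` is generated by `𝔥` and `𝔫₊`, is a left ideal: an element of `𝔤` is
  -- moved past `U(𝔫₋)` by commutators, and then decomposed along `𝔫₋ + 𝔥 + 𝔫₊`
  let B : Subalgebra ℂ (𝓤 𝔤) :=
    Algebra.adjoin ℂ (Set.range (fun h : H => 𝓲 (h : 𝔤)) ∪ 𝓲 '' (nPlus b : Set 𝔤))
  let W : Submodule ℂ (𝓤 𝔤) :=
    Submodule.span ℂ {w | ∃ a : UMinus b, ∃ c ∈ B, w = envIncl (nMinus b) a * c}
  have hWP : W ≤ P := by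
    let K : Subalgebra ℂ (𝓤 𝔤) :=
      { carrier := {c | ∀ y ∈ P, y * c ∈ P}
        mul_mem' := fun {c d} hc hd y hy => by rw [← mul_assoc]; exact hd _ (hc _ hy)
        add_mem' := fun {c d} hc hd y hy => by
          rw [mul_add]; exact P.add_mem (hc _ hy) (hd _ hy)
        algebraMap_mem' := fun r y hy => by
          rw [← Algebra.commutes, ← Algebra.smul_def]; exact P.smul_mem r hy }
    have hBK : B ≤ K := by
      refine Algebra.adjoin_le ?_
      rintro _ (⟨h, rfl⟩ | ⟨x, hx, rfl⟩)
      exacts [hH h, hp x hx]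
    refine Submodule.span_le.2 ?_
    rintro _ ⟨a, c, hc, rfl⟩
    exact hBK hc _ (h0 a)
  have hWr : ∀ c ∈ B, ∀ w ∈ W, w * c ∈ W := by
    intro c hc w hw
    have : W ≤ W.comap (LinearMap.mulRight ℂ c) := by
      refine Submodule.span_le.2 ?_
      rintro _ ⟨a, d, hd, rfl⟩
      exact Submodule.subset_span ⟨a, d * c, B.mul_mem hd hc, mul_assoc _ _ _⟩
    exact this hw
  have hWl : ∀ a : UMinus b, ∀ w ∈ W, envIncl (nMinus b) a * w ∈ W := by
    intro a w hw
    have : W ≤ W.comap (LinearMap.mulLeft ℂ (envIncl (nMinus b) a)) := by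
      refine Submodule.span_le.2 ?_
      rintro _ ⟨a', d, hd, rfl⟩
      refine Submodule.subset_span ⟨a * a', d, hd, ?_⟩
      rw [LinearMap.mulLeft_apply, map_mul, mul_assoc]
    exact this hw
  have hWa : ∀ (a : UMinus b) (x : 𝔤), 𝓲 x * envIncl (nMinus b) a ∈ W := by
    intro a
    let Q : Submodule ℂ (UMinus b) :=
      { carrier := {a | ∀ x : 𝔤, 𝓲 x * envIncl (nMinus b) a ∈ W}
        add_mem' := fun {a c} ha hc x => by
          rw [map_add, mul_add]; exact W.add_mem (ha x) (hc x)
        zero_mem' := fun x => by rw [map_zero, mul_zero]; exact W.zero_mem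
        smul_mem' := fun r a ha x => by
          rw [map_smul, mul_smul_comm]; exact W.smul_mem r (ha x) }
    refine env_left_induction lieSpan_univ_eq_top Q ?_ ?_ a
    · intro x
      obtain ⟨y, hy, h, z, hz, rfl⟩ := exists_triangular b x
      rw [map_one, mul_one, map_add, map_add]
      refine W.add_mem (W.add_mem ?_ ?_) ?_
      · refine Submodule.subset_span ⟨𝓲 ⟨y, hy⟩, 1, B.one_mem, ?_⟩
        rw [envIncl_ι, mul_one]
      · refine Submodule.subset_span ⟨1, 𝓲 (h : 𝔤),
          Algebra.subset_adjoin (Or.inl ⟨h, rfl⟩), ?_⟩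
        rw [map_one, one_mul]
      · refine Submodule.subset_span ⟨1, 𝓲 z, Algebra.subset_adjoin (Or.inr ⟨z, hz, rfl⟩), ?_⟩
        rw [map_one, one_mul]
    · intro y _ a ha x
      have h1 : 𝓲 x * envIncl (nMinus b) (𝓲 y * a) =
          envIncl (nMinus b) (𝓲 y) * (𝓲 x * envIncl (nMinus b) a) +
            𝓲 ⁅x, (y : 𝔤)⁆ * envIncl (nMinus b) a := by
        rw [env_ι_lie, map_mul, envIncl_ι]
        noncomm_ring
      rw [h1]
      exact W.add_mem (hWl _ _ (ha x)) (ha _)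
  have hWtop : z ∈ W := by
    refine env_left_induction lieSpan_univ_eq_top W ?_ ?_ z
    · exact Submodule.subset_span ⟨1, 1, B.one_mem, by rw [map_one, one_mul]⟩
    · intro x _ w hw
      have : W ≤ W.comap (LinearMap.mulLeft ℂ (𝓲 x)) := by
        refine Submodule.span_le.2 ?_
        rintro _ ⟨a, d, hd, rfl⟩
        change 𝓲 x * (envIncl (nMinus b) a * d) ∈ W
        rw [← mul_assoc]
        exact hWr d hd _ (hWa a x)
      exact this hw
  exact hWP hWtop

/-- The left ideal `U(𝔤) 𝔫₊` is stable under right multiplication by `U(𝔥)`. -/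
theorem mul_nPlus_mul_cartan {E : Type*} [AddCommGroup E] [Module ℂ E] (d : 𝓤 𝔤 →ₗ[ℂ] E)
    (hp : ∀ x ∈ nPlus b, ∀ g, d (g * 𝓲 x) = 0) (y : 𝓤 H) :
    ∀ x ∈ nPlus b, ∀ g, d (g * 𝓲 x * envIncl H y) = 0 := by
  let Q : Submodule ℂ (𝓤 H) :=
    { carrier := {y | ∀ x ∈ nPlus b, ∀ g, d (g * 𝓲 x * envIncl H y) = 0}
      add_mem' := fun {a c} ha hc x hx g => by
        rw [map_add, mul_add, map_add, ha x hx g, hc x hx g, add_zero]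
      zero_mem' := fun x _ g => by rw [map_zero, mul_zero, map_zero]
      smul_mem' := fun r a ha x hx g => by
        rw [map_smul, mul_smul_comm, map_smul, ha x hx g, smul_zero] }
  refine env_left_induction lieSpan_univ_eq_top Q ?_ ?_ y
  · intro x hx g
    rw [map_one, mul_one, hp x hx]
  · intro h _ y hy x hx g
    have h1 : g * 𝓲 x * envIncl H (𝓲 h * y) = g * 𝓲 (h : 𝔤) * 𝓲 x * envIncl H y -
        g * 𝓲 ⁅(h : 𝔤), x⁆ * envIncl H y := by
      rw [env_ι_lie, map_mul, envIncl_ι]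
      noncomm_ring
    rw [h1, map_sub, hy x hx, hy _ (lie_h_mem_nPlus b h hx), sub_zero]

/-- A linear map on `U(𝔤)` that vanishes on `U(𝔥)`, `𝔫₋ U(𝔤)` and `U(𝔤) 𝔫₊` is zero, because
`U(𝔤)` is the sum of these subspaces. In particular `γ` is unique. -/
theorem eq_zero_of_triangular {E : Type*} [AddCommGroup E] [Module ℂ E] (d : 𝓤 𝔤 →ₗ[ℂ] E)
    (hH : ∀ y, d (envIncl H y) = 0) (hm : ∀ x ∈ nMinus b, ∀ g, d (𝓲 x * g) = 0)
    (hp : ∀ x ∈ nPlus b, ∀ g, d (g * 𝓲 x) = 0) (z : 𝓤 𝔤) : d z = 0 := by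
  let P : Submodule ℂ (𝓤 𝔤) :=
    { carrier := {g | ∀ y, d (g * envIncl H y) = 0}
      add_mem' := fun {a c} ha hc y => by rw [add_mul, map_add, ha, hc, add_zero]
      zero_mem' := fun y => by rw [zero_mul, map_zero]
      smul_mem' := fun r a ha y => by rw [smul_mul_assoc, map_smul, ha, smul_zero] }
  have hz : z ∈ P := by
    refine triangular_induction b P (fun a => ?_) (fun h g hg y => ?_) (fun x hx g _ y => ?_) z
    · refine env_left_induction lieSpan_univ_eq_top
        (P.comap (envIncl (nMinus b)).toLinearMap) ?_ ?_ a
      · intro y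
        rw [AlgHom.toLinearMap_apply, map_one, one_mul, hH]
      · intro x _ a _ y
        rw [AlgHom.toLinearMap_apply, map_mul (envIncl (nMinus b)), envIncl_ι, mul_assoc, hm _ x.2]
    · have := hg (𝓲 h * y)
      rwa [map_mul (envIncl H), envIncl_ι, ← mul_assoc] at this
    · exact mul_nPlus_mul_cartan b d hp y x hx g
  have := hz 1
  rwa [map_one, mul_one] at this

theorem gammaProj_spec :
    (∀ x, gammaProj b (envIncl H x) = x) ∧
    (∀ x ∈ nMinus b, ∀ g, gammaProj b (𝓲 x * g) = 0) ∧
    (∀ x ∈ nPlus b, ∀ g, gammaProj b (g * 𝓲 x) = 0) :=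
  theElement_spec (exists_gammaProj b)

theorem gammaProj_mul_cartan (g : 𝓤 𝔤) (y : 𝓤 H) :
    gammaProj b (g * envIncl H y) = gammaProj b g * y := by
  obtain ⟨h1, h2, h3⟩ := gammaProj_spec b
  have := eq_zero_of_triangular b
    (gammaProj b ∘ₗ LinearMap.mulRight ℂ (envIncl H y) - LinearMap.mulRight ℂ y ∘ₗ gammaProj b)
    (fun x => ?_) (fun x hx g => ?_) (fun x hx g => ?_) g
  · exact sub_eq_zero.1 this
  · simp only [LinearMap.sub_apply, LinearMap.comp_apply, LinearMap.mulRight_apply]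
    rw [← map_mul, h1, h1, sub_self]
  · simp only [LinearMap.sub_apply, LinearMap.comp_apply, LinearMap.mulRight_apply]
    rw [mul_assoc, h2 x hx, h2 x hx, zero_mul, sub_zero]
  · simp only [LinearMap.sub_apply, LinearMap.comp_apply, LinearMap.mulRight_apply]
    rw [mul_nPlus_mul_cartan b _ h3 y x hx, h3 x hx, zero_mul, sub_zero]

/-- The anti-involution `a ω` of `U(𝔤)`, which exchanges `eᵢ` and `fᵢ` and fixes `𝔥`. -/
noncomputable def tau : 𝓤 𝔤 →ₗ[ℂ] 𝓤 𝔤 := antipode 𝔤 ∘ₗ (omega b).toLinearMap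

theorem tau_apply (z : 𝓤 𝔤) : tau b z = antipode 𝔤 (omega b z) := rfl

theorem tau_one : tau b 1 = 1 := by rw [tau_apply, map_one, antipode_one]

theorem tau_mul (x y : 𝓤 𝔤) : tau b (x * y) = tau b y * tau b x := by
  rw [tau_apply, map_mul, antipode_mul]; rfl

theorem tau_ι (x : 𝔤) : tau b (𝓲 x) = -𝓲 (chevalley b x) := by
  rw [tau_apply, omega_ι, antipode_ι]

theorem tau_tau (z : 𝓤 𝔤) : tau b (tau b z) = z := by
  rw [tau_apply, tau_apply, ← antipode_omega, omega_omega, antipode_antipode]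

theorem tau_cartan (y : 𝓤 H) : tau b (envIncl H y) = envIncl H y := by
  refine env_left_induction lieSpan_univ_eq_top
    (LinearMap.eqLocus (tau b ∘ₗ (envIncl H).toLinearMap) (envIncl H).toLinearMap) ?_ ?_ y
  · simp [LinearMap.mem_eqLocus, tau_one]
  · intro h _ y hy
    simp only [LinearMap.mem_eqLocus, LinearMap.comp_apply, AlgHom.toLinearMap_apply] at hy ⊢
    rw [map_mul, tau_mul, hy, envIncl_ι, tau_ι, chevalley_cartan, map_neg, neg_neg, ← envIncl_ι,
      ← map_mul, ← map_mul, env_cartan_comm b]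

/-- `γ` is invariant under the anti-involution `a ω`; hence the Shapovalov form is symmetric. -/
theorem gammaProj_tau (g : 𝓤 𝔤) : gammaProj b (tau b g) = gammaProj b g := by
  obtain ⟨h1, h2, h3⟩ := gammaProj_spec b
  have := eq_zero_of_triangular b (gammaProj b ∘ₗ tau b - gammaProj b)
    (fun x => ?_) (fun x hx g => ?_) (fun x hx g => ?_) g
  · exact sub_eq_zero.1 this
  · simp only [LinearMap.sub_apply, LinearMap.comp_apply]
    rw [tau_cartan, sub_self]
  · simp only [LinearMap.sub_apply, LinearMap.comp_apply]
    rw [tau_mul, tau_ι, ← map_neg, h3 _ (neg_mem (chevalley_mem_nPlus b hx)), h2 x hx, sub_zero]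
  · simp only [LinearMap.sub_apply, LinearMap.comp_apply]
    rw [tau_mul, tau_ι, ← map_neg, h2 _ (neg_mem (chevalley_mem_nMinus b hx)), h3 x hx, sub_zero]

/-- `g ↦ γ(g)(μ)`, the coefficient of the highest weight vector in the Verma module `M_μ`. -/
noncomputable def vacuum (μ : Module.Dual ℂ H) : 𝓤 𝔤 →ₗ[ℂ] ℂ :=
  (evalAt μ).toLinearMap ∘ₗ gammaProj b

variable (μ : Module.Dual ℂ H)

theorem evalAt_ι (h : H) : evalAt μ (𝓲 h) = μ h := by
  unfold evalAt
  rw [UniversalEnvelopingAlgebra.lift_ι_apply]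
  rfl

theorem vacuum_one : vacuum b μ 1 = 1 := by
  have := (gammaProj_spec b).1 1
  rw [map_one] at this
  change evalAt μ (gammaProj b 1) = 1
  rw [this, map_one]

theorem vacuum_nMinus_mul {x : 𝔤} (hx : x ∈ nMinus b) (g : 𝓤 𝔤) : vacuum b μ (𝓲 x * g) = 0 := by
  change evalAt μ (gammaProj b (𝓲 x * g)) = 0
  rw [(gammaProj_spec b).2.1 x hx, map_zero]

theorem vacuum_mul_nPlus {x : 𝔤} (hx : x ∈ nPlus b) (g : 𝓤 𝔤) : vacuum b μ (g * 𝓲 x) = 0 := by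
  change evalAt μ (gammaProj b (g * 𝓲 x)) = 0
  rw [(gammaProj_spec b).2.2 x hx, map_zero]

theorem vacuum_mul_cartan (h : H) (g : 𝓤 𝔤) :
    vacuum b μ (g * 𝓲 (h : 𝔤)) = μ h * vacuum b μ g := by
  change evalAt μ (gammaProj b (g * 𝓲 (h : 𝔤))) = _
  rw [← envIncl_ι, gammaProj_mul_cartan, map_mul, evalAt_ι, mul_comm]
  rfl

theorem vacuum_tau (g : 𝓤 𝔤) : vacuum b μ (tau b g) = vacuum b μ g := by
  change evalAt μ (gammaProj b (tau b g)) = _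
  rw [gammaProj_tau]; rfl

theorem vacuum_cartan_mul (h : H) (g : 𝓤 𝔤) :
    vacuum b μ (𝓲 (h : 𝔤) * g) = μ h * vacuum b μ g := by
  rw [← vacuum_tau, tau_mul, tau_ι, chevalley_cartan, map_neg, neg_neg, vacuum_mul_cartan,
    vacuum_tau]

theorem shapU_eq (x y : 𝓤 𝔤) : shapU b μ x y = vacuum b μ (tau b x * y) := rfl

theorem shapU_symm (x y : 𝓤 𝔤) : shapU b μ x y = shapU b μ y x := by
  rw [shapU_eq, ← vacuum_tau, tau_mul, tau_tau, shapU_eq]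

theorem shapMinus_symm (x y : UMinus b) : shapMinus b μ x y = shapMinus b μ y x := by
  rw [shapMinus_apply, shapMinus_apply, shapU_symm]

/-- With `shapMinus_one_one`: the form `S_μ(1, ·)` is the counit of `U(𝔫₋)`. -/
theorem shapMinus_one_ι_mul (x : nMinus b) (y : UMinus b) : shapMinus b μ 1 (𝓲 x * y) = 0 := by
  rw [shapMinus_apply, shapU_eq, map_one, tau_one, one_mul, map_mul, envIncl_ι,
    vacuum_nMinus_mul b μ x.2]

theorem shapMinus_one_one : shapMinus b μ 1 1 = 1 := by
  rw [shapMinus_apply, shapU_eq, map_one, tau_one, one_mul, vacuum_one]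

end Projection

/-! ### Spans of eigenvectors -/

section Eigen

variable {M : Type*} [AddCommGroup M] [Module ℂ M]

/-- The span of the eigenvectors of `D` with eigenvalues in `S`. -/
def eigenSpan (D : Module.End ℂ M) (S : Set ℂ) : Submodule ℂ M :=
  Submodule.span ℂ {w | ∃ c ∈ S, D w = c • w}

theorem eigenSpan_mono (D : Module.End ℂ M) {S T : Set ℂ} (h : S ⊆ T) :
    eigenSpan D S ≤ eigenSpan D T :=
  Submodule.span_mono fun _ ⟨c, hc, hw⟩ => ⟨c, h hc, hw⟩

theorem eigenSpan_eq_zero {D : Module.End ℂ M} {S : Set ℂ} {c : ℂ} (hc : c ∉ S) {w : M}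
    (hw : D w = c • w) (h : w ∈ eigenSpan D S) : w = 0 := by
  have hle : eigenSpan D S ≤ ⨆ (c' : ℂ) (_ : c' ≠ c), D.eigenspace c' := by
    refine Submodule.span_le.2 ?_
    rintro v ⟨c', hc', hv⟩
    have hne : c' ≠ c := fun h => hc (h ▸ hc')
    exact Submodule.mem_iSup_of_mem c' (Submodule.mem_iSup_of_mem hne
      (Module.End.mem_eigenspace_iff.2 hv))
  have := (Module.End.eigenspaces_iSupIndep D) c
  have h0 : w ∈ D.eigenspace c ⊓ ⨆ (c' : ℂ) (_ : c' ≠ c), D.eigenspace c' :=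
    ⟨Module.End.mem_eigenspace_iff.2 hw, hle h⟩
  rw [this.eq_bot] at h0
  simpa using h0

end Eigen

/-! ### Highest weight modules and their Shapovalov forms -/

section HighestWeight

variable {𝔤 : Type*} [LieRing 𝔤] [LieAlgebra ℂ 𝔤] [FiniteDimensional ℂ 𝔤]
  [LieAlgebra.IsSimple ℂ 𝔤] {H : LieSubalgebra ℂ 𝔤} {ι : Type*} [Fintype ι]
  [H.IsCartanSubalgebra] (b : LieAlgebra.Basis ι H)

/-- `𝔫₋` lowers the eigenvalues of the height element by positive integers. -/
theorem nMinus_eigenSpan {M : Type*} [AddCommGroup M] [Module ℂ M] (π : 𝔤 →ₗ⁅ℂ⁆ Module.End ℂ M)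
    {x : 𝔤} (hx : x ∈ nMinus b) (c : ℂ) {w : M}
    (hw : w ∈ eigenSpan (π (heightElt b)) (Set.range fun n : ℕ => c - n)) :
    π x w ∈ eigenSpan (π (heightElt b)) (Set.range fun n : ℕ => c - (n + 1 : ℕ)) := by
  rw [← LieSubalgebra.mem_toSubmodule, nMinus_toSubmodule] at hx
  induction hx using Submodule.span_induction with
  | mem y hy =>
    obtain ⟨α, hα, hy⟩ := hy
    obtain ⟨k, hk, hαk⟩ := posRoot_heightElt b hα
    have hle : eigenSpan (π (heightElt b)) (Set.range fun n : ℕ => c - n) ≤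
        (eigenSpan (π (heightElt b)) (Set.range fun n : ℕ => c - (n + 1 : ℕ))).comap (π y) := by
      refine Submodule.span_le.2 ?_
      rintro v ⟨_, ⟨n, rfl⟩, hv⟩
      have h1 : π (heightElt b) (π y v) = π ⁅(heightElt b : 𝔤), y⁆ v +
          π y (π (heightElt b) v) := by
        rw [LieHom.map_lie, LieRing.of_associative_ring_bracket, LinearMap.sub_apply,
          Module.End.mul_apply, Module.End.mul_apply]
        abel
      refine Submodule.subset_span ⟨_, ⟨n + k - 1, rfl⟩, ?_⟩
      rw [h1, hv, lie_of_mem_rootSpace hy, map_smul, map_smul, LinearMap.smul_apply, ← add_smul]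
      congr 1
      change -(α (heightElt b)) + (c - (n : ℂ)) = c - ((n + k - 1 + 1 : ℕ) : ℂ)
      have : n + k - 1 + 1 = n + k := by omega
      rw [this, hαk]
      push_cast
      ring
    exact hle hw
  | zero => rw [map_zero]; exact zero_mem _
  | add y z _ _ hy hz => rw [map_add]; exact add_mem hy hz
  | smul t y _ hy => rw [map_smul]; exact Submodule.smul_mem _ t hy

variable {V : Type*} [AddCommGroup V] [Module ℂ V] [LieRingModule 𝔤 V] [LieModule ℂ 𝔤 V]
  {Λ : Module.Dual ℂ H} {v : V}

theorem IsHighestWeight.exists_env (hv : IsHighestWeight b Λ v) (x : V) :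
    ∃ g : 𝓤 𝔤, envAct (LieModule.toEnd ℂ 𝔤 V) g v = x := by
  let N : LieSubmodule ℂ 𝔤 V :=
    { carrier := {x | ∃ g : 𝓤 𝔤, envAct (LieModule.toEnd ℂ 𝔤 V) g v = x}
      add_mem' := by
        rintro _ _ ⟨g, rfl⟩ ⟨g', rfl⟩
        exact ⟨g + g', by rw [map_add, LinearMap.add_apply]⟩
      zero_mem' := ⟨0, by rw [map_zero, LinearMap.zero_apply]⟩
      smul_mem' := by
        rintro c _ ⟨g, rfl⟩
        exact ⟨c • g, by rw [map_smul, LinearMap.smul_apply]⟩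
      lie_mem := by
        rintro x _ ⟨g, rfl⟩
        exact ⟨𝓲 x * g, by rw [map_mul, envAct_ι, Module.End.mul_apply]; rfl⟩ }
  have hN : N = ⊤ := by
    rw [eq_top_iff, ← hv.generates, LieSubmodule.lieSpan_le]
    rintro _ rfl
    exact ⟨1, by rw [map_one]; rfl⟩
  have : x ∈ N := by rw [hN]; trivial
  exact this

/-- Modulo vectors of lower weight, `g v = γ(g)(Λ) v`. -/
theorem IsHighestWeight.env_sub_mem (hv : IsHighestWeight b Λ v) (g : 𝓤 𝔤) :
    envAct (LieModule.toEnd ℂ 𝔤 V) g v - vacuum b Λ g • v ∈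
      eigenSpan (LieModule.toEnd ℂ 𝔤 V (heightElt b))
        (Set.range fun n : ℕ => Λ (heightElt b) - (n + 1 : ℕ)) := by
  set π := LieModule.toEnd ℂ 𝔤 V with hπ
  set W := eigenSpan (π (heightElt b))
    (Set.range fun n : ℕ => Λ (heightElt b) - (n + 1 : ℕ)) with hW
  have hv0 : v ∈ eigenSpan (π (heightElt b)) (Set.range fun n : ℕ => Λ (heightElt b) - n) :=
    Submodule.subset_span ⟨_, ⟨0, rfl⟩, by
      change _ = (Λ (heightElt b) - ((0 : ℕ) : ℂ)) • v
      rw [Nat.cast_zero, sub_zero]; exact hv.weight (heightElt b)⟩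
  have hWle : W ≤ eigenSpan (π (heightElt b)) (Set.range fun n : ℕ => Λ (heightElt b) - n) :=
    eigenSpan_mono _ (by rintro _ ⟨n, rfl⟩; exact ⟨n + 1, rfl⟩)
  let P : Submodule ℂ (𝓤 𝔤) :=
    { carrier := {g | envAct π g v - vacuum b Λ g • v ∈ W}
      add_mem' := fun {g g'} hg hg' => by
        have : envAct π (g + g') v - vacuum b Λ (g + g') • v =
            (envAct π g v - vacuum b Λ g • v) + (envAct π g' v - vacuum b Λ g' • v) := by
          rw [map_add, map_add, LinearMap.add_apply, add_smul]; abel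
        change _ ∈ W
        rw [this]
        exact W.add_mem hg hg'
      zero_mem' := by
        change _ ∈ W
        rw [map_zero, map_zero, LinearMap.zero_apply, zero_smul, sub_zero]
        exact W.zero_mem
      smul_mem' := fun c g hg => by
        change _ ∈ W
        rw [map_smul, map_smul, LinearMap.smul_apply, smul_assoc, ← smul_sub]
        exact W.smul_mem c hg }
  refine triangular_induction b P (fun a => ?_) (fun h g hg => ?_) (fun x hx g _ => ?_) g
  · refine env_left_induction lieSpan_univ_eq_top
      (P.comap (envIncl (nMinus b)).toLinearMap) ?_ ?_ a
    · change envAct π (envIncl (nMinus b) 1) v - vacuum b Λ (envIncl (nMinus b) 1) • v ∈ W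
      rw [map_one, map_one, vacuum_one, one_smul, Module.End.one_apply, sub_self]
      exact W.zero_mem
    · intro x _ a ha
      change envAct π (envIncl (nMinus b) (𝓲 x * a)) v -
        vacuum b Λ (envIncl (nMinus b) (𝓲 x * a)) • v ∈ W
      rw [map_mul, envIncl_ι, vacuum_nMinus_mul b Λ x.2, zero_smul, sub_zero, map_mul,
        Module.End.mul_apply, envAct_ι]
      refine nMinus_eigenSpan b π x.2 _ ?_
      have := add_mem (hWle ha) (Submodule.smul_mem _ (vacuum b Λ (envIncl (nMinus b) a)) hv0)
      rwa [AlgHom.toLinearMap_apply, sub_add_cancel] at this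
  · change envAct π (g * 𝓲 (h : 𝔤)) v - vacuum b Λ (g * 𝓲 (h : 𝔤)) • v ∈ W
    have h1 : π h v = Λ h • v := hv.weight h
    rw [map_mul, Module.End.mul_apply, envAct_ι, h1, vacuum_mul_cartan, map_smul, mul_smul,
      ← smul_sub]
    exact W.smul_mem _ hg
  · change envAct π (g * 𝓲 x) v - vacuum b Λ (g * 𝓲 x) • v ∈ W
    have h1 : π x v = 0 := hv.singular x hx
    rw [map_mul, Module.End.mul_apply, envAct_ι, h1, vacuum_mul_nPlus b Λ hx, map_zero, zero_smul,
      sub_zero]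
    exact W.zero_mem

theorem IsHighestWeight.mem_eigenSpan (hv : IsHighestWeight b Λ v) (x : V) :
    x ∈ eigenSpan (LieModule.toEnd ℂ 𝔤 V (heightElt b))
      (Set.range fun n : ℕ => Λ (heightElt b) - n) := by
  obtain ⟨g, rfl⟩ := hv.exists_env b x
  have hv0 : v ∈ eigenSpan (LieModule.toEnd ℂ 𝔤 V (heightElt b))
      (Set.range fun n : ℕ => Λ (heightElt b) - n) :=
    Submodule.subset_span ⟨_, ⟨0, rfl⟩, by
      change _ = (Λ (heightElt b) - ((0 : ℕ) : ℂ)) • v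
      rw [Nat.cast_zero, sub_zero]; exact hv.weight (heightElt b)⟩
  have h1 := eigenSpan_mono _ (T := Set.range fun n : ℕ => Λ (heightElt b) - n)
    (by rintro _ ⟨n, rfl⟩; exact ⟨n + 1, rfl⟩) (hv.env_sub_mem b g)
  have := add_mem h1 (Submodule.smul_mem _ (vacuum b Λ g) hv0)
  rwa [sub_add_cancel] at this

/-- What kills the highest weight vector has vacuum coefficient zero: otherwise the highest weight
vector would be a combination of vectors of lower height. -/
theorem IsHighestWeight.vacuum_eq_zero (hv : IsHighestWeight b Λ v) {g : 𝓤 𝔤}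
    (hg : envAct (LieModule.toEnd ℂ 𝔤 V) g v = 0) : vacuum b Λ g = 0 := by
  have h1 := hv.env_sub_mem b g
  rw [hg, zero_sub, Submodule.neg_mem_iff] at h1
  have h2 : LieModule.toEnd ℂ 𝔤 V (heightElt b) (vacuum b Λ g • v) =
      Λ (heightElt b) • (vacuum b Λ g • v) := by
    rw [map_smul, smul_comm]
    congr 1
    exact hv.weight (heightElt b)
  have h3 := eigenSpan_eq_zero (by
    rintro ⟨n, hn⟩
    have h4 : ((n + 1 : ℕ) : ℂ) = 0 := by
      have : Λ (heightElt b) - ((n + 1 : ℕ) : ℂ) = Λ (heightElt b) := hn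
      simpa using this
    exact Nat.cast_ne_zero.2 (Nat.succ_ne_zero n) h4) h2 h1
  exact (smul_eq_zero.1 h3).resolve_right hv.ne_zero

/-- The Shapovalov form of a highest weight module exists: `S_Λ` vanishes if one of its arguments
kills the highest weight vector. -/
theorem IsHighestWeight.shapModule_spec (hv : IsHighestWeight b Λ v) (g₁ g₂ : 𝓤 𝔤) :
    shapModule b Λ v (envAct (LieModule.toEnd ℂ 𝔤 V) g₁ v)
      (envAct (LieModule.toEnd ℂ 𝔤 V) g₂ v) = shapU b Λ g₁ g₂ := by
  set π := LieModule.toEnd ℂ 𝔤 V with hπ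
  have hex : ∃ B : V →ₗ[ℂ] V →ₗ[ℂ] ℂ, ∀ g₁ g₂ : 𝓤 𝔤,
      B (envAct π g₁ v) (envAct π g₂ v) = shapU b Λ g₁ g₂ := by
    let r : 𝓤 𝔤 →ₗ[ℂ] V := LinearMap.applyₗ v ∘ₗ (envAct π).toLinearMap
    have hr : LinearMap.range r = ⊤ := LinearMap.range_eq_top.2 (hv.exists_env b)
    -- a linear section of the surjection `g ↦ g v`
    obtain ⟨s, hs⟩ := r.exists_rightInverse_of_surjective hr
    have hs' : ∀ x, envAct π (s x) v = x := LinearMap.congr_fun hs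
    let F : 𝓤 𝔤 →ₗ[ℂ] 𝓤 𝔤 →ₗ[ℂ] ℂ :=
      (LinearMap.mul ℂ (𝓤 𝔤)).compr₂ (vacuum b Λ) ∘ₗ tau b
    have hF : ∀ x y, F x y = shapU b Λ x y := fun x y => rfl
    have hk : ∀ x y, envAct π y v = 0 → F x y = 0 := by
      intro x y hy
      refine hv.vacuum_eq_zero b ?_
      change envAct π (tau b x * y) v = 0
      rw [map_mul, Module.End.mul_apply, hy, map_zero]
    have hk' : ∀ x y, envAct π x v = 0 → F x y = 0 := by
      intro x y hx
      rw [hF, shapU_symm, ← hF]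
      exact hk y x hx
    refine ⟨F.compl₁₂ s s, fun g₁ g₂ => ?_⟩
    rw [LinearMap.compl₁₂_apply, ← hF]
    have e1 : F (s (envAct π g₁ v) - g₁) (s (envAct π g₂ v)) = 0 :=
      hk' _ _ (by rw [map_sub, LinearMap.sub_apply, hs', sub_self])
    have e2 : F g₁ (s (envAct π g₂ v) - g₂) = 0 :=
      hk _ _ (by rw [map_sub, LinearMap.sub_apply, hs', sub_self])
    rw [map_sub, LinearMap.sub_apply, sub_eq_zero] at e1
    rw [map_sub, sub_eq_zero] at e2
    rw [e1, e2]
  exact theElement_spec hex g₁ g₂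

theorem IsHighestWeight.shapModule_contravariant (hv : IsHighestWeight b Λ v) (x : 𝔤) (y z : V) :
    shapModule b Λ v (LieModule.toEnd ℂ 𝔤 V x y) z =
      shapModule b Λ v y (LieModule.toEnd ℂ 𝔤 V (-chevalley b x) z) := by
  obtain ⟨g, rfl⟩ := hv.exists_env b y
  obtain ⟨g', rfl⟩ := hv.exists_env b z
  rw [← envAct_ι, ← envAct_ι, ← Module.End.mul_apply, ← Module.End.mul_apply, ← map_mul,
    ← map_mul, hv.shapModule_spec, hv.shapModule_spec, shapU_eq, shapU_eq, tau_mul, tau_ι,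
    map_neg, mul_assoc]

end HighestWeight

/-! ### Tensor products -/

section Tensor

variable {𝔤 : Type*} [LieRing 𝔤] [LieAlgebra ℂ 𝔤] [FiniteDimensional ℂ 𝔤]
  [LieAlgebra.IsSimple ℂ 𝔤] {H : LieSubalgebra ℂ 𝔤} {ι : Type*} [Fintype ι]
  [H.IsCartanSubalgebra] (b : LieAlgebra.Basis ι H)
  {n : ℕ} {V : Fin n → Type*}
  [∀ p, AddCommGroup (V p)] [∀ p, Module ℂ (V p)]
  [∀ p, LieRingModule 𝔤 (V p)] [∀ p, LieModule ℂ 𝔤 (V p)]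
  {Λ : Fin n → Module.Dual ℂ H} {v₀ : ∀ p, V p}

theorem factorEnd_tprod (p : Fin n) (X : Module.End ℂ (V p)) (t : ∀ p, V p) :
    factorEnd V p X (PiTensorProduct.tprod ℂ t) =
      PiTensorProduct.tprod ℂ (Function.update t p (X (t p))) := by
  simp only [factorEnd, MultilinearMap.toLinearMap_apply, PiTensorProduct.mapMultilinear_apply,
    PiTensorProduct.map_tprod]
  congr 1
  ext q
  by_cases h : q = p
  · subst h; simp
  · simp [Function.update_of_ne h]

theorem tensorRep_tprod (x : 𝔤) (t : ∀ p, V p) :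
    tensorRep V 𝔤 x (PiTensorProduct.tprod ℂ t) =
      ∑ p, PiTensorProduct.tprod ℂ (Function.update t p (LieModule.toEnd ℂ 𝔤 (V p) x (t p))) := by
  change (∑ p, factorEnd V p (LieModule.toEnd ℂ 𝔤 (V p) x)) (PiTensorProduct.tprod ℂ t) = _
  rw [LinearMap.sum_apply]
  exact Finset.sum_congr rfl fun p _ => factorEnd_tprod p _ t

theorem tensorSpan_induction {P : (⨂[ℂ] p, V p) → Prop} (h0 : P 0)
    (hadd : ∀ x y, P x → P y → P (x + y)) (hsmul : ∀ (c : ℂ) x, P x → P (c • x))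
    (ht : ∀ t : ∀ p, V p, P (PiTensorProduct.tprod ℂ t)) (x : ⨂[ℂ] p, V p) : P x := by
  have hx : x ∈ Submodule.span ℂ (Set.range (PiTensorProduct.tprod ℂ (s := V))) := by
    rw [PiTensorProduct.span_tprod_eq_top]; trivial
  induction hx using Submodule.span_induction with
  | mem y hy => obtain ⟨t, rfl⟩ := hy; exact ht t
  | zero => exact h0
  | add y z _ _ hy hz => exact hadd y z hy hz
  | smul c y _ hy => exact hsmul c y hy

theorem shapTensor_contravariant (hV : ∀ p, IsHighestWeight b (Λ p) (v₀ p)) (x : 𝔤)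
    (y z : ⨂[ℂ] p, V p) :
    shapTensor b V Λ v₀ (tensorRep V 𝔤 x y) z =
      shapTensor b V Λ v₀ y (tensorRep V 𝔤 (-chevalley b x) z) := by
  induction y using tensorSpan_induction with
  | h0 => simp
  | hadd y y' hy hy' => simp only [map_add, LinearMap.add_apply, hy, hy']
  | hsmul c y hy => simp only [map_smul, LinearMap.smul_apply, hy]
  | ht t =>
    induction z using tensorSpan_induction with
    | h0 => simp
    | hadd y y' hy hy' => simp only [map_add, hy, hy']
    | hsmul c y hy => simp only [map_smul, hy]
    | ht s =>
      rw [tensorRep_tprod, tensorRep_tprod, map_sum, map_sum, LinearMap.sum_apply]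
      refine Finset.sum_congr rfl fun p _ => ?_
      rw [shapTensor, tensorForm_tprod, tensorForm_tprod]
      refine Finset.prod_congr rfl fun q _ => ?_
      by_cases hq : q = p
      · subst hq
        rw [Function.update_self, Function.update_self, (hV q).shapModule_contravariant]
      · rw [Function.update_of_ne hq, Function.update_of_ne hq]

/-- The form on the tensor product is contravariant for the anti-involution `a ω`. -/
theorem shapTensor_env (hV : ∀ p, IsHighestWeight b (Λ p) (v₀ p)) (g : 𝓤 𝔤)
    (y z : ⨂[ℂ] p, V p) :
    shapTensor b V Λ v₀ (envAct (tensorRep V 𝔤) g y) z =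
      shapTensor b V Λ v₀ y (envAct (tensorRep V 𝔤) (tau b g) z) := by
  let P : Submodule ℂ (𝓤 𝔤) :=
    { carrier := {g | ∀ y z, shapTensor b V Λ v₀ (envAct (tensorRep V 𝔤) g y) z =
        shapTensor b V Λ v₀ y (envAct (tensorRep V 𝔤) (tau b g) z)}
      add_mem' := fun {g g'} hg hg' y z => by
        simp only [map_add, LinearMap.add_apply, hg y z, hg' y z]
      zero_mem' := fun y z => by simp
      smul_mem' := fun c g hg y z => by
        simp only [map_smul, LinearMap.smul_apply, hg y z] }
  have hg : g ∈ P := by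
    refine env_left_induction lieSpan_univ_eq_top P (fun y z => ?_) (fun x _ g hg y z => ?_) g
    · rw [tau_one, map_one]; rfl
    · rw [map_mul, tau_mul, map_mul, Module.End.mul_apply, Module.End.mul_apply, ← hg, envAct_ι,
        shapTensor_contravariant b hV, tau_ι, map_neg, map_neg (envAct _),
        envAct_ι]
  exact hg y z

/-- On a tensor product of highest weight modules, the height element has its eigenvalues in
`Λ - ℕ`. -/
theorem tensor_mem_eigenSpan (hV : ∀ p, IsHighestWeight b (Λ p) (v₀ p)) (x : ⨂[ℂ] p, V p) :
    x ∈ eigenSpan (tensorRep V 𝔤 (heightElt b))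
      (Set.range fun k : ℕ => ∑ p, Λ p (heightElt b) - k) := by
  set W := eigenSpan (tensorRep V 𝔤 (heightElt b))
      (Set.range fun k : ℕ => ∑ p, Λ p (heightElt b) - k) with hW
  -- the factors outside `s` are eigenvectors already; those in `s` are expanded one by one
  have key : ∀ (s : Finset (Fin n)) (t : ∀ p, V p),
      (∀ p ∉ s, ∃ k : ℕ, LieModule.toEnd ℂ 𝔤 (V p) (heightElt b) (t p) =
        (Λ p (heightElt b) - k) • t p) → PiTensorProduct.tprod ℂ t ∈ W := by
    intro s
    induction s using Finset.induction_on with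
    | empty =>
      intro t ht
      choose k hk using fun p => ht p (Finset.notMem_empty p)
      refine Submodule.subset_span ⟨_, ⟨∑ p, k p, rfl⟩, ?_⟩
      rw [tensorRep_tprod]
      push_cast
      rw [← Finset.sum_sub_distrib, Finset.sum_smul]
      refine Finset.sum_congr rfl fun p _ => ?_
      rw [hk, MultilinearMap.map_update_smul, Function.update_eq_self]
    | insert p s hp ih =>
      intro t ht
      have htp := (hV p).mem_eigenSpan b (t p)
      have hle : eigenSpan (LieModule.toEnd ℂ 𝔤 (V p) (heightElt b))
          (Set.range fun n : ℕ => Λ p (heightElt b) - n) ≤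
          W.comap ((PiTensorProduct.tprod ℂ).toLinearMap t p) := by
        refine Submodule.span_le.2 ?_
        rintro w ⟨_, ⟨k, rfl⟩, hw⟩
        refine ih (Function.update t p w) fun q hq => ?_
        by_cases hqp : q = p
        · subst hqp
          exact ⟨k, by rw [Function.update_self]; exact hw⟩
        · rw [Function.update_of_ne hqp]
          exact ht q (by simp [hqp, hq])
      have := hle htp
      rwa [Submodule.mem_comap, MultilinearMap.toLinearMap_apply, Function.update_eq_self] at this
  induction x using tensorSpan_induction with
  | h0 => exact W.zero_mem
  | hadd y y' hy hy' => exact W.add_mem hy hy'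
  | hsmul c y hy => exact W.smul_mem c hy
  | ht t => exact key Finset.univ t fun p hp => absurd (Finset.mem_univ p) hp

end Tensor

/-! ### Splittings of a word -/

section Splits

variable {α M : Type*} [AddCommMonoid M]

/-- The ways to split a word into a subword and the complementary subword. -/
def splits : List α → List (List α × List α)
  | [] => [([], [])]
  | a :: l => (splits l).map (fun s => (a :: s.1, s.2)) ++ (splits l).map (fun s => (s.1, a :: s.2))

/-- The sum of a function over the splittings of a word. -/
def splitSum (l : List α) (ψ : List α → List α → M) : M :=
  ((splits l).map fun s => ψ s.1 s.2).sum

@[simp] theorem splitSum_nil (ψ : List α → List α → M) : splitSum [] ψ = ψ [] [] := by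
  simp [splitSum, splits]

theorem splitSum_cons (a : α) (l : List α) (ψ : List α → List α → M) :
    splitSum (a :: l) ψ =
      splitSum l (fun I J => ψ (a :: I) J) + splitSum l (fun I J => ψ I (a :: J)) := by
  simp [splitSum, splits, Function.comp_def]

theorem length_of_mem_splits {l : List α} {s : List α × List α} (h : s ∈ splits l) :
    s.1.length + s.2.length = l.length := by
  induction l generalizing s with
  | nil => simp only [splits, List.mem_singleton] at h; subst h; rfl
  | cons a l ih =>
    simp only [splits, List.mem_append, List.mem_map] at h
    rcases h with ⟨t, ht, rfl⟩ | ⟨t, ht, rfl⟩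
    · have := ih ht; simp only [List.length_cons]; omega
    · have := ih ht; simp only [List.length_cons]; omega

theorem splitSum_congr {l : List α} {ψ ψ' : List α → List α → M}
    (h : ∀ I J, I.length + J.length = l.length → ψ I J = ψ' I J) :
    splitSum l ψ = splitSum l ψ' := by
  unfold splitSum
  congr 1
  exact List.map_congr_left fun s hs => h _ _ (length_of_mem_splits hs)

theorem splitSum_add (l : List α) (ψ ψ' : List α → List α → M) :
    splitSum l (fun I J => ψ I J + ψ' I J) = splitSum l ψ + splitSum l ψ' :=
  List.sum_map_add

theorem map_splitSum {M' F : Type*} [AddCommMonoid M'] [FunLike F M M'] [AddMonoidHomClass F M M']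
    (g : F) (l : List α) (ψ : List α → List α → M) :
    g (splitSum l ψ) = splitSum l fun I J => g (ψ I J) := by
  unfold splitSum
  rw [map_list_sum, List.map_map]
  rfl

theorem splitSum_append (l l' : List α) (ψ : List α → List α → M) :
    splitSum (l ++ l') ψ =
      splitSum l fun I J => splitSum l' fun I' J' => ψ (I ++ I') (J ++ J') := by
  induction l generalizing ψ with
  | nil => simp
  | cons a l ih => rw [List.cons_append, splitSum_cons, splitSum_cons, ih, ih]; rfl

/-- The ways to pick a letter of a word. -/
def picks : List α → List (List α × α × List α)
  | [] => []
  | a :: l => ([], a, l) :: (picks l).map fun s => (a :: s.1, s.2.1, s.2.2)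

/-- The sum of a function over the letters of a word. -/
def pickSum (l : List α) (ψ : List α → α → List α → M) : M :=
  ((picks l).map fun s => ψ s.1 s.2.1 s.2.2).sum

@[simp] theorem pickSum_nil (ψ : List α → α → List α → M) : pickSum [] ψ = 0 := by
  simp [pickSum, picks]

theorem pickSum_cons (a : α) (l : List α) (ψ : List α → α → List α → M) :
    pickSum (a :: l) ψ = ψ [] a l + pickSum l fun I x J => ψ (a :: I) x J := by
  simp [pickSum, picks, Function.comp_def]

theorem pickSum_append (l l' : List α) (ψ : List α → α → List α → M) :
    pickSum (l ++ l') ψ = pickSum l (fun I x J => ψ I x (J ++ l')) +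
      pickSum l' fun I x J => ψ (l ++ I) x J := by
  induction l generalizing ψ with
  | nil => simp
  | cons a l ih =>
    rw [List.cons_append, pickSum_cons, pickSum_cons, ih, add_assoc]
    rfl

theorem length_of_mem_picks {l : List α} {s : List α × α × List α} (h : s ∈ picks l) :
    s.1.length + s.2.2.length + 1 = l.length := by
  induction l generalizing s with
  | nil => simp [picks] at h
  | cons a l ih =>
    simp only [picks, List.mem_cons, List.mem_map] at h
    rcases h with rfl | ⟨t, ht, rfl⟩
    · simp
    · have := ih ht; simp only [List.length_cons]; omega

theorem pickSum_congr {l : List α} {ψ ψ' : List α → α → List α → M}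
    (h : ∀ I x J, I.length + J.length + 1 = l.length → ψ I x J = ψ' I x J) :
    pickSum l ψ = pickSum l ψ' := by
  unfold pickSum
  congr 1
  exact List.map_congr_left fun s hs => h _ _ _ (length_of_mem_picks hs)

theorem pickSum_add (l : List α) (ψ ψ' : List α → α → List α → M) :
    pickSum l (fun I x J => ψ I x J + ψ' I x J) = pickSum l ψ + pickSum l ψ' :=
  List.sum_map_add

theorem pickSum_ofFn {m : ℕ} (a : Fin m → α) (ψ : List α → α → List α → M) :
    pickSum (List.ofFn a) ψ =
      ∑ i : Fin m, ψ ((List.ofFn a).take i) (a i) ((List.ofFn a).drop (i + 1)) := by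
  induction m generalizing ψ with
  | zero => simp
  | succ m ih =>
    rw [List.ofFn_succ, pickSum_cons, ih, Fin.sum_univ_succ]
    simp

/-- A splitting whose second word is not empty amounts to the last letter of that word and a
splitting of the letters to its left. -/
theorem splitSum_eq_pickSum (l : List α) (ψ : List α → List α → M) :
    splitSum l ψ = ψ l [] + pickSum l fun m₁ x m₂ => splitSum m₁ fun I J =>
      ψ (I ++ m₂) (J ++ [x]) := by
  induction l generalizing ψ with
  | nil => simp
  | cons a l ih =>
    rw [splitSum_cons, ih, ih fun I J => ψ I (a :: J), pickSum_cons, splitSum_nil]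
    simp only [splitSum_cons, pickSum_add]
    simp only [List.nil_append, List.cons_append]
    abel

end Splits

/-! ### The symmetrized words -/

section SymWord

variable {U : Type*} [Ring U] [Algebra ℂ U]

/-- The product of the weights of the letters of a word; a letter is an element of an algebra
together with its weight, a complex number. -/
def letterWeight (l : List (ℂ × U)) : ℂ := (l.map Prod.fst).prod

/-- The product of a word. -/
def letterProd (l : List (ℂ × U)) : U := (l.map Prod.snd).prod

@[simp] theorem letterProd_nil : letterProd ([] : List (ℂ × U)) = 1 := rfl

@[simp] theorem letterProd_cons (a : ℂ × U) (l : List (ℂ × U)) :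
    letterProd (a :: l) = a.2 * letterProd l := by simp [letterProd]

@[simp] theorem letterProd_append (l l' : List (ℂ × U)) :
    letterProd (l ++ l') = letterProd l * letterProd l' := by simp [letterProd]

@[simp] theorem letterWeight_cons (a : ℂ × U) (l : List (ℂ × U)) :
    letterWeight (a :: l) = a.1 * letterWeight l := by simp [letterWeight]

@[simp] theorem letterWeight_append (l l' : List (ℂ × U)) :
    letterWeight (l ++ l') = letterWeight l * letterWeight l' := by simp [letterWeight]

/-- The recursive form of the map `A_X`: with `f(P) = P / (1 - P)`, the value of `A_X` on a word
`w` of weight `P` is `f(P)` times the sum of `A_X(w') w''` over the splittings of `w` into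
complementary subwords `w'` and `w'' ≠ 1`. -/
noncomputable def symWord (f : ℂ → ℂ) (l : List (ℂ × U)) : U :=
  if l = [] then 1 else
    f (letterWeight l) • splitSum l fun I J =>
      if _h : I.length < l.length then symWord f I * letterProd J else 0
termination_by l.length

variable (f : ℂ → ℂ)

@[simp] theorem symWord_nil : symWord f ([] : List (ℂ × U)) = 1 := by
  rw [symWord, if_pos rfl]

theorem symWord_of_ne_nil {l : List (ℂ × U)} (h : l ≠ []) :
    symWord f l = f (letterWeight l) • splitSum l fun I J =>
      if I.length < l.length then symWord f I * letterProd J else 0 := by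
  rw [symWord, if_neg h]
  rfl

/-- The value of a word is linear in each of its letters, for fixed weights. -/
theorem symWord_letter_linear (l l' : List (ℂ × U)) (p c : ℂ) (x y : U) :
    symWord f (l ++ (p, c • x + y) :: l') =
      c • symWord f (l ++ (p, x) :: l') + symWord f (l ++ (p, y) :: l') := by
  generalize hN : l.length + l'.length = N
  induction N using Nat.strong_induction_on generalizing l l' with
  | _ N ih =>
    subst hN
    rw [symWord_of_ne_nil f (by simp), symWord_of_ne_nil f (by simp),
      symWord_of_ne_nil f (by simp)]
    have hw : ∀ z : U, letterWeight (l ++ (p, z) :: l') = letterWeight l * (p * letterWeight l') :=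
      fun z => by simp
    rw [hw, hw, hw, smul_comm c, ← smul_add]
    congr 1
    have hm := map_splitSum (LinearMap.lsmul ℂ U c) (l ++ (p, x) :: l')
      (fun I J => if I.length < (l ++ (p, x) :: l').length then symWord f I * letterProd J else 0)
    rw [LinearMap.lsmul_apply] at hm
    rw [hm]
    simp only [splitSum_append, splitSum_cons, ← splitSum_add]
    refine splitSum_congr fun I J h₁ => ?_
    refine splitSum_congr fun I' J' h₂ => ?_
    simp only [List.length_append, List.length_cons, LinearMap.lsmul_apply, letterProd_append,
      letterProd_cons]
    have e2 : I.length + I'.length < l.length + (l'.length + 1) := by omega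
    by_cases h : I.length + (I'.length + 1) < l.length + (l'.length + 1)
    · simp only [if_pos h, if_pos e2]
      rw [ih _ (by omega) I I' rfl]
      simp only [add_mul, mul_add, smul_mul_assoc, mul_smul_comm]
      abel
    · simp only [if_neg h, if_pos e2, smul_zero, zero_add]
      simp only [add_mul, mul_add, smul_mul_assoc, mul_smul_comm]

/-- The value of a word as a linear function of one of its letters. -/
noncomputable def symWordLetter (l l' : List (ℂ × U)) (p : ℂ) : U →ₗ[ℂ] U where
  toFun x := symWord f (l ++ (p, x) :: l')
  map_add' x y := by simpa using symWord_letter_linear f l l' p 1 x y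
  map_smul' c x := by
    have h0 := symWord_letter_linear f l l' p 1 0 0
    have h := symWord_letter_linear f l l' p c x 0
    simp only [one_smul, add_zero, left_eq_add] at h0
    rw [h0, add_zero, add_zero] at h
    exact h

/-- The commutation relations of the algebra hold for `symWord`, if the weight of a product is the
product of the weights. In the recursion, the splittings that separate the two letters are the same
for both orders, so they cancel; the others are commutators by induction. No property of `f` is
needed. -/
theorem symWord_commutator (l l' : List (ℂ × U)) (p q : ℂ) (x y : U) :
    symWord f (l ++ (p, x) :: (q, y) :: l') - symWord f (l ++ (q, y) :: (p, x) :: l') =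
      symWord f (l ++ (p * q, x * y - y * x) :: l') := by
  generalize hN : l.length + l'.length = N
  induction N using Nat.strong_induction_on generalizing l l' with
  | _ N ih =>
    subst hN
    rw [symWord_of_ne_nil f (by simp), symWord_of_ne_nil f (by simp),
      symWord_of_ne_nil f (by simp)]
    have hw1 : letterWeight (l ++ (p, x) :: (q, y) :: l') =
        letterWeight l * (p * q * letterWeight l') := by
      simp [mul_assoc]
    have hw2 : letterWeight (l ++ (q, y) :: (p, x) :: l') =
        letterWeight l * (p * q * letterWeight l') := by
      simp [mul_left_comm, mul_assoc]
    have hw3 : letterWeight (l ++ (p * q, x * y - y * x) :: l') =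
      letterWeight l * (p * q * letterWeight l') := by simp
    rw [hw1, hw2, hw3, ← smul_sub]
    congr 1
    rw [sub_eq_iff_eq_add]
    simp only [splitSum_append, splitSum_cons, ← splitSum_add]
    refine splitSum_congr fun I J h₁ => ?_
    refine splitSum_congr fun I' J' h₂ => ?_
    simp only [List.length_append, List.length_cons, letterProd_append, letterProd_cons]
    have e0 : I.length + I'.length < l.length + (l'.length + 1 + 1) := by omega
    have e1 : I.length + (I'.length + 1) < l.length + (l'.length + 1 + 1) := by omega
    have e2 : I.length + I'.length < l.length + (l'.length + 1) := by omega
    simp only [if_pos e0, if_pos e1, if_pos e2]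
    by_cases h : I.length + (I'.length + 1) < l.length + (l'.length + 1)
    · have h' : I.length + (I'.length + 1 + 1) < l.length + (l'.length + 1 + 1) := by omega
      simp only [if_pos h, if_pos h']
      rw [← ih _ (by omega) I I' rfl]
      noncomm_ring
    · have h' : ¬ I.length + (I'.length + 1 + 1) < l.length + (l'.length + 1 + 1) := by omega
      simp only [if_neg h, if_neg h']
      noncomm_ring

/-- The sum of `A_X(I l') J` over the splittings of `l` into `I` and `J`. For `l = []` it
is `A_X(l')`. -/
noncomputable def symWordSplit (l l' : List (ℂ × U)) : U :=
  splitSum l fun I J => symWord f (I ++ l') * letterProd J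

theorem symWordSplit_nil (l : List (ℂ × U)) : symWordSplit f [] l = symWord f l := by
  simp [symWordSplit]

/-- The recursion for `symWord`, with the splittings grouped by the last letter of the second
subword. -/
theorem symWord_eq_pickSum {l : List (ℂ × U)} (h : l ≠ []) :
    symWord f l = f (letterWeight l) • pickSum l fun m₁ x m₂ => symWordSplit f m₁ m₂ * x.2 := by
  rw [symWord_of_ne_nil f h, splitSum_eq_pickSum, if_neg (lt_irrefl _), zero_add]
  congr 1
  refine pickSum_congr fun m₁ x m₂ hlen => ?_
  unfold symWordSplit
  rw [← LinearMap.mulRight_apply (R := ℂ), map_splitSum]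
  refine splitSum_congr fun I J hIJ => ?_
  rw [if_pos (by rw [List.length_append]; omega), LinearMap.mulRight_apply]
  simp [mul_assoc]

/-- The recursion for `symWordSplit` in terms of the last letter of the words: it is picked from
`l` with the factor `1 + f(P) = 1 / (1 - P)` and from `l'` with the factor `f(P)`. -/
theorem symWordSplit_eq_pickSum {l l' : List (ℂ × U)} (h : l ++ l' ≠ []) :
    symWordSplit f l l' = pickSum (l ++ l') fun m₁ x m₂ =>
      ((if l.length ≤ m₁.length then f (letterWeight (l ++ l'))
        else 1 + f (letterWeight (l ++ l'))) • symWordSplit f m₁ m₂) * x.2 := by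
  have h1 : symWordSplit f l l' = symWord f (l ++ l') +
      pickSum l fun m₁ x m₂ => symWordSplit f m₁ (m₂ ++ l') * x.2 := by
    unfold symWordSplit
    rw [splitSum_eq_pickSum, letterProd_nil, mul_one]
    congr 1
    refine pickSum_congr fun m₁ x m₂ _ => ?_
    rw [← LinearMap.mulRight_apply (R := ℂ), map_splitSum]
    refine splitSum_congr fun I J _ => ?_
    rw [LinearMap.mulRight_apply]
    simp [mul_assoc]
  have hs : ∀ (c : ℂ) (l : List (ℂ × U)) (ψ : List (ℂ × U) → ℂ × U → List (ℂ × U) → U),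
      c • pickSum l ψ = pickSum l fun I x J => c • ψ I x J := by
    intro c l ψ
    unfold pickSum
    rw [List.smul_sum, List.map_map]
    rfl
  rw [h1, symWord_eq_pickSum f h, pickSum_append, pickSum_append, smul_add, hs, hs, add_right_comm]
  congr 1
  · rw [← pickSum_add]
    refine pickSum_congr fun m₁ x m₂ hlen => ?_
    rw [if_neg (by omega), add_smul, one_smul, add_mul,
      smul_mul_assoc, add_comm]
  · refine pickSum_congr fun I x J _ => ?_
    rw [if_pos (by simp), smul_mul_assoc]

end SymWord

/-! ### The sum over permutations -/

section PermSum

/-- The permutation of `m + 1` letters that sends the last letter to `i` and the others in the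
order given by `τ`. -/
def snocPerm {m : ℕ} (i : Fin (m + 1)) (τ : Equiv.Perm (Fin m)) : Equiv.Perm (Fin (m + 1)) :=
  ((finSuccEquiv' (Fin.last m)).trans (Equiv.optionCongr τ)).trans (finSuccEquiv' i).symm

theorem snocPerm_last {m : ℕ} (i : Fin (m + 1)) (τ : Equiv.Perm (Fin m)) :
    snocPerm i τ (Fin.last m) = i := by
  simp [snocPerm]

theorem snocPerm_castSucc {m : ℕ} (i : Fin (m + 1)) (τ : Equiv.Perm (Fin m)) (k : Fin m) :
    snocPerm i τ k.castSucc = i.succAbove (τ k) := by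
  have : finSuccEquiv' (Fin.last m) k.castSucc = some k := by
    rw [← Fin.succAbove_last_apply, finSuccEquiv'_succAbove]
  simp [snocPerm, this]

theorem snocPerm_bijective (m : ℕ) :
    Function.Bijective fun s : Fin (m + 1) × Equiv.Perm (Fin m) => snocPerm s.1 s.2 := by
  rw [Fintype.bijective_iff_injective_and_card]
  constructor
  · rintro ⟨i, τ⟩ ⟨i', τ'⟩ h
    replace h : snocPerm i τ = snocPerm i' τ' := h
    have hi : i = i' := by rw [← snocPerm_last i τ, h, snocPerm_last]
    subst hi
    have : τ = τ' := by
      ext1 k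
      have := snocPerm_castSucc i τ k
      rw [h, snocPerm_castSucc] at this
      exact (Fin.succAbove_right_injective this).symm
    rw [this]
  · rw [Fintype.card_prod, Fintype.card_perm, Fintype.card_perm, Fintype.card_fin,
      Fintype.card_fin, Nat.factorial_succ]

/-- `k` is a descent of `σ`; the last index counts as a descent if its value is at least `j`. -/
def IsDescent {m : ℕ} (σ : Equiv.Perm (Fin m)) (j : ℕ) (k : Fin m) : Prop :=
  if h : (k : ℕ) + 1 < m then σ ⟨(k : ℕ) + 1, h⟩ < σ k else j ≤ σ k

theorem isDescent_snocPerm_last {m : ℕ} (i : Fin (m + 1)) (τ : Equiv.Perm (Fin m)) (j : ℕ) :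
    IsDescent (snocPerm i τ) j (Fin.last m) ↔ j ≤ i := by
  rw [IsDescent, dif_neg (by simp), snocPerm_last]

theorem isDescent_snocPerm_castSucc {m : ℕ} (i : Fin (m + 1)) (τ : Equiv.Perm (Fin m)) (j : ℕ)
    (k : Fin m) : IsDescent (snocPerm i τ) j k.castSucc ↔ IsDescent τ i k := by
  have h0 : ((k.castSucc : Fin (m + 1)) : ℕ) + 1 < m + 1 := by simp
  rw [IsDescent, dif_pos h0, snocPerm_castSucc, IsDescent]
  by_cases h : (k : ℕ) + 1 < m
  · have h1 : (⟨((k.castSucc : Fin (m + 1)) : ℕ) + 1, h0⟩ : Fin (m + 1)) =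
        (⟨(k : ℕ) + 1, h⟩ : Fin m).castSucc := rfl
    rw [dif_pos h, h1, snocPerm_castSucc]
    exact i.strictMono_succAbove.lt_iff_lt
  · have h1 : (⟨((k.castSucc : Fin (m + 1)) : ℕ) + 1, h0⟩ : Fin (m + 1)) = Fin.last m := by
      ext; simp; omega
    rw [dif_neg h, h1, snocPerm_last, Fin.lt_succAbove_iff_le_castSucc, Fin.le_def]
    rfl

variable {U : Type*} [Ring U] [Algebra ℂ U] (f : ℂ → ℂ)

open Classical in
/-- The sum over permutations with a factor `f(P)` for each descent and a factor `1 + f(P)` for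
each other index, where `P` is the product of the weights of the letters up to that index. The
threshold `j` decides whether the last index is a descent, see `IsDescent`. -/
noncomputable def permSum {m : ℕ} (a : Fin m → ℂ × U) (j : ℕ) : U :=
  ∑ σ : Equiv.Perm (Fin m),
    (∏ k, if IsDescent σ j k then f (∏ l ∈ Finset.Iic k, (a (σ l)).1)
      else 1 + f (∏ l ∈ Finset.Iic k, (a (σ l)).1)) • letterProd (List.ofFn fun k => a (σ k))

open Classical in
/-- The permutations are grouped by the last letter `a i` of the permuted word. The index before
the last one is a descent exactly if its value, among the remaining letters, is at least `i`: this
is the new threshold. -/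
theorem permSum_succ {m : ℕ} (a : Fin (m + 1) → ℂ × U) (j : ℕ) :
    permSum f a j = ∑ i : Fin (m + 1),
      ((if j ≤ i then f (∏ l, (a l).1) else 1 + f (∏ l, (a l).1)) •
        permSum f (fun k => a (i.succAbove k)) i) * (a i).2 := by
  unfold permSum
  rw [← (Equiv.ofBijective _ (snocPerm_bijective m)).sum_comp, Fintype.sum_prod_type]
  refine Finset.sum_congr rfl fun i _ => ?_
  rw [Finset.smul_sum, Finset.sum_mul]
  refine Finset.sum_congr rfl fun τ _ => ?_
  have hcast : ∀ k : Fin m, ∏ l ∈ Finset.Iic k.castSucc, (a (snocPerm i τ l)).1 =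
      ∏ l ∈ Finset.Iic k, (a (i.succAbove (τ l))).1 := by
    intro k
    rw [← Fin.map_castSuccEmb_Iic, Finset.prod_map]
    refine Finset.prod_congr rfl fun l _ => ?_
    rw [Fin.coe_castSuccEmb, snocPerm_castSucc]
  have hlast : ∏ l ∈ Finset.Iic (Fin.last m), (a (snocPerm i τ l)).1 = ∏ l, (a l).1 := by
    rw [show Finset.Iic (Fin.last m) = Finset.univ from Finset.Iic_top]
    exact Equiv.prod_comp (snocPerm i τ) fun l => (a l).1
  rw [Equiv.ofBijective_apply, Fin.prod_univ_castSucc, hlast]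
  simp only [isDescent_snocPerm_last, isDescent_snocPerm_castSucc, hcast]
  rw [List.ofFn_succ', List.concat_eq_append, letterProd_append, smul_smul, smul_mul_assoc,
    snocPerm_last]
  simp only [snocPerm_castSucc]
  rw [mul_comm]
  simp

/-- Both sides satisfy the same recursion in the last letter, by `symWordSplit_eq_pickSum` and
`permSum_succ`. The threshold is the position of the cut between `l` and `l'`. -/
theorem symWordSplit_eq_permSum {m : ℕ} (a : Fin m → ℂ × U) (l l' : List (ℂ × U))
    (h : List.ofFn a = l ++ l') : symWordSplit f l l' = permSum f a l.length := by
  induction m generalizing l l' with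
  | zero =>
    rw [List.ofFn_zero, eq_comm, List.append_eq_nil_iff] at h
    obtain ⟨rfl, rfl⟩ := h
    rw [symWordSplit_nil, symWord_nil, permSum]
    simp
  | succ m ih =>
    have hne : l ++ l' ≠ [] := by
      rw [← h]; simp
    have hw : letterWeight (l ++ l') = ∏ k, (a k).1 := by
      rw [← h, letterWeight, List.map_ofFn, List.prod_ofFn]; rfl
    rw [symWordSplit_eq_pickSum f hne, hw, ← h, pickSum_ofFn, permSum_succ]
    refine Finset.sum_congr rfl fun i _ => ?_
    have hlen : ((List.ofFn a).take i).length = i := by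
      rw [List.length_take, List.length_ofFn]; omega
    have he : (List.ofFn fun k => a (i.succAbove k)) =
        (List.ofFn a).take i ++ (List.ofFn a).drop (i + 1) := by
      rw [← List.eraseIdx_eq_take_drop_succ]
      have hl : ((List.ofFn a).eraseIdx i).length = m := by
        rw [List.length_eraseIdx_of_lt (by rw [List.length_ofFn]; exact i.2),
          List.length_ofFn]; rfl
      refine List.ext_getElem (by rw [List.length_ofFn, hl]) fun k h₁ h₂ => ?_
      rw [List.getElem_ofFn, List.getElem_eraseIdx]
      rw [List.length_ofFn] at h₁
      by_cases hk : k < i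
      · rw [dif_pos hk, List.getElem_ofFn, Fin.succAbove_of_castSucc_lt _ _ hk]
        rfl
      · rw [dif_neg hk, List.getElem_ofFn, Fin.succAbove_of_le_castSucc _ _ (not_lt.1 hk)]
        rfl
    rw [ih _ _ _ he, hlen]

theorem symWord_ofFn {m : ℕ} (a : Fin m → ℂ × U) :
    symWord f (List.ofFn a) = permSum f a 0 := by
  rw [← symWordSplit_nil]
  exact symWordSplit_eq_permSum f a [] _ rfl

open Classical in
/-- The exponent `a_k^σ + 1` counts the descents from `k` on, the last index included. -/
theorem descentCount_add_one {m : ℕ} (σ : Equiv.Perm (Fin m)) (k : Fin m) :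
    descentCount σ k + 1 = (Finset.univ.filter fun j : Fin m => k ≤ j ∧ IsDescent σ 0 j).card := by
  obtain _ | m := m
  · exact k.elim0
  have : (Finset.univ.filter fun j : Fin (m + 1) => k ≤ j ∧ IsDescent σ 0 j) =
      insert (Fin.last m) (Finset.univ.filter fun j : Fin (m + 1) =>
        k ≤ j ∧ ∃ h : (j : ℕ) + 1 < m + 1, σ ⟨(j : ℕ) + 1, h⟩ < σ j) := by
    ext j
    rw [Finset.mem_filter, Finset.mem_insert, Finset.mem_filter, IsDescent]
    by_cases h : (j : ℕ) + 1 < m + 1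
    · have hj : j ≠ Fin.last m := by
        rintro rfl
        simp at h
      simp only [dif_pos h, hj, false_or, exists_prop_of_true h, Finset.mem_univ, true_and]
    · have hj : j = Fin.last m := by
        ext
        rw [Fin.val_last]
        omega
      subst hj
      simp only [dif_neg h, Nat.zero_le, and_true, true_or, iff_true, Finset.mem_univ, true_and]
      exact Fin.le_last k
  rw [this, Finset.card_insert_of_notMem]
  · unfold descentCount
    congr!
  · simp only [Finset.mem_filter, not_and, not_exists]
    intro _ _ h
    simp at h

open Classical in
/-- The coefficients of `A_X`: each descent, and the last index, contributes the product of the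
`X`'s up to that index. -/
theorem prod_pow_descentCount {m : ℕ} (x : Fin m → ℂ) (σ : Equiv.Perm (Fin m))
    (hx : ∀ k, ∏ l ∈ Finset.Iic k, x (σ l) ≠ 1) :
    ∏ k, x (σ k) ^ (descentCount σ k + 1) / (1 - ∏ l ∈ Finset.Iic k, x (σ l)) =
      ∏ k, if IsDescent σ 0 k then
          (∏ l ∈ Finset.Iic k, x (σ l)) / (1 - ∏ l ∈ Finset.Iic k, x (σ l))
        else 1 + (∏ l ∈ Finset.Iic k, x (σ l)) / (1 - ∏ l ∈ Finset.Iic k, x (σ l)) := by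
  have h1 : ∏ k, x (σ k) ^ (descentCount σ k + 1) =
      ∏ j, if IsDescent σ 0 j then ∏ k ∈ Finset.Iic j, x (σ k) else 1 := by
    rw [← Finset.prod_filter]
    simp only [descentCount_add_one, ← Finset.prod_const]
    refine Finset.prod_comm' fun k j => ?_
    simp
  rw [Finset.prod_div_distrib, h1, ← Finset.prod_div_distrib]
  refine Finset.prod_congr rfl fun k _ => ?_
  split_ifs
  · rfl
  · have : 1 - ∏ l ∈ Finset.Iic k, x (σ l) ≠ 0 := sub_ne_zero.2 (hx k).symm
    field_simp
    ring

end PermSum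

/-! ### Existence of the map `A_X` -/

section AX

variable {𝔤 : Type*} [LieRing 𝔤] [LieAlgebra ℂ 𝔤] [FiniteDimensional ℂ 𝔤]
  [LieAlgebra.IsSimple ℂ 𝔤] {H : LieSubalgebra ℂ 𝔤} {ι : Type*} [Fintype ι]
  [H.IsCartanSubalgebra] (b : LieAlgebra.Basis ι H)

theorem Xexp_eq_mul {α β γ : LieModule.Weight ℂ H 𝔤} {lam : H}
    (h : α lam = β lam + γ lam) : Xexp α lam = Xexp β lam * Xexp γ lam := by
  rw [Xexp, Xexp, Xexp, ← Complex.exp_add, h]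
  congr 1
  ring

/-- A word whose letters are negative root vectors, each listed with the corresponding positive
root. -/
def IsRootWord (l : List (LieModule.Weight ℂ H 𝔤 × nMinus b)) : Prop :=
  ∀ s ∈ l, s.1 ∈ posRoots b ∧ (s.2 : 𝔤) ∈ LieAlgebra.rootSpace H (-(s.1 : H → ℂ))

/-- The word of elements of `U(𝔫₋)` in which a letter of root `-β` is given the weight `X_β`. -/
noncomputable def expWord (lam : H) (l : List (LieModule.Weight ℂ H 𝔤 × nMinus b)) :
    List (ℂ × UMinus b) :=
  l.map fun s => (Xexp s.1 lam, 𝓲 s.2)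

/-- The recursion `symWord` defines a linear map on `U(𝔫₋)`: on words in a basis of root vectors it
satisfies the commutation relations, since `X_α` is multiplicative in `α`. The formula extends to
all words in root vectors by linearity in each letter. -/
theorem exists_symWord_map (f : ℂ → ℂ) (lam : H) : ∃ A : UMinus b →ₗ[ℂ] UMinus b,
    ∀ l, IsRootWord b l → A (wordProd (l.map Prod.snd)) = symWord f (expWord b lam l) := by
  obtain ⟨κ, e, d, he⟩ := exists_rootBasis b
  let w : κ → LieModule.Weight ℂ H 𝔤 × nMinus b := fun k => (d k, e k)
  obtain ⟨A, hA⟩ := exists_linearMap_of_wordRelations e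
    (fun l => symWord f (expWord b lam (l.map w))) (by
      intro s i j t
      simp only [expWord, List.map_append, List.map_cons, w]
      rw [symWord_commutator, ← env_ι_lie]
      conv_lhs => rw [← e.linearCombination_repr ⁅e i, e j⁆, Finsupp.linearCombination_apply,
        Finsupp.sum, map_sum]
      change symWordLetter f _ _ _ _ = _
      rw [map_sum, Finsupp.sum]
      refine Finset.sum_congr rfl fun k hk => ?_
      rw [map_smul, map_smul]
      congr 1
      have hk' := weight_eq_of_repr_ne_zero b e d he (χ := fun h => d i h + d j h)
        (x := ⁅e i, e j⁆) (fun h => by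
          rw [LieSubalgebra.coe_bracket, leibniz_lie, lie_of_mem_rootSpace (he i).2,
            lie_of_mem_rootSpace (he j).2, smul_lie, lie_smul, ← add_smul, Pi.neg_apply,
            Pi.neg_apply, neg_add]) (Finsupp.mem_support_iff.1 hk)
      rw [← Xexp_eq_mul (congrFun hk' lam)]
      rfl)
  refine ⟨A, ?_⟩
  -- `l` is a word in arbitrary root vectors, `t` one in basis vectors; the letters of `l` are
  -- expanded in the basis one by one, from the right
  have key : ∀ (l : List (LieModule.Weight ℂ H 𝔤 × nMinus b)) (t : List κ), IsRootWord b l →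
      A (wordProd (l.map Prod.snd ++ t.map e)) =
        symWord f (expWord b lam l ++ expWord b lam (t.map w)) := by
    intro l
    induction l using List.reverseRecOn with
    | nil =>
      intro t _
      have := hA t
      simpa [expWord] using this
    | append_singleton l a ih =>
      intro t hl
      obtain ⟨β, x⟩ := a
      have hl' : IsRootWord b l := fun s hs => hl s (by simp [hs])
      obtain ⟨hβ, hx⟩ := hl (β, x) (by simp)
      have h1 : ∀ y : nMinus b, wordProd ((l ++ [(β, y)]).map Prod.snd ++ t.map e) =
          (LinearMap.mulRight ℂ (wordProd (t.map e)) ∘ₗ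
            LinearMap.mulLeft ℂ (wordProd (l.map Prod.snd)) ∘ₗ
            (𝓲 : nMinus b →ₗ⁅ℂ⁆ UMinus b).toLinearMap) y := by
        intro y
        simp [mul_assoc]
      have h2 : ∀ y : nMinus b,
          symWord f (expWord b lam (l ++ [(β, y)]) ++ expWord b lam (t.map w)) =
          (symWordLetter f (expWord b lam l) (expWord b lam (t.map w)) (Xexp β lam) ∘ₗ
            (𝓲 : nMinus b →ₗ⁅ℂ⁆ UMinus b).toLinearMap) y := by
        intro y
        simp [expWord, symWordLetter]
      rw [h1, h2, ← LinearMap.comp_apply, ← e.linearCombination_repr x,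
        Finsupp.linearCombination_apply, Finsupp.sum, map_sum, map_sum]
      refine Finset.sum_congr rfl fun k hk => ?_
      rw [map_smul, map_smul]
      congr 1
      have hk' := weight_eq_of_repr_ne_zero b e d he (χ := (β : H → ℂ))
        (x := x) (fun h => by rw [lie_of_mem_rootSpace hx, Pi.neg_apply])
        (Finsupp.mem_support_iff.1 hk)
      have hd : d k = β := DFunLike.coe_injective hk'
      rw [LinearMap.comp_apply, ← h1, ← h2]
      have := ih (k :: t) hl'
      rw [List.map_cons] at this
      simp only [List.map_append, List.map_cons, List.map_nil, List.append_assoc,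
        List.singleton_append]
      rw [this]
      simp [expWord, w, hd]
  intro l hl
  simpa [expWord] using key l [] hl

/-- The map `A_X` exists as soon as none of the denominators vanishes. -/
theorem AX_spec {lam : H} (hlam : ∀ (m : ℕ) (β : Fin m → LieModule.Weight ℂ H 𝔤),
      (∀ k, β k ∈ posRoots b) → ∀ k, ∏ l ∈ Finset.Iic k, Xexp (β l) lam ≠ 1)
    (m : ℕ) (β : Fin m → LieModule.Weight ℂ H 𝔤) (F : Fin m → nMinus b)
    (hF : ∀ k, β k ∈ posRoots b ∧ (F k : 𝔤) ∈ LieAlgebra.rootSpace H (-(β k : H → ℂ))) :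
    AX b lam (List.ofFn fun k => 𝓲 (F k)).prod =
        ∑ σ : Equiv.Perm (Fin m),
          (∏ k, Xexp (β (σ k)) lam ^ (descentCount σ k + 1) /
            (1 - ∏ l ∈ Finset.Iic k, Xexp (β (σ l)) lam)) •
          (List.ofFn fun k => 𝓲 (F (σ k))).prod := by
  classical
  refine theElement_spec (P := fun A : UMinus b →ₗ[ℂ] UMinus b =>
    ∀ (m : ℕ) (β : Fin m → LieModule.Weight ℂ H 𝔤) (F : Fin m → nMinus b),
      (∀ k, β k ∈ posRoots b ∧ (F k : 𝔤) ∈ LieAlgebra.rootSpace H (-(β k : H → ℂ))) →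
      A (List.ofFn fun k => 𝓲 (F k)).prod =
        ∑ σ : Equiv.Perm (Fin m),
          (∏ k, Xexp (β (σ k)) lam ^ (descentCount σ k + 1) /
            (1 - ∏ l ∈ Finset.Iic k, Xexp (β (σ l)) lam)) •
          (List.ofFn fun k => 𝓲 (F (σ k))).prod) ?_ m β F hF
  obtain ⟨A, hA⟩ := exists_symWord_map b (fun P => P / (1 - P)) lam
  refine ⟨A, fun m β F hF => ?_⟩
  have h1 := hA (List.ofFn fun k => (β k, F k)) (by
    intro s hs
    obtain ⟨k, rfl⟩ := List.mem_ofFn.1 hs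
    exact hF k)
  have h2 : expWord b lam (List.ofFn fun k => (β k, F k)) =
      List.ofFn fun k => (Xexp (β k) lam, 𝓲 (F k)) := by
    rw [expWord, List.map_ofFn]; rfl
  have h3 : wordProd ((List.ofFn fun k => (β k, F k)).map Prod.snd) =
      (List.ofFn fun k => 𝓲 (F k)).prod := by
    rw [wordProd, List.map_map, List.map_ofFn]; rfl
  rw [h2, h3, symWord_ofFn, permSum] at h1
  rw [h1]
  refine Finset.sum_congr rfl fun σ _ => ?_
  rw [prod_pow_descentCount (fun k => Xexp (β k) lam) σ
    (fun k => hlam m (fun l => β (σ l)) (fun l => (hF (σ l)).1) k), letterProd, List.map_ofFn]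
  rfl

end AX

/-! ### Means over the contour -/

section Mean

open MeasureTheory BoundedContinuousFunction

variable {ι : Type*} [Fintype ι] (δ : ℝ)

/-- The exponential `X_{α_i}` at the point of the contour with parameter `t`. -/
noncomputable def torusExp (t : ι → ℝ) (i : ι) : ℂ :=
  Complex.exp (-2 * Real.pi * Complex.I * ((t i : ℂ) - Complex.I * δ))

theorem norm_torusExp (t : ι → ℝ) (i : ι) : ‖torusExp δ t i‖ = Real.exp (-2 * Real.pi * δ) := by
  rw [torusExp, Complex.norm_exp]
  congr 1
  simp [Complex.mul_re, Complex.mul_im]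

/-- The exponential `X_{α_i}` as a bounded continuous function on the contour. -/
noncomputable def torusExpFun (i : ι) : (ι → ℝ) →ᵇ ℂ :=
  BoundedContinuousFunction.ofNormedAddCommGroup (fun t => torusExp δ t i)
    (by unfold torusExp; fun_prop) (Real.exp (-2 * Real.pi * δ))
    (fun t => (norm_torusExp δ t i).le)

/-- The closed algebra generated by the pairs `(X_{α_i}, 0)`. For a pair `(a, c)` in it, the
function `a` is a uniform limit of polynomials in the `X_{α_i}` with constant terms tending
to `c`. -/
noncomputable def meanAlgebra : Subalgebra ℂ (((ι → ℝ) →ᵇ ℂ) × ℂ) :=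
  (MvPolynomial.aeval fun i => (torusExpFun δ i, (0 : ℂ)) :
    MvPolynomial ι ℂ →ₐ[ℂ] ((ι → ℝ) →ᵇ ℂ) × ℂ).range.topologicalClosure

/-- The integral over the unit cube, as a continuous linear form for uniform convergence. -/
noncomputable def cubeIntegral : ((ι → ℝ) →ᵇ ℂ) →L[ℂ] ℂ :=
  LinearMap.mkContinuous
    { toFun := fun g => ∫ t in Set.Icc (0 : ι → ℝ) 1, g t
      map_add' := fun g g' => by
        have : IsFiniteMeasure (volume.restrict (Set.Icc (0 : ι → ℝ) 1)) :=
          ⟨by rw [Measure.restrict_apply_univ]; exact isCompact_Icc.measure_lt_top⟩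
        exact integral_add (g.integrable _) (g'.integrable _)
      map_smul' := fun c g => integral_const_mul c _ } 1 (fun g => by
        have h1 : volume (Set.Icc (0 : ι → ℝ) 1) = 1 := by
          rw [Real.volume_Icc_pi]; simp
        have := norm_setIntegral_le_of_norm_le_const (μ := volume) (s := Set.Icc (0 : ι → ℝ) 1)
          (by rw [h1]; exact ENNReal.one_lt_top) (fun t _ => g.norm_coe_le_norm t)
        rw [Measure.real, h1, ENNReal.toReal_one, mul_one] at this
        rw [one_mul]
        exact this)

theorem cubeIntegral_apply (g : (ι → ℝ) →ᵇ ℂ) :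
    cubeIntegral g = ∫ t in Set.Icc (0 : ι → ℝ) 1, g t := rfl

theorem integral_torusExp_pow (k : ℕ) :
    ∫ x in Set.Icc (0 : ℝ) 1,
      Complex.exp (-2 * Real.pi * Complex.I * ((x : ℂ) - Complex.I * δ)) ^ k =
      if k = 0 then 1 else 0 := by
  split_ifs with h
  · subst h; simp
  · have hk : (-(k * (2 * Real.pi * Complex.I)) : ℂ) ≠ 0 := by
      simp [h, Real.pi_ne_zero, Complex.I_ne_zero]
    have h1 : ∀ x : ℝ, Complex.exp (-2 * Real.pi * Complex.I * ((x : ℂ) - Complex.I * δ)) ^ k =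
        Complex.exp (-2 * Real.pi * Complex.I * (-(Complex.I * δ))) ^ k *
          Complex.exp (-(k * (2 * Real.pi * Complex.I)) * x) := by
      intro x
      rw [← Complex.exp_nat_mul, ← Complex.exp_nat_mul, ← Complex.exp_add]
      congr 1
      ring
    simp only [h1]
    rw [integral_const_mul, integral_Icc_eq_integral_Ioc,
      ← intervalIntegral.integral_of_le zero_le_one, integral_exp_mul_complex hk]
    rw [Complex.ofReal_one, mul_one, Complex.ofReal_zero, mul_zero, Complex.exp_zero,
      Complex.exp_neg, Complex.exp_nat_mul_two_pi_mul_I]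
    simp

/-- The integral is continuous, and it takes a monomial to its constant term. -/
theorem cubeIntegral_of_mem {s : ((ι → ℝ) →ᵇ ℂ) × ℂ} (hs : s ∈ meanAlgebra δ) :
    cubeIntegral s.1 = s.2 := by
  have hcl : IsClosed {s : ((ι → ℝ) →ᵇ ℂ) × ℂ | cubeIntegral s.1 = s.2} :=
    isClosed_eq (cubeIntegral.continuous.comp continuous_fst) continuous_snd
  refine closure_minimal ?_ hcl hs
  rintro _ ⟨p, rfl⟩
  change cubeIntegral (MvPolynomial.aeval (fun i => (torusExpFun δ i, (0 : ℂ))) p).1 =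
    (MvPolynomial.aeval (fun i => (torusExpFun δ i, (0 : ℂ))) p).2
  induction p using MvPolynomial.induction_on' with
  | add p q hp hq => simp only [map_add, Prod.fst_add, Prod.snd_add, hp, hq]
  | monomial u a =>
    rw [MvPolynomial.aeval_monomial, Finsupp.prod_fintype _ _ (by simp)]
    have e1 : ∀ t, (algebraMap ℂ (((ι → ℝ) →ᵇ ℂ) × ℂ) a *
        ∏ i, (torusExpFun δ i, (0 : ℂ)) ^ u i).1 t =
        a * ∏ i, Complex.exp (-2 * Real.pi * Complex.I * ((t i : ℂ) - Complex.I * δ)) ^ u i := by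
      intro t
      rw [Prod.fst_mul, Prod.fst_prod, BoundedContinuousFunction.mul_apply]
      refine congrArg₂ (· * ·) (by simp) ?_
      rw [BoundedContinuousFunction.coe_prod, Finset.prod_apply]
      rfl
    have e2 : (algebraMap ℂ (((ι → ℝ) →ᵇ ℂ) × ℂ) a * ∏ i, (torusExpFun δ i, (0 : ℂ)) ^ u i).2 =
        a * ∏ i, if u i = 0 then 1 else 0 := by
      rw [Prod.snd_mul, Prod.snd_prod]
      congr 1
      refine Finset.prod_congr rfl fun i _ => ?_
      simp [zero_pow_eq]
    rw [cubeIntegral_apply, e2]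
    simp only [e1]
    rw [integral_const_mul]
    congr 1
    have h0 : Set.Icc (0 : ι → ℝ) 1 = Set.univ.pi fun _ => Set.Icc (0 : ℝ) 1 :=
      (Set.pi_univ_Icc _ _).symm
    rw [h0, volume_pi, Measure.restrict_pi_pi,
      integral_fintype_prod_eq_prod (fun i (x : ℝ) =>
        Complex.exp (-2 * Real.pi * Complex.I * ((x : ℂ) - Complex.I * δ)) ^ u i)]
    exact Finset.prod_congr rfl fun i _ => integral_torusExp_pow δ (u i)

/-- The function `a` on the contour is a uniform limit of polynomials in the `X_{α_i}` with
constant terms tending to `c`. -/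
def HasMean (a : (ι → ℝ) → ℂ) (c : ℂ) : Prop :=
  ∃ g : (ι → ℝ) →ᵇ ℂ, (g, c) ∈ meanAlgebra δ ∧ ∀ t, g t = a t

variable {δ}

theorem HasMean.integrableOn {a : (ι → ℝ) → ℂ} {c : ℂ} (h : HasMean δ a c) :
    IntegrableOn a (Set.Icc (0 : ι → ℝ) 1) := by
  obtain ⟨g, -, hg⟩ := h
  have : a = g := (funext hg).symm
  rw [this]
  exact g.continuous.continuousOn.integrableOn_compact isCompact_Icc

theorem HasMean.integral_eq {a : (ι → ℝ) → ℂ} {c : ℂ} (h : HasMean δ a c) :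
    ∫ t in Set.Icc (0 : ι → ℝ) 1, a t = c := by
  obtain ⟨g, hgc, hg⟩ := h
  have : a = g := (funext hg).symm
  rw [this]
  exact cubeIntegral_of_mem δ hgc

theorem HasMean.add {a a' : (ι → ℝ) → ℂ} {c c' : ℂ} (h : HasMean δ a c) (h' : HasMean δ a' c') :
    HasMean δ (fun t => a t + a' t) (c + c') := by
  obtain ⟨g, hgc, hg⟩ := h
  obtain ⟨g', hgc', hg'⟩ := h'
  exact ⟨g + g', add_mem hgc hgc', fun t => by
    rw [BoundedContinuousFunction.add_apply, hg, hg']⟩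

theorem HasMean.mul {a a' : (ι → ℝ) → ℂ} {c c' : ℂ} (h : HasMean δ a c) (h' : HasMean δ a' c') :
    HasMean δ (fun t => a t * a' t) (c * c') := by
  obtain ⟨g, hgc, hg⟩ := h
  obtain ⟨g', hgc', hg'⟩ := h'
  exact ⟨g * g', mul_mem hgc hgc', fun t => by
    rw [BoundedContinuousFunction.mul_apply, hg, hg']⟩

theorem hasMean_const (c : ℂ) : HasMean δ (fun _ : ι → ℝ => c) c :=
  ⟨algebraMap ℂ _ c, (meanAlgebra δ).algebraMap_mem c, fun t => by
    rw [BoundedContinuousFunction.algebraMap_apply]; simp⟩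

theorem HasMean.prod {κ : Type*} (s : Finset κ) {a : κ → (ι → ℝ) → ℂ} {c : κ → ℂ}
    (h : ∀ k ∈ s, HasMean δ (a k) (c k)) :
    HasMean δ (fun t => ∏ k ∈ s, a k t) (∏ k ∈ s, c k) := by
  classical
  induction s using Finset.induction_on with
  | empty => simpa using hasMean_const (ι := ι) (δ := δ) 1
  | insert k s hk ih =>
    simp only [Finset.prod_insert hk]
    exact (h k (by simp)).mul (ih fun j hj => h j (by simp [hj]))

theorem hasMean_torusExp (i : ι) : HasMean δ (fun t => torusExp δ t i) 0 :=
  ⟨torusExpFun δ i, Subalgebra.le_topologicalClosure _ ⟨MvPolynomial.X i, by simp⟩, fun _ => rfl⟩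

/-- A geometric series: if `a` has mean `0` and is bounded by `r < 1`, then `1 / (1 - a)` has
mean `1`. -/
theorem HasMean.inv_one_sub {a : (ι → ℝ) → ℂ} (h : HasMean δ a 0) {r : ℝ} (hr : r < 1)
    (hr0 : 0 ≤ r) (ha : ∀ t, ‖a t‖ ≤ r) : HasMean δ (fun t => (1 - a t)⁻¹) 1 := by
  obtain ⟨g, hgc, hg⟩ := h
  set p : ((ι → ℝ) →ᵇ ℂ) × ℂ := (g, 0) with hp
  have hnorm : ‖p‖ < 1 := by
    rw [Prod.norm_def, norm_zero, max_lt_iff]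
    refine ⟨lt_of_le_of_lt ((BoundedContinuousFunction.norm_le hr0).2 fun t => ?_) hr, one_pos⟩
    rw [hg]
    exact ha t
  -- the sum is taken in the product algebra: its second component is the mean `1`
  set q := ∑' k : ℕ, p ^ k with hq
  have hqm : q ∈ meanAlgebra δ :=
    (Subalgebra.isClosed_topologicalClosure _).mem_of_tendsto
      (summable_geometric_of_norm_lt_one hnorm).hasSum.tendsto_sum_nat
      (Filter.Eventually.of_forall fun _ => sum_mem fun k _ => pow_mem hgc k)
  have hpq : (1 - p) * q = 1 := mul_neg_geom_series p hnorm
  have h1 := congrArg Prod.fst hpq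
  have h2 := congrArg Prod.snd hpq
  rw [Prod.snd_mul, Prod.snd_sub, hp] at h2
  simp only [Prod.snd_one, sub_zero, one_mul] at h2
  refine ⟨q.1, by rw [← h2]; exact hqm, fun t => ?_⟩
  have h3 := congrArg (fun g : (ι → ℝ) →ᵇ ℂ => g t) h1
  rw [Prod.fst_mul, Prod.fst_sub, hp] at h3
  simp only [BoundedContinuousFunction.mul_apply, BoundedContinuousFunction.sub_apply, hg,
    Prod.fst_one] at h3
  exact eq_inv_of_mul_eq_one_right h3

/-- A function of mean `0` which is bounded by `|X_{α_i}|` on the contour. -/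
def IsSmall (δ : ℝ) (a : (ι → ℝ) → ℂ) : Prop :=
  HasMean δ a 0 ∧ ∀ t, ‖a t‖ ≤ Real.exp (-2 * Real.pi * δ)

theorem exp_contour_lt_one (hδ : 0 < δ) : Real.exp (-2 * Real.pi * δ) < 1 := by
  rw [Real.exp_lt_one_iff]
  have := mul_pos Real.pi_pos hδ
  linarith

theorem IsSmall.mul (hδ : 0 < δ) {a a' : (ι → ℝ) → ℂ} (h : IsSmall δ a) (h' : IsSmall δ a') :
    IsSmall δ (a * a') := by
  refine ⟨by have := h.1.mul h'.1; rwa [mul_zero] at this, fun t => ?_⟩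
  rw [Pi.mul_apply, norm_mul]
  exact (mul_le_of_le_one_right (norm_nonneg _)
    ((h'.2 t).trans (exp_contour_lt_one hδ).le)).trans (h.2 t)

theorem IsSmall.prod (hδ : 0 < δ) {κ : Type*} {s : Finset κ} (hs : s.Nonempty)
    {a : κ → (ι → ℝ) → ℂ} (h : ∀ k ∈ s, IsSmall δ (a k)) : IsSmall δ (∏ k ∈ s, a k) :=
  Finset.prod_induction_nonempty a (IsSmall δ) (fun _ _ h h' => h.mul hδ h') hs h

theorem isSmall_torusExp (i : ι) : IsSmall δ fun t => torusExp δ t i :=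
  ⟨hasMean_torusExp i, fun t => (norm_torusExp δ t i).le⟩

theorem isSmall_torusExp_monomial (hδ : 0 < δ) {m : ι → ℕ} (hm : m ≠ 0) :
    IsSmall δ fun t => ∏ i, torusExp δ t i ^ m i := by
  classical
  have h1 : ∀ (i : ι) (k : ℕ), k ≠ 0 → IsSmall δ fun t => torusExp δ t i ^ k := by
    intro i k hk
    have := IsSmall.prod hδ (s := Finset.range k) (Finset.nonempty_range_iff.2 hk)
      (a := fun _ t => torusExp δ t i) fun _ _ => isSmall_torusExp i
    convert this using 1
    ext t
    simp
  have h2 : (fun t => ∏ i, torusExp δ t i ^ m i) =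
      ∏ i ∈ Finset.univ.filter fun i => m i ≠ 0, fun t => torusExp δ t i ^ m i := by
    ext t
    rw [Finset.prod_apply, Finset.prod_filter]
    refine Finset.prod_congr rfl fun i _ => ?_
    by_cases h : m i = 0 <;> simp [h]
  rw [h2]
  refine IsSmall.prod hδ ?_ fun i hi => h1 i _ (Finset.mem_filter.1 hi).2
  obtain ⟨i, hi⟩ := Function.ne_iff.1 hm
  exact ⟨i, by simpa using hi⟩

section Fractions

variable {P : (ι → ℝ) → ℂ}

theorem IsSmall.one_sub_ne_zero (hδ : 0 < δ) (h : IsSmall δ P) (t : ι → ℝ) : 1 - P t ≠ 0 := by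
  intro h0
  have h1 := (h.2 t).trans_lt (exp_contour_lt_one hδ)
  rw [← sub_eq_zero.1 h0, norm_one] at h1
  exact lt_irrefl _ h1

theorem IsSmall.hasMean_inv (hδ : 0 < δ) (h : IsSmall δ P) : HasMean δ (fun t => (1 - P t)⁻¹) 1 :=
  h.1.inv_one_sub (exp_contour_lt_one hδ) (Real.exp_pos _).le h.2

theorem IsSmall.hasMean_div (hδ : 0 < δ) (h : IsSmall δ P) :
    HasMean δ (fun t => P t / (1 - P t)) 0 := by
  simpa [div_eq_mul_inv] using h.1.mul (h.hasMean_inv hδ)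

theorem IsSmall.hasMean_one_add_div (hδ : 0 < δ) (h : IsSmall δ P) :
    HasMean δ (fun t => 1 + P t / (1 - P t)) 1 := by
  simpa using (hasMean_const 1).add (h.hasMean_div hδ)

/-- The mean of `P⁻¹ / (1 - P⁻¹) = -1 / (1 - P)`. -/
theorem IsSmall.hasMean_inv_div (hδ : 0 < δ) (h : IsSmall δ P) (h0 : ∀ t, P t ≠ 0) :
    HasMean δ (fun t => (P t)⁻¹ / (1 - (P t)⁻¹)) (-1) := by
  have := (hasMean_const (-1)).mul (h.hasMean_inv hδ)
  rw [mul_one] at this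
  convert this using 2 with t
  have h3 : 1 - (P t)⁻¹ = -((1 - P t) * (P t)⁻¹) := by
    rw [sub_mul, mul_inv_cancel₀ (h0 t)]; ring
  rw [h3, div_neg, div_mul_cancel_right₀ (inv_ne_zero (h0 t)), neg_one_mul]

theorem IsSmall.hasMean_one_add_inv_div (hδ : 0 < δ) (h : IsSmall δ P) (h0 : ∀ t, P t ≠ 0) :
    HasMean δ (fun t => 1 + (P t)⁻¹ / (1 - (P t)⁻¹)) 0 := by
  simpa using (hasMean_const 1).add (h.hasMean_inv_div hδ h0)

end Fractions

end Mean

/-! ### The means of `A_X` and of `A_{1/X}` -/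

section MeanAX

variable {𝔤 : Type*} [LieRing 𝔤] [LieAlgebra ℂ 𝔤] [FiniteDimensional ℂ 𝔤]
  [LieAlgebra.IsSimple ℂ 𝔤] {H : LieSubalgebra ℂ 𝔤} {ι : Type*} [Fintype ι]
  [H.IsCartanSubalgebra] (b : LieAlgebra.Basis ι H) {δ : ℝ}

theorem Xexp_ne_zero (β : LieModule.Weight ℂ H 𝔤) (lam : H) : Xexp β lam ≠ 0 :=
  Complex.exp_ne_zero _

theorem Xexp_neg (β : LieModule.Weight ℂ H 𝔤) (lam : H) : Xexp β (-lam) = (Xexp β lam)⁻¹ := by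
  rw [Xexp, Xexp, ← Complex.exp_neg]
  congr 1
  have : β (-lam) = -β lam := map_neg β.toLinear lam
  rw [this]
  ring

/-- For a positive root `β`, the function `X_β` is a nonconstant monomial in the `X_{α_i}`. -/
theorem isSmall_Xexp (hδ : 0 < δ) {β : LieModule.Weight ℂ H 𝔤} (hβ : β ∈ posRoots b) :
    IsSmall δ fun t => Xexp β (contourPoint b δ t) := by
  obtain ⟨-, m, hm⟩ := (mem_posRoots b β).1 hβ
  have hm0 : m ≠ 0 := by
    rintro rfl
    obtain ⟨n, hn, h⟩ := posRoot_heightElt b hβ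
    have h1 : β (heightElt b) = 0 := by
      have := LinearMap.congr_fun hm (heightElt b)
      simpa using this
    rw [h] at h1
    exact absurd (Nat.cast_eq_zero.1 h1) (by omega)
  convert isSmall_torusExp_monomial hδ hm0 using 2 with t
  have h1 : β (contourPoint b δ t) = ∑ i, (m i : ℂ) * ((t i : ℂ) - Complex.I * δ) := by
    refine (LinearMap.congr_fun hm _).trans ?_
    rw [LinearMap.sum_apply]
    refine Finset.sum_congr rfl fun i _ => ?_
    rw [LinearMap.smul_apply, contourPoint, baseSupp_pointOf, nsmul_eq_mul]
  rw [Xexp, h1, Finset.mul_sum, Complex.exp_sum]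
  refine Finset.prod_congr rfl fun i _ => ?_
  rw [torusExp, ← Complex.exp_nat_mul]
  congr 1
  ring

theorem isSmall_prod_Xexp (hδ : 0 < δ) {m : ℕ} {β : Fin m → LieModule.Weight ℂ H 𝔤}
    (hβ : ∀ k, β k ∈ posRoots b) (k : Fin m) :
    IsSmall δ fun t => ∏ l ∈ Finset.Iic k, Xexp (β l) (contourPoint b δ t) := by
  have := IsSmall.prod hδ (s := Finset.Iic k) ⟨k, by simp⟩
    (a := fun l t => Xexp (β l) (contourPoint b δ t)) fun l _ => isSmall_Xexp b hδ (hβ l)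
  convert this using 1
  ext t
  rw [Finset.prod_apply]

open Classical in
theorem AX_contour (hδ : 0 < δ) (t : ι → ℝ) {m : ℕ} (β : Fin m → LieModule.Weight ℂ H 𝔤)
    (F : Fin m → nMinus b)
    (hF : ∀ k, β k ∈ posRoots b ∧ (F k : 𝔤) ∈ LieAlgebra.rootSpace H (-(β k : H → ℂ))) :
    AX b (contourPoint b δ t) (wordProd (List.ofFn F)) =
      ∑ σ : Equiv.Perm (Fin m), (∏ k, if IsDescent σ 0 k then
          (∏ l ∈ Finset.Iic k, Xexp (β (σ l)) (contourPoint b δ t)) /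
            (1 - ∏ l ∈ Finset.Iic k, Xexp (β (σ l)) (contourPoint b δ t))
        else 1 + (∏ l ∈ Finset.Iic k, Xexp (β (σ l)) (contourPoint b δ t)) /
            (1 - ∏ l ∈ Finset.Iic k, Xexp (β (σ l)) (contourPoint b δ t))) •
        wordProd (List.ofFn fun k => F (σ k)) := by
  have hne : ∀ (m : ℕ) (β : Fin m → LieModule.Weight ℂ H 𝔤), (∀ k, β k ∈ posRoots b) → ∀ k,
      ∏ l ∈ Finset.Iic k, Xexp (β l) (contourPoint b δ t) ≠ 1 := fun m β hβ k =>
    (sub_ne_zero.1 ((isSmall_prod_Xexp b hδ hβ k).one_sub_ne_zero hδ t)).symm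
  have := AX_spec b hne m β F hF
  simp only [wordProd, List.map_ofFn]
  refine this.trans (Finset.sum_congr rfl fun σ _ => ?_)
  rw [prod_pow_descentCount (fun k => Xexp (β k) (contourPoint b δ t)) σ
    (fun k => hne m (fun l => β (σ l)) (fun l => (hF (σ l)).1) k)]
  rfl

open Classical in
theorem AX_neg_contour (hδ : 0 < δ) (t : ι → ℝ) {m : ℕ} (β : Fin m → LieModule.Weight ℂ H 𝔤)
    (F : Fin m → nMinus b)
    (hF : ∀ k, β k ∈ posRoots b ∧ (F k : 𝔤) ∈ LieAlgebra.rootSpace H (-(β k : H → ℂ))) :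
    AX b (-contourPoint b δ t) (wordProd (List.ofFn F)) =
      ∑ σ : Equiv.Perm (Fin m), (∏ k, if IsDescent σ 0 k then
          (∏ l ∈ Finset.Iic k, Xexp (β (σ l)) (contourPoint b δ t))⁻¹ /
            (1 - (∏ l ∈ Finset.Iic k, Xexp (β (σ l)) (contourPoint b δ t))⁻¹)
        else 1 + (∏ l ∈ Finset.Iic k, Xexp (β (σ l)) (contourPoint b δ t))⁻¹ /
            (1 - (∏ l ∈ Finset.Iic k, Xexp (β (σ l)) (contourPoint b δ t))⁻¹)) •
        wordProd (List.ofFn fun k => F (σ k)) := by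
  have hne : ∀ (m : ℕ) (β : Fin m → LieModule.Weight ℂ H 𝔤), (∀ k, β k ∈ posRoots b) → ∀ k,
      ∏ l ∈ Finset.Iic k, Xexp (β l) (-contourPoint b δ t) ≠ 1 := by
    intro m β hβ k h
    simp only [Xexp_neg, Finset.prod_inv_distrib, inv_eq_one] at h
    exact (sub_ne_zero.1 ((isSmall_prod_Xexp b hδ hβ k).one_sub_ne_zero hδ t)) h.symm
  have := AX_spec b hne m β F hF
  simp only [wordProd, List.map_ofFn]
  refine this.trans (Finset.sum_congr rfl fun σ _ => ?_)
  rw [prod_pow_descentCount (fun k => Xexp (β k) (-contourPoint b δ t)) σ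
    (fun k => hne m (fun l => β (σ l)) (fun l => (hF (σ l)).1) k)]
  simp only [Xexp_neg, Finset.prod_inv_distrib]
  rfl

/-- The only permutation all of whose indices are descents is the reversal. -/
theorem forall_isDescent_iff {m : ℕ} (σ : Equiv.Perm (Fin m)) :
    (∀ k, IsDescent σ 0 k) ↔ σ = Fin.revPerm := by
  obtain _ | m := m
  · exact ⟨fun _ => Subsingleton.elim _ _, fun _ k => k.elim0⟩
  constructor
  · intro h
    have hanti : StrictAnti σ := by
      rw [Fin.strictAnti_iff_succ_lt]
      intro i
      have := h i.castSucc
      rw [IsDescent, dif_pos (by simp)] at this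
      exact this
    have hmono : StrictMono fun k => σ (Fin.rev k) := fun i j hij => hanti (Fin.rev_lt_rev.2 hij)
    have h1 : (fun k => σ (Fin.rev k)) = id := hmono.eq_id
    ext1 k
    have := congrFun h1 (Fin.rev k)
    simpa using this
  · rintro rfl k
    unfold IsDescent
    split_ifs with h
    · rw [Fin.revPerm_apply, Fin.revPerm_apply, Fin.rev_lt_rev, Fin.lt_def]
      simp
    · exact Nat.zero_le _

section MeanSpan

variable {M N : Type*} [AddCommGroup M] [Module ℂ M] [AddCommGroup N] [Module ℂ N]

/-- The span of the pairs `(a x, c x)` with `x ∈ M` and `a` a function on the contour of mean `c`: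
the pairs of an `M`-valued function and its mean. No topology on `M` is needed. -/
def meanSpan (ι : Type*) [Fintype ι] (δ : ℝ) (M : Type*) [AddCommGroup M] [Module ℂ M] :
    Submodule ℂ (((ι → ℝ) → M) × M) :=
  Submodule.span ℂ {s | ∃ (a : (ι → ℝ) → ℂ) (c : ℂ) (x : M), HasMean δ a c ∧
    s = (fun t => a t • x, c • x)}

theorem HasMean.smul_mem {a : (ι → ℝ) → ℂ} {c : ℂ} (h : HasMean δ a c) (x : M) :
    ((fun t => a t • x, c • x) : ((ι → ℝ) → M) × M) ∈ meanSpan ι δ M :=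
  Submodule.subset_span ⟨a, c, x, h, rfl⟩

theorem meanSpan_map (L : M →ₗ[ℂ] N) {s : ((ι → ℝ) → M) × M} (hs : s ∈ meanSpan ι δ M) :
    ((fun t => L (s.1 t), L s.2) : ((ι → ℝ) → N) × N) ∈ meanSpan ι δ N := by
  induction hs using Submodule.span_induction with
  | mem s h =>
    obtain ⟨a, c, x, h, rfl⟩ := h
    simpa using h.smul_mem (L x)
  | zero =>
    convert (meanSpan ι δ N).zero_mem using 1
    simp; rfl
  | add s s' _ _ h h' =>
    convert add_mem h h' using 1
    simp; rfl
  | smul c s _ h =>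
    convert (meanSpan ι δ N).smul_mem c h using 1
    simp; rfl

theorem meanSpan_pairing (S : M →ₗ[ℂ] N →ₗ[ℂ] ℂ) {s : ((ι → ℝ) → M) × M}
    {s' : ((ι → ℝ) → N) × N} (hs : s ∈ meanSpan ι δ M) (hs' : s' ∈ meanSpan ι δ N) :
    HasMean δ (fun t => S (s.1 t) (s'.1 t)) (S s.2 s'.2) := by
  have hsmul : ∀ (c c' : ℂ) (a : (ι → ℝ) → ℂ), HasMean δ a c' →
      HasMean δ (fun t => c * a t) (c * c') := fun c c' a h => (hasMean_const c).mul h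
  induction hs using Submodule.span_induction with
  | mem s h =>
    obtain ⟨a, c, x, h, rfl⟩ := h
    induction hs' using Submodule.span_induction with
    | mem s' h' =>
      obtain ⟨a', c', x', h', rfl⟩ := h'
      have := (h'.mul h).mul (hasMean_const (S x x'))
      simpa [mul_assoc] using this
    | zero => simpa using hasMean_const (ι := ι) (δ := δ) 0
    | add s s' _ _ h h' => simpa [mul_add] using h.add h'
    | smul c s _ h => simpa [mul_left_comm] using hsmul c _ _ h
  | zero => simpa using hasMean_const (ι := ι) (δ := δ) 0
  | add s s' _ _ h h' => simpa using h.add h'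
  | smul c s _ h => simpa using hsmul c _ _ h

end MeanSpan

open Classical in
/-- The mean of `A_X` is the counit: for a nonempty word, each product of factors contains
`P / (1 - P)` for the last index, which is always a descent, and this factor has mean zero. -/
theorem AX_contour_word_mem (hδ : 0 < δ) {m : ℕ} (β : Fin m → LieModule.Weight ℂ H 𝔤)
    (F : Fin m → nMinus b)
    (hF : ∀ k, β k ∈ posRoots b ∧ (F k : 𝔤) ∈ LieAlgebra.rootSpace H (-(β k : H → ℂ))) :
    ((fun t => AX b (contourPoint b δ t) (wordProd (List.ofFn F)),
        if m = 0 then 1 else 0) : ((ι → ℝ) → UMinus b) × UMinus b) ∈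
      meanSpan ι δ (UMinus b) := by
  have h1 : ∀ σ : Equiv.Perm (Fin m), ((fun t => (∏ k, if IsDescent σ 0 k then
          (∏ l ∈ Finset.Iic k, Xexp (β (σ l)) (contourPoint b δ t)) /
            (1 - ∏ l ∈ Finset.Iic k, Xexp (β (σ l)) (contourPoint b δ t))
        else 1 + (∏ l ∈ Finset.Iic k, Xexp (β (σ l)) (contourPoint b δ t)) /
            (1 - ∏ l ∈ Finset.Iic k, Xexp (β (σ l)) (contourPoint b δ t))) •
        wordProd (List.ofFn fun k => F (σ k)),
      (∏ k, if IsDescent σ 0 k then (0 : ℂ) else 1) • wordProd (List.ofFn fun k => F (σ k))) :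
        ((ι → ℝ) → UMinus b) × UMinus b) ∈ meanSpan ι δ (UMinus b) := by
    intro σ
    refine HasMean.smul_mem (HasMean.prod _ fun k _ => ?_) _
    have hs := isSmall_prod_Xexp b hδ (fun l => (hF (σ l)).1) k
    split_ifs
    · exact hs.hasMean_div hδ
    · exact hs.hasMean_one_add_div hδ
  have h2 := sum_mem (t := Finset.univ) fun σ _ => h1 σ
  convert h2 using 1
  refine Prod.ext ?_ ?_
  · rw [Prod.fst_sum]
    funext t
    rw [Finset.sum_apply]
    exact AX_contour b hδ t β F hF
  · rw [Prod.snd_sum]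
    obtain _ | m := m
    · simp
    · rw [if_neg (Nat.succ_ne_zero m)]
      refine (Finset.sum_eq_zero fun σ _ => ?_).symm
      have hl : IsDescent σ 0 (Fin.last m) := by
        rw [IsDescent, dif_neg (by simp)]
        exact Nat.zero_le _
      have : (∏ k, if IsDescent σ 0 k then (0 : ℂ) else 1) = 0 :=
        Finset.prod_eq_zero (Finset.mem_univ (Fin.last m)) (if_pos hl)
      simp only [this, zero_smul]

theorem antipode_wordProd {L : Type*} [LieRing L] [LieAlgebra ℂ L] (l : List L) :
    antipode L (wordProd l) = (-1 : ℂ) ^ l.length • wordProd l.reverse := by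
  induction l with
  | nil => simp [antipode_one]
  | cons x l ih =>
    rw [wordProd_cons, antipode_mul, ih, antipode_ι, List.reverse_cons, wordProd_append,
      List.length_cons, pow_succ]
    simp

open Classical in
/-- The mean of `A_{1/X}` is the antipode: a descent now contributes a factor of mean `-1` and any
other index a factor of mean `0`, so that only the reversal of the word survives, with the sign
`(-1) ^ m`. -/
theorem AX_neg_contour_word_mem (hδ : 0 < δ) {m : ℕ} (β : Fin m → LieModule.Weight ℂ H 𝔤)
    (F : Fin m → nMinus b)
    (hF : ∀ k, β k ∈ posRoots b ∧ (F k : 𝔤) ∈ LieAlgebra.rootSpace H (-(β k : H → ℂ))) :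
    ((fun t => AX b (-contourPoint b δ t) (wordProd (List.ofFn F)),
        antipode (nMinus b) (wordProd (List.ofFn F))) : ((ι → ℝ) → UMinus b) × UMinus b) ∈
      meanSpan ι δ (UMinus b) := by
  have h1 : ∀ σ : Equiv.Perm (Fin m), ((fun t => (∏ k, if IsDescent σ 0 k then
          (∏ l ∈ Finset.Iic k, Xexp (β (σ l)) (contourPoint b δ t))⁻¹ /
            (1 - (∏ l ∈ Finset.Iic k, Xexp (β (σ l)) (contourPoint b δ t))⁻¹)
        else 1 + (∏ l ∈ Finset.Iic k, Xexp (β (σ l)) (contourPoint b δ t))⁻¹ /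
            (1 - (∏ l ∈ Finset.Iic k, Xexp (β (σ l)) (contourPoint b δ t))⁻¹)) •
        wordProd (List.ofFn fun k => F (σ k)),
      (∏ k, if IsDescent σ 0 k then (-1 : ℂ) else 0) • wordProd (List.ofFn fun k => F (σ k))) :
        ((ι → ℝ) → UMinus b) × UMinus b) ∈ meanSpan ι δ (UMinus b) := by
    intro σ
    refine HasMean.smul_mem (HasMean.prod _ fun k _ => ?_) _
    have hs := isSmall_prod_Xexp b hδ (fun l => (hF (σ l)).1) k
    have hne : ∀ t, ∏ l ∈ Finset.Iic k, Xexp (β (σ l)) (contourPoint b δ t) ≠ 0 := fun t =>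
      Finset.prod_ne_zero_iff.2 fun l _ => Xexp_ne_zero _ _
    split_ifs
    · exact hs.hasMean_inv_div hδ hne
    · exact hs.hasMean_one_add_inv_div hδ hne
  have h2 := sum_mem (t := Finset.univ) fun σ _ => h1 σ
  convert h2 using 1
  refine Prod.ext ?_ ?_
  · rw [Prod.fst_sum]
    funext t
    rw [Finset.sum_apply]
    exact AX_neg_contour b hδ t β F hF
  · rw [Prod.snd_sum, antipode_wordProd, List.length_ofFn,
      Finset.sum_eq_single_of_mem Fin.revPerm (Finset.mem_univ _)]
    · have h3 : (∏ k : Fin m, if IsDescent (Fin.revPerm : Equiv.Perm (Fin m)) 0 k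
          then (-1 : ℂ) else 0) = (-1) ^ m := by
        rw [Finset.prod_congr rfl fun k _ => if_pos ((forall_isDescent_iff _).2 rfl k)]
        simp
      simp only [h3]
      congr 2
      refine List.ext_getElem (by simp) fun k h₁ h₂ => ?_
      rw [List.getElem_reverse, List.getElem_ofFn, List.getElem_ofFn]
      congr 1
      ext
      simp [Fin.val_rev]
      omega
    · intro σ _ hσ
      have h4 : ¬ ∀ k, IsDescent σ 0 k := fun h => hσ ((forall_isDescent_iff σ).1 h)
      push Not at h4
      obtain ⟨k, hk⟩ := h4
      have : (∏ k, if IsDescent σ 0 k then (-1 : ℂ) else 0) = 0 :=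
        Finset.prod_eq_zero (Finset.mem_univ k) (if_neg hk)
      simp only [this, zero_smul]

/-- A family of maps on `U(𝔫₋)` which has a mean on the words in root vectors has one on all of
`U(𝔫₋)`. -/
theorem mem_meanSpan_of_words {A : (ι → ℝ) → UMinus b →ₗ[ℂ] UMinus b}
    {L : UMinus b →ₗ[ℂ] UMinus b}
    (h : ∀ (m : ℕ) (β : Fin m → LieModule.Weight ℂ H 𝔤) (F : Fin m → nMinus b),
      (∀ k, β k ∈ posRoots b ∧ (F k : 𝔤) ∈ LieAlgebra.rootSpace H (-(β k : H → ℂ))) →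
      ((fun t => A t (wordProd (List.ofFn F)), L (wordProd (List.ofFn F))) :
        ((ι → ℝ) → UMinus b) × UMinus b) ∈ meanSpan ι δ (UMinus b)) (z : UMinus b) :
    ((fun t => A t z, L z) : ((ι → ℝ) → UMinus b) × UMinus b) ∈ meanSpan ι δ (UMinus b) := by
  obtain ⟨κ, e, d, he⟩ := exists_rootBasis b
  have hz : z ∈ Submodule.span ℂ (Set.range fun l : List κ => wordProd (l.map e)) := by
    rw [span_wordProd_basis]; trivial
  let T : UMinus b →ₗ[ℂ] ((ι → ℝ) → UMinus b) × UMinus b := (LinearMap.pi A).prod L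
  have hle : Submodule.span ℂ (Set.range fun l : List κ => wordProd (l.map e)) ≤
      (meanSpan ι δ (UMinus b)).comap T := by
    refine Submodule.span_le.2 ?_
    rintro _ ⟨l, rfl⟩
    have := h l.length (fun k => d (l.get k)) (fun k => e (l.get k)) fun k => he _
    have hl : List.ofFn (fun k => e (l.get k)) = l.map e := by
      have h1 := congrArg (List.map e) (List.ofFn_get l)
      rw [List.map_ofFn] at h1
      exact h1
    rw [hl] at this
    exact this
  exact hle hz

theorem lift_mem_meanSpan {M : Type*} [AddCommGroup M] [Module ℂ M]
    {A : (ι → ℝ) → UMinus b →ₗ[ℂ] UMinus b} {L : UMinus b →ₗ[ℂ] UMinus b}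
    (h : ∀ z, ((fun t => A t z, L z) : ((ι → ℝ) → UMinus b) × UMinus b) ∈
      meanSpan ι δ (UMinus b)) (act : UMinus b →ₗ[ℂ] Module.End ℂ M) (w : UMinus b ⊗[ℂ] M) :
    ((fun t => TensorProduct.lift (act ∘ₗ A t) w, TensorProduct.lift (act ∘ₗ L) w) :
      ((ι → ℝ) → M) × M) ∈ meanSpan ι δ M := by
  induction w using TensorProduct.induction_on with
  | zero =>
    convert (meanSpan ι δ M).zero_mem using 1
    simp; rfl
  | tmul z x => exact meanSpan_map (act.flip x) (h z)
  | add w w' hw hw' =>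
    convert add_mem hw hw' using 1
    simp; rfl

/-- The scalar product of the functions `ψ` as a value of the form: the counit, which is `S_μ(1, ·)`
for any `μ`, is applied to `wu`, and the antipode to `wv`. -/
theorem hasMean_integrand (hδ : 0 < δ) {M : Type*} [AddCommGroup M] [Module ℂ M]
    (S : M →ₗ[ℂ] M →ₗ[ℂ] ℂ) (π : 𝔤 →ₗ⁅ℂ⁆ Module.End ℂ M) (ξ μ : Module.Dual ℂ H)
    (wu wv : UMinus b ⊗[ℂ] M) :
    HasMean δ (integrand b S δ (psi b π ξ wu) (psi b π ξ wv))
      (S (TensorProduct.lid ℂ M (LinearMap.rTensor M (shapMinus b μ 1) wu)) (Qvec b π wv)) := by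
  classical
  set act : UMinus b →ₗ[ℂ] Module.End ℂ M :=
    (envAct π).toLinearMap ∘ₗ (envIncl (nMinus b)).toLinearMap with hact
  have hword : ∀ (m : ℕ) (F : Fin m → nMinus b),
      (LinearMap.toSpanSingleton ℂ (UMinus b) 1 ∘ₗ shapMinus b μ 1) (wordProd (List.ofFn F)) =
        if m = 0 then 1 else 0 := by
    intro m F
    rw [LinearMap.comp_apply]
    obtain _ | m := m
    · rw [List.ofFn_zero, wordProd_nil, shapMinus_one_one]
      simp
    · rw [List.ofFn_succ, wordProd_cons, shapMinus_one_ι_mul]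
      simp
  have h4 : ∀ w : UMinus b ⊗[ℂ] M, TensorProduct.lift
      (act ∘ₗ LinearMap.toSpanSingleton ℂ (UMinus b) 1 ∘ₗ shapMinus b μ 1) w =
      TensorProduct.lid ℂ M (LinearMap.rTensor M (shapMinus b μ 1) w) := by
    intro w
    induction w using TensorProduct.induction_on with
    | zero => simp
    | tmul z x => simp [hact]
    | add w w' hw hw' => simp only [map_add, hw, hw']
  have h1 := lift_mem_meanSpan b (mem_meanSpan_of_words (δ := δ) b
    (A := fun t => AX b (contourPoint b δ t))
    (L := LinearMap.toSpanSingleton ℂ (UMinus b) 1 ∘ₗ shapMinus b μ 1)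
    fun m β F hF => by rw [hword]; exact AX_contour_word_mem b hδ β F hF) act wu
  have h2 := lift_mem_meanSpan b (mem_meanSpan_of_words (δ := δ) b
    (A := fun t => AX b (-contourPoint b δ t)) (L := antipode (nMinus b))
    fun m β F hF => AX_neg_contour_word_mem b hδ β F hF) act wv
  have h3 := meanSpan_pairing S h1 h2
  simp only at h3
  rw [h4] at h3
  have hQ : Qvec b π wv = TensorProduct.lift (act ∘ₗ antipode (nMinus b)) wv := rfl
  rw [hQ]
  convert h3 using 1
  funext t
  -- the two exponentials in `ξ` cancel
  have h5 : Complex.exp (2 * Real.pi * Complex.I * ξ (-contourPoint b δ t)) *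
      Complex.exp (2 * Real.pi * Complex.I * ξ (contourPoint b δ t)) = 1 := by
    rw [← Complex.exp_add, map_neg]
    simp
  rw [integrand, psi, psi, map_smul, map_smul, LinearMap.smul_apply, smul_smul, h5, one_smul]
  rfl

end MeanAX

/-! ### Linear equations with vector-valued right hand sides -/

section LinearEquations

variable {I M : Type*} [Fintype I] [AddCommGroup M] [Module ℂ M]

/-- A linear system with vector-valued unknowns is solvable if each linear relation between the
rows of the matrix holds for the right hand side. -/
theorem exists_solution (S : I → I → ℂ) (f : I → M)
    (h : ∀ c : I → ℂ, (∀ l', ∑ l, c l * S l l' = 0) → ∑ l, c l • f l = 0) :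
    ∃ m : I → M, ∀ l, ∑ l', S l l' • m l' = f l := by
  classical
  let φ : (I → ℂ) →ₗ[ℂ] (I → ℂ) := Fintype.linearCombination ℂ S
  let ψ : (I → ℂ) →ₗ[ℂ] M := Fintype.linearCombination ℂ f
  have hker : ∀ c, φ c = 0 → ψ c = 0 := by
    intro c hc
    have h1 : ∀ l', ∑ l, c l * S l l' = 0 := fun l' => by
      have := congrFun hc l'
      simpa [φ, Fintype.linearCombination_apply, Finset.sum_apply] using this
    simpa [ψ, Fintype.linearCombination_apply] using h c h1
  obtain ⟨s, hs⟩ := φ.rangeRestrict.exists_rightInverse_of_surjective φ.range_rangeRestrict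
  obtain ⟨g, hg⟩ := LinearMap.exists_extend (ψ ∘ₗ s)
  have hgφ : ∀ c, g (φ c) = ψ c := by
    intro c
    have h1 : g (φ c) = ψ (s (φ.rangeRestrict c)) := LinearMap.congr_fun hg (φ.rangeRestrict c)
    have h2 : φ (s (φ.rangeRestrict c) - c) = 0 := by
      have := congrArg Subtype.val (LinearMap.congr_fun hs (φ.rangeRestrict c))
      rw [map_sub, sub_eq_zero]
      exact this
    have h3 := hker _ h2
    rw [map_sub, sub_eq_zero] at h3
    rw [h1, h3]
  refine ⟨fun l => g (Pi.single l 1), fun l => ?_⟩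
  have h1 := hgφ (Pi.single l 1)
  have h2 : φ (Pi.single l 1) = ∑ l', S l l' • Pi.single l' (1 : ℂ) := by
    ext j
    simp [φ, Pi.single_apply]
  have h3 : ψ (Pi.single l 1) = f l := by
    simp [ψ, Fintype.linearCombination_apply, Pi.single_apply]
  rw [h2, h3, map_sum] at h1
  simpa using h1

theorem exists_solution_mem (S : I → I → ℂ) (f : I → M) (W : Submodule ℂ M) (hf : ∀ l, f l ∈ W)
    (h : ∀ c : I → ℂ, (∀ l', ∑ l, c l * S l l' = 0) → ∑ l, c l • f l = 0) :
    ∃ m : I → M, (∀ l, m l ∈ W) ∧ ∀ l, ∑ l', S l l' • m l' = f l := by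
  obtain ⟨m, hm⟩ := exists_solution S (fun l => (⟨f l, hf l⟩ : W)) fun c hc => by
    ext
    simpa using h c hc
  refine ⟨fun l => m l, fun l => (m l).2, fun l => ?_⟩
  have := congrArg Subtype.val (hm l)
  simpa using this

end LinearEquations

/-! ### The kernel of the Shapovalov form -/

section Kernel

variable {𝔤 : Type*} [LieRing 𝔤] [LieAlgebra ℂ 𝔤] [FiniteDimensional ℂ 𝔤]
  [LieAlgebra.IsSimple ℂ 𝔤] {H : LieSubalgebra ℂ 𝔤} {ι : Type*} [Fintype ι]
  [H.IsCartanSubalgebra] (b : LieAlgebra.Basis ι H) {μ ν : Module.Dual ℂ H}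
  {M : Type*} [AddCommGroup M] [Module ℂ M] {π : 𝔤 →ₗ⁅ℂ⁆ Module.End ℂ M}

theorem omega_mem_range (x : UMinus b) :
    ∃ y, envIncl (nPlus b) y = omega b (envIncl (nMinus b) x) := by
  have hx : x ∈ ((envIncl (nPlus b)).range.comap
      ((omega b).comp (envIncl (nMinus b)))).toSubmodule := by
    refine env_left_induction lieSpan_univ_eq_top _ ?_ ?_ x
    · exact Subalgebra.one_mem _
    · intro x _ y hy
      refine Subalgebra.mul_mem _ ?_ hy
      refine ⟨𝓲 ⟨chevalley b x, chevalley_mem_nPlus b x.2⟩, ?_⟩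
      change envIncl (nPlus b) _ = omega b (envIncl (nMinus b) (𝓲 x))
      rw [envIncl_ι, envIncl_ι, omega_ι]
  exact hx

/-- `ω` maps the kernel of `S_μ` on `U(𝔫₋)` into the ideal `I_μ`, which annihilates `u`. -/
theorem omega_smul_eq_zero {x : UMinus b} (hx : shapMinus b μ x = 0) {u : M}
    (hu : u ∈ weightSpaceAnn b π ν μ) : envAct π (omega b (envIncl (nMinus b) x)) u = 0 := by
  obtain ⟨y, hy⟩ := omega_mem_range b x
  rw [← hy]
  refine hu.2 y fun z => ?_
  rw [hy]
  change vacuum b μ (tau b (envIncl (nMinus b) x) * z) = 0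
  have : z ∈ LinearMap.ker (vacuum b μ ∘ₗ LinearMap.mulLeft ℂ (tau b (envIncl (nMinus b) x))) := by
    refine triangular_induction b _ (fun a => ?_) (fun h y hy => ?_) (fun x hx y _ => ?_) z
    · exact LinearMap.congr_fun hx a
    · rw [LinearMap.mem_ker, LinearMap.comp_apply, LinearMap.mulLeft_apply] at hy ⊢
      rw [← mul_assoc, vacuum_mul_cartan, hy, mul_zero]
    · rw [LinearMap.mem_ker, LinearMap.comp_apply, LinearMap.mulLeft_apply, ← mul_assoc,
        vacuum_mul_nPlus b μ hx]
  exact this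

/-- A tensor on which all the forms `S_μ(x, ·)` vanish is in `Ker S_μ ⊗ M`. -/
theorem mem_span_ker_tmul {w : UMinus b ⊗[ℂ] M}
    (hw : ∀ x, TensorProduct.lid ℂ M (LinearMap.rTensor M (shapMinus b μ x) w) = 0) :
    w ∈ Submodule.span ℂ {t | ∃ (z : UMinus b) (m : M), shapMinus b μ z = 0 ∧ t = z ⊗ₜ[ℂ] m} := by
  classical
  let B := Module.Basis.ofVectorSpace ℂ M
  set F := TensorProduct.equivFinsuppOfBasisRight (M := UMinus b) B w with hF
  have hwF : w = F.sum fun i m => m ⊗ₜ[ℂ] B i := by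
    rw [← TensorProduct.equivFinsuppOfBasisRight_symm_apply, hF, LinearEquiv.symm_apply_apply]
  rw [hwF]
  refine sum_mem fun i hi => Submodule.subset_span ⟨F i, B i, ?_, rfl⟩
  ext y
  rw [shapMinus_symm, LinearMap.zero_apply]
  have h1 := hw y
  rw [hwF, Finsupp.sum, map_sum, map_sum] at h1
  simp only [LinearMap.rTensor_tmul, TensorProduct.lid_tmul] at h1
  exact linearIndependent_iff'.1 B.linearIndependent F.support _ h1 i hi

end Kernel

section Independence

variable {𝔤 : Type*} [LieRing 𝔤] [LieAlgebra ℂ 𝔤] [FiniteDimensional ℂ 𝔤]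
  [LieAlgebra.IsSimple ℂ 𝔤] {H : LieSubalgebra ℂ 𝔤} {ι : Type*} [Fintype ι]
  [H.IsCartanSubalgebra] (b : LieAlgebra.Basis ι H) {μ ν : Module.Dual ℂ H}
  {n : ℕ} {V : Fin n → Type*}
  [∀ p, AddCommGroup (V p)] [∀ p, Module ℂ (V p)]
  [∀ p, LieRingModule 𝔤 (V p)] [∀ p, LieModule ℂ 𝔤 (V p)]
  {Λ : Fin n → Module.Dual ℂ H} {v₀ : ∀ p, V p}

theorem antipode_envIncl {L : Type*} [LieRing L] [LieAlgebra ℂ L] (n : LieSubalgebra ℂ L)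
    (x : 𝓤 n) : envIncl n (antipode n x) = antipode L (envIncl n x) := by
  have hx : x ∈ LinearMap.eqLocus ((envIncl n).toLinearMap ∘ₗ antipode n)
      (antipode L ∘ₗ (envIncl n).toLinearMap) := by
    refine env_left_induction lieSpan_univ_eq_top _ ?_ (fun x _ y hy => ?_) x
    · simp [LinearMap.mem_eqLocus, antipode_one]
    · simp only [LinearMap.mem_eqLocus, LinearMap.comp_apply, AlgHom.toLinearMap_apply] at hy ⊢
      rw [antipode_mul, map_mul, map_mul, antipode_mul, hy, antipode_ι, map_neg, envIncl_ι,
        antipode_ι]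
  exact hx

/-- Elements of `Ker S_μ ⊗ V` do not contribute to `S(u, 𝒬 w)`: for `z ∈ Ker S_μ` one has
`S(u, a(z) m) = S(ω(z) u, m) = 0`. -/
theorem shapTensor_Qvec_eq_zero (hV : ∀ p, IsHighestWeight b (Λ p) (v₀ p))
    {u : ⨂[ℂ] p, V p} (hu : u ∈ weightSpaceAnn b (tensorRep V 𝔤) ν μ)
    {w : UMinus b ⊗[ℂ] (⨂[ℂ] p, V p)}
    (hw : ∀ x, TensorProduct.lid ℂ _ (LinearMap.rTensor _ (shapMinus b μ x) w) = 0) :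
    shapTensor b V Λ v₀ u (Qvec b (tensorRep V 𝔤) w) = 0 := by
  refine (Submodule.span_le (p := LinearMap.ker
    (shapTensor b V Λ v₀ u ∘ₗ Qvec b (tensorRep V 𝔤)))).2 ?_ (mem_span_ker_tmul b hw)
  rintro _ ⟨z, m, hz, rfl⟩
  have h1 : Qvec b (tensorRep V 𝔤) (z ⊗ₜ[ℂ] m) =
      envAct (tensorRep V 𝔤) (tau b (omega b (envIncl (nMinus b) z))) m := by
    rw [tau_apply, omega_omega, ← antipode_envIncl]
    rfl
  rw [SetLike.mem_coe, LinearMap.mem_ker, LinearMap.comp_apply, h1, ← shapTensor_env b hV,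
    omega_smul_eq_zero b hz hu, map_zero, LinearMap.zero_apply]

end Independence

/-! ### Weights of words in root vectors -/

section WordWeights

variable {𝔤 : Type*} [LieRing 𝔤] [LieAlgebra ℂ 𝔤] [FiniteDimensional ℂ 𝔤]
  [LieAlgebra.IsSimple ℂ 𝔤] {H : LieSubalgebra ℂ 𝔤} {ι : Type*} [Fintype ι]
  [H.IsCartanSubalgebra] (b : LieAlgebra.Basis ι H) {μ : Module.Dual ℂ H}
  {M : Type*} [AddCommGroup M] [Module ℂ M] {π : 𝔤 →ₗ⁅ℂ⁆ Module.End ℂ M}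
  {κ : Type*} {e : Module.Basis κ ℂ (nMinus b)} {d : κ → LieModule.Weight ℂ H 𝔤}

/-- The sum of the positive roots attached to the letters of a word. -/
noncomputable def rootSum (d : κ → LieModule.Weight ℂ H 𝔤) (l : List κ) : Module.Dual ℂ H :=
  (l.map fun k => (d k).toLinear).sum

/-- A word is a weight vector for the adjoint action of `𝔥`. -/
theorem cartan_mul_word
    (he : ∀ k, d k ∈ posRoots b ∧ (e k : 𝔤) ∈ LieAlgebra.rootSpace H (-(d k : H → ℂ)))
    (h : H) (l : List κ) :
    𝓲 (h : 𝔤) * envIncl (nMinus b) (wordProd (l.map e)) =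
      envIncl (nMinus b) (wordProd (l.map e)) * 𝓲 (h : 𝔤) -
        rootSum d l h • envIncl (nMinus b) (wordProd (l.map e)) := by
  induction l with
  | nil => simp [rootSum]
  | cons k l ih =>
    have h1 : 𝓲 (h : 𝔤) * 𝓲 (e k : 𝔤) = 𝓲 (e k : 𝔤) * 𝓲 (h : 𝔤) - d k h • 𝓲 (e k : 𝔤) := by
      have h2 := env_ι_lie (h : 𝔤) (e k : 𝔤)
      rw [lie_of_mem_rootSpace (he k).2, map_smul, Pi.neg_apply, neg_smul] at h2
      rw [sub_eq_add_neg, h2]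
      abel
    have h3 : rootSum d (k :: l) h = d k h + rootSum d l h := by
      simp [rootSum]
    rw [List.map_cons, wordProd_cons, map_mul, envIncl_ι, ← mul_assoc, h1, sub_mul, mul_assoc, ih,
      h3, mul_sub, smul_mul_assoc, mul_smul_comm, add_smul, mul_assoc]
    abel

/-- Words of different weights are orthogonal for the Shapovalov form. -/
theorem shapMinus_word_eq_zero
    (he : ∀ k, d k ∈ posRoots b ∧ (e k : 𝔤) ∈ LieAlgebra.rootSpace H (-(d k : H → ℂ)))
    {l l' : List κ} (hne : rootSum d l ≠ rootSum d l') :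
    shapMinus b μ (wordProd (l.map e)) (wordProd (l'.map e)) = 0 := by
  obtain ⟨h, hh⟩ : ∃ h, rootSum d l h ≠ rootSum d l' h := by
    by_contra! hc
    exact hne (LinearMap.ext hc)
  set Z := envIncl (nMinus b) (wordProd (l.map e)) with hZ
  set Z' := envIncl (nMinus b) (wordProd (l'.map e)) with hZ'
  have h1 := congrArg (tau b) (cartan_mul_word b he h l)
  rw [← hZ, map_sub, tau_mul, tau_mul, map_smul, tau_ι, chevalley_cartan, map_neg, neg_neg] at h1
  have h2 := cartan_mul_word b he h l'
  rw [← hZ'] at h2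
  have h3 : vacuum b μ (tau b Z * 𝓲 (h : 𝔤) * Z') =
      (μ h - rootSum d l h) * vacuum b μ (tau b Z * Z') := by
    rw [h1, sub_mul, map_sub, mul_assoc, vacuum_cartan_mul, smul_mul_assoc, map_smul, smul_eq_mul,
      sub_mul]
  have h4 : vacuum b μ (tau b Z * 𝓲 (h : 𝔤) * Z') =
      (μ h - rootSum d l' h) * vacuum b μ (tau b Z * Z') := by
    rw [mul_assoc, h2, mul_sub, map_sub, ← mul_assoc, vacuum_mul_cartan, mul_smul_comm, map_smul,
      smul_eq_mul, sub_mul]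
  change vacuum b μ (tau b Z * Z') = 0
  have h5 : (rootSum d l h - rootSum d l' h) * vacuum b μ (tau b Z * Z') = 0 := by
    linear_combination h3 - h4
  exact (mul_eq_zero.1 h5).resolve_left (sub_ne_zero.2 hh)

/-- If `u` has weight zero, then `ω(z) u` has the weight of `ω(z)`, for a word `z`. -/
theorem omega_word_weight
    (he : ∀ k, d k ∈ posRoots b ∧ (e k : 𝔤) ∈ LieAlgebra.rootSpace H (-(d k : H → ℂ)))
    {u : M} (hu : u ∈ weightSpace H π 0) (l : List κ) :
    envAct π (omega b (envIncl (nMinus b) (wordProd (l.map e)))) u ∈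
      weightSpace H π (rootSum d l) := by
  intro h
  have h1 := congrArg (omega b) (cartan_mul_word b he h l)
  rw [map_sub, map_mul, map_mul, map_smul, omega_ι, chevalley_cartan, map_neg] at h1
  set Z := omega b (envIncl (nMinus b) (wordProd (l.map e)))
  have h2 : 𝓲 (h : 𝔤) * Z = Z * 𝓲 (h : 𝔤) + rootSum d l h • Z := by
    rw [neg_mul, mul_neg] at h1
    rw [← neg_inj, h1]
    abel
  have h3 : π h u = 0 := by
    have := hu h
    simpa using this
  rw [← envAct_ι, ← Module.End.mul_apply, ← map_mul, h2, map_add, map_mul, LinearMap.add_apply,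
    Module.End.mul_apply, envAct_ι, h3, map_zero, zero_add, map_smul]
  rfl

/-- The height of the weight of a word bounds its length. -/
theorem length_le_rootSum
    (he : ∀ k, d k ∈ posRoots b ∧ (e k : 𝔤) ∈ LieAlgebra.rootSpace H (-(d k : H → ℂ)))
    (l : List κ) : ∃ N : ℕ, l.length ≤ N ∧ rootSum d l (heightElt b) = N := by
  induction l with
  | nil => exact ⟨0, le_rfl, by simp [rootSum]⟩
  | cons k l ih =>
    obtain ⟨N, hN, hl⟩ := ih
    obtain ⟨n, hn, hk⟩ := posRoot_heightElt b (he k).1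
    refine ⟨n + N, by simp; omega, ?_⟩
    have h3 : rootSum d (k :: l) (heightElt b) =
        d k (heightElt b) + rootSum d l (heightElt b) := by
      simp [rootSum]
    rw [h3, hk, hl]
    push_cast
    rfl

/-- The words of a given weight contribute a tensor which satisfies the equations for these
words, and on which the forms `S_μ(x, ·)` for the words `x` of other weights vanish. -/
theorem exists_xi_of_weight
    (he : ∀ k, d k ∈ posRoots b ∧ (e k : 𝔤) ∈ LieAlgebra.rootSpace H (-(d k : H → ℂ)))
    {u : M} (hu : u ∈ weightSpaceAnn b π 0 μ) (ν : Module.Dual ℂ H) :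
    ∃ w ∈ weightZero b π, ∀ l : List κ,
      TensorProduct.lid ℂ M (LinearMap.rTensor M (shapMinus b μ (wordProd (l.map e))) w) =
        open Classical in if rootSum d l = ν then
          envAct π (omega b (envIncl (nMinus b) (wordProd (l.map e)))) u else 0 := by
  classical
  have : Finite κ := Module.Finite.finite_basis e
  have hfin : {l : List κ | rootSum d l = ν}.Finite := by
    obtain ⟨N, hN⟩ := exists_nat_ge ‖ν (heightElt b)‖
    refine (List.finite_length_le κ N).subset fun l hl => ?_
    obtain ⟨n, hn, hl'⟩ := length_le_rootSum b he l
    rw [show rootSum d l = ν from hl] at hl'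
    rw [hl', Complex.norm_natCast] at hN
    exact hn.trans (by exact_mod_cast hN)
  have := hfin.fintype
  let I := {l : List κ | rootSum d l = ν}
  let z : List κ → UMinus b := fun l => wordProd (l.map e)
  let W : Submodule ℂ M :=
    { carrier := weightSpace H π ν
      add_mem' := fun {x y} hx hy h => by rw [map_add, hx h, hy h, smul_add]
      zero_mem' := fun h => by rw [map_zero, smul_zero]
      smul_mem' := fun c x hx h => by rw [map_smul, hx h, smul_comm] }
  obtain ⟨m, hmW, hm⟩ := exists_solution_mem (I := I)
    (fun l l' => shapMinus b μ (z l) (z l'))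
    (fun l => envAct π (omega b (envIncl (nMinus b) (z l))) u) W
    (fun l => by
      have := omega_word_weight b he hu.1 l.1
      rw [show rootSum d l.1 = ν from l.2] at this
      exact this) (fun c hc => by
      -- a relation between the rows of the matrix is an element of `Ker S_μ`
      have hker : shapMinus b μ (∑ l, c l • z l) = 0 := by
        have hz : ∀ l', shapMinus b μ (∑ l, c l • z l) (z l') = 0 := by
          intro l'
          have h1 : shapMinus b μ (∑ l, c l • z l) (z l') =
              ∑ l, c l * shapMinus b μ (z l) (z l') := by
            rw [shapMinus_symm, map_sum]
            refine Finset.sum_congr rfl fun l _ => ?_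
            rw [map_smul, smul_eq_mul, shapMinus_symm]
          rw [h1]
          by_cases hl' : rootSum d l' = ν
          · exact hc ⟨l', hl'⟩
          · refine Finset.sum_eq_zero fun l _ => ?_
            have hne : rootSum d l.1 ≠ rootSum d l' := by
              rw [show rootSum d l.1 = ν from l.2]
              exact fun h => hl' h.symm
            rw [shapMinus_word_eq_zero b he hne, mul_zero]
        ext y
        have hy : y ∈ Submodule.span ℂ (Set.range fun l : List κ => wordProd (l.map e)) := by
          rw [span_wordProd_basis]; trivial
        refine (Submodule.span_le (p := LinearMap.ker (shapMinus b μ (∑ l, c l • z l)))).2 ?_ hy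
        rintro _ ⟨l', rfl⟩
        exact hz l'
      have := omega_smul_eq_zero b hker hu
      rw [map_sum, map_sum, map_sum, LinearMap.sum_apply] at this
      simpa using this)
  refine ⟨∑ l, z l.1 ⊗ₜ[ℂ] m l, sum_mem fun l _ => Submodule.subset_span
    ⟨l.1.length, fun k => d (l.1.get k), fun k => e (l.1.get k), m l, fun k => he _, ?_, ?_⟩,
    fun l => ?_⟩
  · have h1 : ∑ k, (d (l.1.get k)).toLinear = ν := by
      rw [← List.sum_ofFn]
      have h2 := congrArg (List.map fun k => (d k).toLinear) (List.ofFn_get l.1)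
      rw [List.map_ofFn] at h2
      refine Eq.trans ?_ (show rootSum d l.1 = ν from l.2)
      rw [rootSum, ← h2]
      rfl
    rw [h1]
    exact hmW l
  · congr 1
    have h2 := congrArg (List.map fun k => 𝓲 (e k)) (List.ofFn_get l.1)
    rw [List.map_ofFn] at h2
    change ((l.1.map e).map 𝓲).prod = _
    rw [List.map_map]
    exact congrArg List.prod h2.symm
  · rw [map_sum, map_sum]
    simp only [LinearMap.rTensor_tmul, TensorProduct.lid_tmul]
    split_ifs with hl
    · exact hm ⟨l, hl⟩
    · refine Finset.sum_eq_zero fun l' _ => ?_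
      rw [shapMinus_word_eq_zero b he, zero_smul]
      rw [show rootSum d l'.1 = ν from l'.2]
      exact hl

/-- The equations for `w` need only be checked on words. -/
theorem isXi_of_words {u : M} {w : UMinus b ⊗[ℂ] M} (hw : w ∈ weightZero b π)
    (h : ∀ l : List κ,
      TensorProduct.lid ℂ M (LinearMap.rTensor M (shapMinus b μ (wordProd (l.map e))) w) =
          envAct π (omega b (envIncl (nMinus b) (wordProd (l.map e)))) u) :
    IsXi b π μ u w := by
  refine ⟨hw, fun x => ?_⟩
  have hx : x ∈ Submodule.span ℂ (Set.range fun l : List κ => wordProd (l.map e)) := by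
    rw [span_wordProd_basis]; trivial
  have hadd : ∀ x y, shapMinus b μ (x + y) = shapMinus b μ x + shapMinus b μ y := fun x y => by
    ext z
    rw [shapMinus_symm, map_add, LinearMap.add_apply, shapMinus_symm, shapMinus_symm b μ z]
  have hsmul : ∀ (c : ℂ) x, shapMinus b μ (c • x) = c • shapMinus b μ x := fun c x => by
    ext z
    rw [shapMinus_symm, map_smul, LinearMap.smul_apply, shapMinus_symm]
  have hzero : shapMinus b μ 0 = 0 := by
    ext z
    rw [shapMinus_symm, map_zero, LinearMap.zero_apply]
  induction hx using Submodule.span_induction with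
  | mem x hx => obtain ⟨l, rfl⟩ := hx; exact h l
  | zero => simp [hzero]
  | add x y _ _ hx hy =>
    simp only [hadd, LinearMap.rTensor_add, LinearMap.add_apply, map_add, hx, hy]
  | smul c x _ hx =>
    simp only [hsmul, LinearMap.rTensor_smul, LinearMap.smul_apply, map_smul, hx]

/-- If the eigenvalues of the height element are bounded above, then the Shapovalov equations have
a solution of weight zero. -/
theorem exists_isXi {C : ℂ}
    (hC : ∀ x : M, x ∈ eigenSpan (π (heightElt b)) (Set.range fun k : ℕ => C - k))
    {u : M} (hu : u ∈ weightSpaceAnn b π 0 μ) : ∃ w, IsXi b π μ u w := by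
  classical
  obtain ⟨κ, e, d, he⟩ := exists_rootBasis b
  have : Finite κ := Module.Finite.finite_basis e
  -- for a word `z` longer than `N`, the vector `ω(z) u` would have height above `Re C`, so it is
  -- zero; hence only finitely many weights matter
  obtain ⟨N, hN⟩ := exists_nat_ge C.re
  have hzero : ∀ l : List κ, N < l.length →
      envAct π (omega b (envIncl (nMinus b) (wordProd (l.map e)))) u = 0 := by
    intro l hl
    obtain ⟨n, hn, hl'⟩ := length_le_rootSum b he l
    have h1 := omega_word_weight b he hu.1 l (heightElt b)
    rw [hl'] at h1
    refine eigenSpan_eq_zero ?_ h1 (hC _)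
    rintro ⟨k, hk⟩
    have h2 : C.re = n + k := by
      have := congrArg Complex.re hk
      simp at this
      linarith
    have h3 : (N : ℝ) < n := by exact_mod_cast hl.trans_le hn
    have h4 : (0 : ℝ) ≤ k := Nat.cast_nonneg k
    linarith
  choose w hw0 hw using fun ν => exists_xi_of_weight b he hu ν
  have hfin := List.finite_length_le κ N
  let T : Finset (Module.Dual ℂ H) := hfin.toFinset.image (rootSum d)
  refine ⟨∑ ν ∈ T, w ν, isXi_of_words (e := e) b (sum_mem fun ν _ => hw0 ν) fun l => ?_⟩
  rw [map_sum, map_sum]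
  simp only [hw]
  rw [Finset.sum_ite_eq]
  split_ifs with hl
  · rfl
  · refine (hzero l ?_).symm
    by_contra hc
    exact hl (Finset.mem_image_of_mem _ (hfin.mem_toFinset.2 (not_lt.1 hc)))

end WordWeights

/-! ### Regular values -/

section Regular

variable {𝔤 : Type*} [LieRing 𝔤] [LieAlgebra ℂ 𝔤] [FiniteDimensional ℂ 𝔤]
  [LieAlgebra.IsSimple ℂ 𝔤] {H : LieSubalgebra ℂ 𝔤} {ι : Type*} [Fintype ι]
  [H.IsCartanSubalgebra] (b : LieAlgebra.Basis ι H) {μ : Module.Dual ℂ H}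
  {M : Type*} [AddCommGroup M] [Module ℂ M] {π : 𝔤 →ₗ⁅ℂ⁆ Module.End ℂ M}

/-- The restriction of polynomials on `𝔥*` to the line `μ + s ν`. -/
theorem exists_line_restriction (b : LieAlgebra.Basis ι H) (μ ν : Module.Dual ℂ H) (R : 𝓤 H) :
    ∃ p : Polynomial ℂ, ∀ s, p.eval s = evalAt (μ + s • ν) R := by
  let L : H →ₗ[ℂ] Polynomial ℂ :=
    (Algebra.linearMap ℂ (Polynomial ℂ)) ∘ₗ μ +
      (LinearMap.toSpanSingleton ℂ (Polynomial ℂ) Polynomial.X) ∘ₗ ν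
  have hab := b.isLieAbelian_cartan
  let ℓ : H →ₗ⁅ℂ⁆ Polynomial ℂ :=
    { toFun := L
      map_add' := L.map_add
      map_smul' := L.map_smul
      map_lie' := fun {x y} => by
        rw [trivial_lie_zero, map_zero, LieRing.of_associative_ring_bracket, mul_comm, sub_self] }
  refine ⟨UniversalEnvelopingAlgebra.lift ℂ ℓ R, fun s => ?_⟩
  have h : (Polynomial.aeval s).comp (UniversalEnvelopingAlgebra.lift ℂ ℓ) =
      evalAt (μ + s • ν) := by
    refine UniversalEnvelopingAlgebra.hom_ext (R := ℂ) (L := H) (A := ℂ) ?_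
    ext x
    change Polynomial.aeval s (UniversalEnvelopingAlgebra.lift ℂ ℓ (𝓲 x)) =
      evalAt (μ + s • ν) (𝓲 x)
    rw [UniversalEnvelopingAlgebra.lift_ι_apply, evalAt_ι]
    change Polynomial.aeval s (L x) = _
    simp [L, mul_comm]
  have := DFunLike.congr_fun h R
  rw [← this]
  simp

/-- A polynomial on `𝔥*` which vanishes at the generic points is zero. -/
theorem evalAt_eq_zero_of_generic {R : 𝓤 H} (hR : ∀ lam, IsGeneric b lam → evalAt lam R = 0)
    (μ : Module.Dual ℂ H) : evalAt μ R = 0 := by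
  obtain ⟨ν, hν⟩ := Module.exists_dual_forall_apply_ne_zero (K := ℂ)
    (fun α : posRoots b => (LieAlgebra.IsKilling.coroot α.1 : H)) (by
      rintro ⟨α, hα⟩ h
      have h1 := ((mem_posRoots b α).1 hα).1
      simp only [LieSubalgebra.root, Finset.mem_filter, Finset.mem_univ, true_and] at h1
      exact h1 (LieAlgebra.IsKilling.coroot_eq_zero_iff.1 h))
  obtain ⟨p, hp⟩ := exists_line_restriction b μ ν R
  -- a line through `μ` in a direction `ν` on which no coroot vanishes meets the excluded
  -- hyperplanes in countably many points
  let bad : Set ℂ := ⋃ (α : posRoots b) (k : ℕ),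
    {(k - (μ + rho b) (LieAlgebra.IsKilling.coroot α.1)) / ν (LieAlgebra.IsKilling.coroot α.1)}
  have hbad : bad.Countable :=
    Set.countable_iUnion fun _ => Set.countable_iUnion fun _ => Set.countable_singleton _
  have hinf : (badᶜ).Infinite := by
    intro hf
    have : (Set.univ : Set ℂ).Countable := by
      rw [← Set.union_compl_self bad]
      exact hbad.union hf.countable
    exact not_countable_complex this
  have hp0 : p = 0 := by
    refine Polynomial.eq_zero_of_infinite_isRoot p (hinf.mono fun s hs => ?_)
    change p.eval s = 0
    rw [hp]
    refine hR _ fun α hα k _ h => hs ?_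
    refine Set.mem_iUnion.2 ⟨⟨α, hα⟩, Set.mem_iUnion.2 ⟨k, ?_⟩⟩
    rw [Set.mem_singleton_iff, eq_div_iff (hν ⟨α, hα⟩)]
    simp only [LinearMap.add_apply, LinearMap.smul_apply, smul_eq_mul] at h ⊢
    linear_combination h
  have := hp 0
  rw [hp0, zero_smul, add_zero, Polynomial.eval_zero] at this
  exact this.symm

/-- A regular value of the rational function solves the Shapovalov equations. Paired with linear
forms, the equations multiplied by `q` are polynomial identities; they hold at the generic points,
hence at `μ`, where `q` does not vanish. -/
theorem IsRegularXiValue.isXi {u : M} {w : UMinus b ⊗[ℂ] M}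
    (h : IsRegularXiValue b π μ u w) : IsXi b π μ u w := by
  obtain ⟨N, q, p, t, hq, hgen, rfl⟩ := h
  have key : ∀ R : 𝓤 H, (∀ lam, IsGeneric b lam → evalAt lam q ≠ 0 → evalAt lam R = 0) →
      evalAt μ R = 0 := by
    intro R hR
    have h1 := evalAt_eq_zero_of_generic b (R := q * R) (fun lam hlam => by
      rw [map_mul]
      by_cases h : evalAt lam q = 0
      · rw [h, zero_mul]
      · rw [hR lam hlam h, mul_zero]) μ
    rw [map_mul] at h1
    exact (mul_eq_zero.1 h1).resolve_left hq
  constructor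
  · refine Submodule.smul_mem _ _ ?_
    -- a linear form that separates the value from the weight zero part would give a polynomial that
    -- vanishes at the generic points but not at `μ`
    by_contra hc
    obtain ⟨φ, hφ, hle⟩ := Submodule.exists_le_ker_of_notMem hc
    apply hφ
    have h1 : ∀ lam, φ (∑ i, evalAt lam (p i) • t i) = evalAt lam (∑ i, φ (t i) • p i) := by
      intro lam
      simp only [map_sum, map_smul, smul_eq_mul, mul_comm]
    rw [h1]
    refine key _ fun lam hlam hl => ?_
    rw [← h1]
    have h2 := (hgen lam hlam hl).1
    have h3 := Submodule.smul_mem _ (evalAt lam q) h2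
    rw [smul_smul, mul_inv_cancel₀ hl, one_smul] at h3
    exact hle h3
  · intro x
    rw [map_smul, map_smul, inv_smul_eq_iff₀ hq, ← sub_eq_zero,
      ← Module.forall_dual_apply_eq_zero_iff ℂ]
    intro φ
    set y := envAct π (omega b (envIncl (nMinus b) x)) u with hy
    let P : 𝓤 H := ∑ i, p i * gammaProj b (tau b (envIncl (nMinus b) x) *
      envIncl (nMinus b) (TensorProduct.rid ℂ _ (LinearMap.lTensor _ φ (t i)))) - φ y • q
    have h0 : ∀ (lam : Module.Dual ℂ H) (s : UMinus b ⊗[ℂ] M),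
        φ (TensorProduct.lid ℂ M (LinearMap.rTensor M (shapMinus b lam x) s)) =
          shapMinus b lam x (TensorProduct.rid ℂ _ (LinearMap.lTensor _ φ s)) := by
      intro lam s
      induction s using TensorProduct.induction_on with
      | zero => simp
      | tmul z m => simp [mul_comm]
      | add s s' hs hs' => simp only [map_add, hs, hs']
    have h1 : ∀ lam, φ (TensorProduct.lid ℂ M (LinearMap.rTensor M (shapMinus b lam x)
        (∑ i, evalAt lam (p i) • t i)) - evalAt lam q • y) = evalAt lam P := by
      intro lam
      simp only [map_sub, map_sum, map_smul, P, map_mul, h0, smul_eq_mul]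
      rw [mul_comm (φ y)]
      rfl
    rw [h1]
    refine key _ fun lam hlam hl => ?_
    rw [← h1]
    have h2 := (hgen lam hlam hl).2 x
    rw [map_smul, map_smul, inv_smul_eq_iff₀ hl, ← sub_eq_zero] at h2
    rw [h2, map_zero]

end Regular

end TrigKZB

theorem proposition5p12
    {𝔤 : Type*} [LieRing 𝔤] [LieAlgebra ℂ 𝔤] [FiniteDimensional ℂ 𝔤] [LieAlgebra.IsSimple ℂ 𝔤]
    {H : LieSubalgebra ℂ 𝔤} [H.IsCartanSubalgebra]
    {ι : Type*} [Fintype ι] (b : LieAlgebra.Basis ι H)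
    {n : ℕ} (hn : 1 ≤ n) (V : Fin n → Type*)
    [∀ p, AddCommGroup (V p)] [∀ p, Module ℂ (V p)]
    [∀ p, LieRingModule 𝔤 (V p)] [∀ p, LieModule ℂ 𝔤 (V p)]
    (Λ : Fin n → Module.Dual ℂ H) (v₀ : ∀ p, V p)
    (hV : ∀ p, TrigKZB.IsHighestWeight b (Λ p) (v₀ p))
    (ξ : Module.Dual ℂ H) :
    (∀ u ∈ TrigKZB.weightSpaceAnn b (TrigKZB.tensorRep V 𝔤) 0 (ξ - TrigKZB.rho b),
      (∃ w, TrigKZB.IsXi b (TrigKZB.tensorRep V 𝔤) (ξ - TrigKZB.rho b) u w) ∧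
      (∀ w, TrigKZB.IsRegularXiValue b (TrigKZB.tensorRep V 𝔤) (ξ - TrigKZB.rho b) u w →
        TrigKZB.IsXi b (TrigKZB.tensorRep V 𝔤) (ξ - TrigKZB.rho b) u w)) ∧
    (∀ u ∈ TrigKZB.weightSpaceAnn b (TrigKZB.tensorRep V 𝔤) 0 (ξ - TrigKZB.rho b),
      ∀ v ∈ TrigKZB.weightSpaceAnn b (TrigKZB.tensorRep V 𝔤) 0 (ξ - TrigKZB.rho b),
      ∀ wu wv wv' : TrigKZB.UMinus b ⊗[ℂ] (⨂[ℂ] p, V p),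
        TrigKZB.IsXi b (TrigKZB.tensorRep V 𝔤) (ξ - TrigKZB.rho b) u wu →
        TrigKZB.IsXi b (TrigKZB.tensorRep V 𝔤) (ξ - TrigKZB.rho b) v wv →
        TrigKZB.IsXi b (TrigKZB.tensorRep V 𝔤) (ξ - TrigKZB.rho b) v wv' →
        ∀ δ : ℝ, 0 < δ →
          MeasureTheory.IntegrableOn
            (TrigKZB.integrand b (TrigKZB.shapTensor b V Λ v₀) δ
              (TrigKZB.psi b (TrigKZB.tensorRep V 𝔤) ξ wu)
              (TrigKZB.psi b (TrigKZB.tensorRep V 𝔤) ξ wv))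
            (Set.Icc (0 : ι → ℝ) 1) ∧
          TrigKZB.scalarProduct b (TrigKZB.shapTensor b V Λ v₀) δ
              (TrigKZB.psi b (TrigKZB.tensorRep V 𝔤) ξ wu)
              (TrigKZB.psi b (TrigKZB.tensorRep V 𝔤) ξ wv) =
            TrigKZB.shapTensor b V Λ v₀ u
              (TrigKZB.Qvec b (TrigKZB.tensorRep V 𝔤) wv')) := by
  refine ⟨fun u hu => ⟨?_, fun w hw => hw.isXi b⟩, fun u hu v hv wu wv wv' hwu hwv hwv' δ hδ => ?_⟩
  · exact TrigKZB.exists_isXi b (TrigKZB.tensor_mem_eigenSpan b hV) hu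
  · have hmean := TrigKZB.hasMean_integrand b hδ (TrigKZB.shapTensor b V Λ v₀)
      (TrigKZB.tensorRep V 𝔤) ξ (ξ - TrigKZB.rho b) wu wv
    have hu1 := hwu.2 1
    rw [map_one, map_one, map_one, Module.End.one_apply] at hu1
    have hQ : TrigKZB.shapTensor b V Λ v₀ u (TrigKZB.Qvec b (TrigKZB.tensorRep V 𝔤) wv) =
        TrigKZB.shapTensor b V Λ v₀ u (TrigKZB.Qvec b (TrigKZB.tensorRep V 𝔤) wv') := by
      rw [← sub_eq_zero, ← map_sub, ← map_sub]
      refine TrigKZB.shapTensor_Qvec_eq_zero b hV hu fun x => ?_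
      rw [map_sub, map_sub, hwv.2 x, hwv'.2 x, sub_self]
    rw [hu1, hQ] at hmean
    exact ⟨hmean.integrableOn, hmean.integral_eq⟩
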